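/- **Packing points into axis-parallel rectangles.** An instance consists of $n$ points $p_1,\dots,p_n$ in the plane with rational coordinates and rational weights $w_1,\dots,w_n$, and of $m$ closed axis-parallel rectangles $b_1,\dots,b_m$ with rational sides and with arbitrary positive integer capacities $\mathrm{cap}(b_1),\dots,\mathrm{cap}(b_m)$. A set $O$ of points is feasible if every $b_j$ contains at most $\mathrm{cap}(b_j)$ points of $O$; $\mathrm{Opt}$ is the maximum total weight of a feasible set. The LP relaxation is: maximize $\sum_i w_i x_i$ subject to $\sum_{i:\,p_i\in b_j} x_i\le \mathrm{cap}(b_j)$ for all $j$ and $0\le x_i\le 1$ for all $i$. The energy of an LP solution $x$ is $\mathcal E(x)=\sum_i x_i$. **Theorem.** There are an absolute constant $C>0$ and a deterministic polynomial-time algorithm (polynomial in the bit length of the instance, whose rational numbers are given by numerators and denominators in binary; running time is measured on a random access machine with logarithmic cost) that computes, for every instance, a set $S$ of points which is an $(O(\log\mathcal E),2)$-approximation to the optimal solution. That is, for every optimal solution $x$ of the LP relaxation, with energy $\mathcal E=\mathcal E(x)$, $$\sum_{i\in S}w_i\;\ge\;\frac{\mathrm{Opt}}{C\,\max(1,\log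 \mathcal E)},$$ and every rectangle $b_j$ contains at most $\max(2,\mathrm{cap}(b_j))$ points of $S$. -/

import Mathlib

/-! ### A random access machine with logarithmic cost -/

namespace Ram

/-- The memory: named arrays of integer cells,
`s a i` being the content of cell `i` of array `a`. A program can mention only finitely many
arrays, since array names in programs are constants. -/
abbrev Store := ℕ → ℤ → ℤ

/-- Integer expressions. `load a i` is the content of cell `i` of array `a` (indirect addressing);
a scalar variable is an array of which only one cell is used. -/
inductive Expr where
  | lit (z : ℤ)
  | load (a : ℕ) (i : Expr)
  | add (e f : Expr)
  | sub (e f : Expr)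
  | mul (e f : Expr)
  | div (e f : Expr)

/-- The value of an expression; `div` is integer division, with value `0` for the divisor `0`. -/
def Expr.eval (s : Store) : Expr → ℤ
  | .lit z => z
  | .load a i => s a (i.eval s)
  | .add e f => e.eval s + f.eval s
  | .sub e f => e.eval s - f.eval s
  | .mul e f => e.eval s * f.eval s
  | .div e f => e.eval s / f.eval s

/-- Length of the binary representation of an integer, with a bit for the sign. -/
def bits (z : ℤ) : ℕ := Nat.size z.natAbs + 1

/-- The cost of evaluating an expression: every literal, every address, every memory access and
every operation is charged the bit length of its value. In particular, operands of an
operation and addresses are paid for bit by bit. -/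
def Expr.cost (s : Store) : Expr → ℕ
  | .lit z => bits z
  | .load a i => i.cost s + bits (s a (i.eval s))
  | .add e f => e.cost s + f.cost s + bits (e.eval s + f.eval s)
  | .sub e f => e.cost s + f.cost s + bits (e.eval s - f.eval s)
  | .mul e f => e.cost s + f.cost s + bits (e.eval s * f.eval s)
  | .div e f => e.cost s + f.cost s + bits (e.eval s / f.eval s)

/-- Programs. The tests of `branch` and `loop` ask whether the expression is positive. -/
inductive Prog where
  | skip
  | store (a : ℕ) (i e : Expr)
  | seq (p q : Prog)
  | branch (e : Expr) (p q : Prog)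
  | loop (e : Expr) (p : Prog)

/-- `Exec p s s' t`: started on the memory `s`, the program `p` halts with the memory `s'`,
and the total cost of the run is `t`. -/
inductive Exec : Prog → Store → Store → ℕ → Prop where
  | skip (s : Store) : Exec .skip s s 1
  | store (a : ℕ) (i e : Expr) (s : Store) :
      Exec (.store a i e) s
        (Function.update s a (Function.update (s a) (i.eval s) (e.eval s)))
        (i.cost s + e.cost s + 1)
  | seq {p q : Prog} {s s₁ s₂ : Store} {t₁ t₂ : ℕ} :
      Exec p s s₁ t₁ → Exec q s₁ s₂ t₂ → Exec (.seq p q) s s₂ (t₁ + t₂ + 1)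
  | branch_pos {e : Expr} {p q : Prog} {s s₁ : Store} {t₁ : ℕ} :
      0 < e.eval s → Exec p s s₁ t₁ → Exec (.branch e p q) s s₁ (e.cost s + t₁ + 1)
  | branch_neg {e : Expr} {p q : Prog} {s s₁ : Store} {t₁ : ℕ} :
      e.eval s ≤ 0 → Exec q s s₁ t₁ → Exec (.branch e p q) s s₁ (e.cost s + t₁ + 1)
  | loop_stop {e : Expr} {p : Prog} {s : Store} :
      e.eval s ≤ 0 → Exec (.loop e p) s s (e.cost s + 1)
  | loop_step {e : Expr} {p : Prog} {s s₁ s₂ : Store} {t₁ t₂ : ℕ} :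
      0 < e.eval s → Exec p s s₁ t₁ → Exec (.loop e p) s₁ s₂ t₂ →
      Exec (.loop e p) s s₂ (e.cost s + t₁ + t₂ + 1)

/-- The initial memory for an input that consists of several lists of integers: the `a`-th list is
in the cells `0, 1, …` of array `a`; all other cells are `0`. -/
def initial (input : List (List ℤ)) : Store :=
  fun a i => if 0 ≤ i then (input.getD a []).getD i.toNat 0 else 0

/-- The bit length of an input. -/
def inputSize (input : List (List ℤ)) : ℕ :=
  (input.map fun l => (l.map bits).sum).sum

end Ram

/-! ### Packing weighted points into axis-parallel rectangles with capacities -/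

/-- A closed axis-parallel rectangle `[left, right] × [bottom, top]`. -/
structure Rect where
  left : ℚ
  right : ℚ
  bottom : ℚ
  top : ℚ
  left_le_right : left ≤ right
  bottom_le_top : bottom ≤ top

/-- The point `p` lies in the rectangle `b`. -/
def Rect.Contains (b : Rect) (p : ℚ × ℚ) : Prop :=
  b.left ≤ p.1 ∧ p.1 ≤ b.right ∧ b.bottom ≤ p.2 ∧ p.2 ≤ b.top

instance (b : Rect) (p : ℚ × ℚ) : Decidable (b.Contains p) := by
  unfold Rect.Contains; infer_instance

/-- An instance of the problem: `n` weighted points and `m` rectangles with positive integer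
capacities. -/
structure PackInstance where
  n : ℕ
  point : Fin n → ℚ × ℚ
  weight : Fin n → ℚ
  m : ℕ
  rect : Fin m → Rect
  cap : Fin m → ℕ
  one_le_cap : ∀ j, 1 ≤ cap j

namespace PackInstance

variable (I : PackInstance)

/-- The (indices of the) points contained in the `j`-th rectangle. -/
def inside (j : Fin I.m) : Finset (Fin I.n) :=
  Finset.univ.filter fun i => (I.rect j).Contains (I.point i)

/-- The total weight of a set of points. -/
def totalWeight (S : Finset (Fin I.n)) : ℚ := ∑ i ∈ S, I.weight i

/-- No rectangle contains more points of `S` than its capacity. -/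
def Feasible (S : Finset (Fin I.n)) : Prop :=
  ∀ j, (S ∩ I.inside j).card ≤ I.cap j

instance : DecidablePred I.Feasible := fun S => by
  unfold Feasible; infer_instance

theorem feasible_nonempty : (Finset.univ.filter I.Feasible).Nonempty :=
  ⟨∅, by simp [Feasible]⟩

/-- `Opt`, the maximum weight of a feasible set of points. -/
def opt : ℚ := (Finset.univ.filter I.Feasible).sup' I.feasible_nonempty I.totalWeight

/-- `S` is an `(α, β)`-approximate solution: its weight is at least `Opt / α`, and each rectangle
`b` contains at most `max (cap b) β` points of `S`. -/
def IsBicriteriaApprox (α : ℝ) (β : ℕ) (S : Finset (Fin I.n)) : Prop :=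
  (I.opt : ℝ) / α ≤ (I.totalWeight S : ℝ) ∧
    ∀ j, (S ∩ I.inside j).card ≤ max (I.cap j) β

/-- Feasible solutions of the linear programming relaxation. -/
def LPFeasible (x : Fin I.n → ℝ) : Prop :=
  (∀ i, 0 ≤ x i ∧ x i ≤ 1) ∧ ∀ j, ∑ i ∈ I.inside j, x i ≤ (I.cap j : ℝ)

/-- The objective value of a fractional solution. -/
def lpValue (x : Fin I.n → ℝ) : ℝ := ∑ i, (I.weight i : ℝ) * x i

/-- Optimal solutions of the linear programming relaxation. -/
def LPOptimal (x : Fin I.n → ℝ) : Prop :=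
  I.LPFeasible x ∧ ∀ y, I.LPFeasible y → I.lpValue y ≤ I.lpValue x

/-- The energy of a fractional solution. -/
def energy (x : Fin I.n → ℝ) : ℝ := ∑ i, x i

/-- The input given to the machine: the numbers of points and of rectangles, and then one list
for the numerators and one for the denominators of each rational parameter of the points (two
coordinates and the weight) and of the rectangles (four sides), and the list of capacities. -/
def encode : List (List ℤ) :=
  [ [(I.n : ℤ), (I.m : ℤ)],
    List.ofFn fun i => (I.point i).1.num,
    List.ofFn fun i => ((I.point i).1.den : ℤ),
    List.ofFn fun i => (I.point i).2.num,
    List.ofFn fun i => ((I.point i).2.den : ℤ),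
    List.ofFn fun i => (I.weight i).num,
    List.ofFn fun i => ((I.weight i).den : ℤ),
    List.ofFn fun j => (I.rect j).left.num,
    List.ofFn fun j => ((I.rect j).left.den : ℤ),
    List.ofFn fun j => (I.rect j).right.num,
    List.ofFn fun j => ((I.rect j).right.den : ℤ),
    List.ofFn fun j => (I.rect j).bottom.num,
    List.ofFn fun j => ((I.rect j).bottom.den : ℤ),
    List.ofFn fun j => (I.rect j).top.num,
    List.ofFn fun j => ((I.rect j).top.den : ℤ),
    List.ofFn fun j => (I.cap j : ℤ) ]

/-- The set of points that a final memory describes: point `i` is chosen if cell `i` of the first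
array after the input is `1`. -/
def output (s : Ram.Store) : Finset (Fin I.n) :=
  Finset.univ.filter fun i => s 16 (i : ℤ) = 1

end PackInstance

/-! Let `B ≥ 1` be an integer bounding the energy of an optimal fractional solution. Adding the
constraint `∑ x i ≤ B` to the linear program costs nothing, and multiplicative weights solve the
extended program up to the factor 11 with all values multiples of `1 / H`: `x i = c i / H` with
natural numbers `c i`, where `H = n + m + 1` is the number of rows (`MultWeights.approx`).

Rounding. Cut the points, from left to right, into blocks of fractional mass about one; there are at
most `B + 1` of them. In the binary tree over the blocks a rectangle belongs to the smallest dyadic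
interval that contains all its points, and only `Λ = O(log B)` levels occur. Unless a rectangle
lives in a single block, the middle of its interval separates its points into two nonempty halves.
Sample the point `i` with probability between `x i / (128 Λ)` and `x i / (64 Λ)`. Discard it if
another sampled point lies in its block, or if some half rectangle containing it has `halfCap` or
more sampled points closer to the middle. In each half the outermost survivor then certifies that at
most `halfCap` points are left, which gives at most `2 * max 1 (cap / 2) ≤ max 2 cap` per rectangle
(`PackInstance.card_survivors_le`).

A sampled point is discarded with conditional probability at most `1 / 2`. Between `i` and the
middle, the vertical sides of a rectangle of given level around `i` are no restriction. Above `i`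
only the top side matters, and below `i` only the bottom side. So, for a fixed level, a fixed side
of `i` and a fixed capacity class `2 ^ t`, all rectangles together are dominated by a single one
(`PackInstance.rivals_subset`), and the union bound runs over levels, sides and classes instead of
rectangles. The expected number of sampled points in such a class is `O(2 ^ t / Λ)`. For `t = 0` the
bad event has probability `O(1 / Λ)`, and there are `O(Λ)` such events. For `t ≥ 1` it requires
about `4 ^ t` pairs of sampled points and has probability `O(1 / Λ ^ 2)`, and there are `O(Λ ^ 2)`
such events (`PackInstance.sum_charge_le`).

Derandomization. The estimate only involves `i` and pairs of other points, so three-wise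
independence suffices: a quadratic polynomial modulo a prime `P` of polynomial size is compared with
a threshold (`Sampling.exists_seed`). The program tries all energy bounds `B ≤ n`, all moduli and
all coefficients, and keeps the heaviest set of survivors. It needs neither a primality test, nor an
optimal fractional solution, nor its energy.

Running time. The program is written in a language of array assignments and bounded repetitions. A
syntactic exponent bounds the bit length of every value by a power of a number `Z` that is
polynomial in the input size, and the compiled code runs in time `Z ^ T`, with `T` depending on the
program only (`Ram.Term.exec_comp`, `Ram.Cmd.exec_comp`). -/

/-! ### A small array language and its compilation -/

namespace Ram

/-- Terms of the array language. Bounded sums and products range over `0, …, N - 1`, where `N` is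
one of the parameters kept in array `40`; the variable bound at depth `d` has the number `d`. -/
inductive Term where
  | lit (z : ℤ)
  | var (v : ℕ)
  | par (c : ℕ)
  | get (a : ℕ) (e : Term)
  | add (e f : Term)
  | sub (e f : Term)
  | mul (e f : Term)
  | div (e f : Term)
  | lt (e f : Term)
  | mod (e : Term) (c : ℕ)
  | sum (c : ℕ) (e : Term)
  | prod (c : ℕ) (e : Term)

namespace Term

instance : Add Term := ⟨.add⟩
instance : Sub Term := ⟨.sub⟩
instance : Mul Term := ⟨.mul⟩
instance : Div Term := ⟨.div⟩

/-- The value of a term. -/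
def eval (u : Store) : Term → ℕ → (ℕ → ℤ) → ℤ
  | .lit z, _, _ => z
  | .var v, _, ρ => ρ v
  | .par c, _, _ => u 40 c
  | .get a e, d, ρ => u a (e.eval u d ρ)
  | .add e f, d, ρ => e.eval u d ρ + f.eval u d ρ
  | .sub e f, d, ρ => e.eval u d ρ - f.eval u d ρ
  | .mul e f, d, ρ => e.eval u d ρ * f.eval u d ρ
  | .div e f, d, ρ => e.eval u d ρ / f.eval u d ρ
  | .lt e f, d, ρ => if e.eval u d ρ < f.eval u d ρ then 1 else 0
  | .mod e c, d, ρ => e.eval u d ρ % (u 40 c + 1)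
  | .sum c e, d, ρ =>
      ∑ k ∈ Finset.range (u 40 c).toNat, e.eval u (d + 1) (Function.update ρ d (k : ℤ))
  | .prod c e, d, ρ =>
      ∏ k ∈ Finset.range (u 40 c).toNat, e.eval u (d + 1) (Function.update ρ d (k : ℤ))

section
variable (u : Store) (d : ℕ) (ρ : ℕ → ℤ) (e f : Term)
@[simp] theorem eval_lit (z : ℤ) : (lit z).eval u d ρ = z := rfl
@[simp] theorem eval_var (v : ℕ) : (var v).eval u d ρ = ρ v := rfl
@[simp] theorem eval_par (c : ℕ) : (par c).eval u d ρ = u 40 c := rfl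
@[simp] theorem eval_get (a : ℕ) : (get a e).eval u d ρ = u a (e.eval u d ρ) := rfl
@[simp] theorem eval_add : (e + f).eval u d ρ = e.eval u d ρ + f.eval u d ρ := rfl
@[simp] theorem eval_sub : (e - f).eval u d ρ = e.eval u d ρ - f.eval u d ρ := rfl
@[simp] theorem eval_mul : (e * f).eval u d ρ = e.eval u d ρ * f.eval u d ρ := rfl
@[simp] theorem eval_div : (e / f).eval u d ρ = e.eval u d ρ / f.eval u d ρ := rfl
@[simp] theorem eval_lt :
    (lt e f).eval u d ρ = if e.eval u d ρ < f.eval u d ρ then 1 else 0 := rfl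
@[simp] theorem eval_mod (c : ℕ) : (mod e c).eval u d ρ = e.eval u d ρ % (u 40 c + 1) := rfl
@[simp] theorem eval_sum (c : ℕ) : (sum c e).eval u d ρ =
    ∑ k ∈ Finset.range (u 40 c).toNat, e.eval u (d + 1) (Function.update ρ d (k : ℤ)) := rfl
@[simp] theorem eval_prod (c : ℕ) : (prod c e).eval u d ρ =
    ∏ k ∈ Finset.range (u 40 c).toNat, e.eval u (d + 1) (Function.update ρ d (k : ℤ)) := rfl
end

/-- The exponent `k` in the bound `Z ^ k` for the bit length of the value of a term, given such
exponents for the arrays. -/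
def kap (κ : ℕ → ℕ) : Term → ℕ
  | .lit z => z.natAbs + 1
  | .var _ => 1
  | .par _ => 1
  | .get a _ => κ a
  | .add e f | .sub e f | .mul e f => max (e.kap κ) (f.kap κ) + 1
  | .div e _ => e.kap κ
  | .lt _ _ => 1
  -- A remainder modulo a parameter plus one is less than `Z`, however large its argument is. This
  -- allows an array to be overwritten repeatedly by a function of itself while its exponent stays
  -- fixed.
  | .mod _ _ => 1
  | .sum _ e | .prod _ e => e.kap κ + 2

/-- All variables of the term are bound, and all arrays that it reads satisfy `r`. -/
def ok (r : ℕ → Bool) : Term → ℕ → Bool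
  | .lit _, _ => true
  | .var v, d => decide (v < d)
  | .par _, _ => true
  | .get a e, d => r a && e.ok r d
  | .add e f, d | .sub e f, d | .mul e f, d | .div e f, d | .lt e f, d => e.ok r d && f.ok r d
  | .mod e _, d => e.ok r d
  | .sum _ e, d | .prod _ e, d => e.ok r (d + 1)

theorem eval_congr {r : ℕ → Bool} {u u' : Store} (h40 : u 40 = u' 40)
    (hu : ∀ a, r a = true → u a = u' a) (e : Term) (d : ℕ) (ρ : ℕ → ℤ) (he : e.ok r d = true) :
    e.eval u d ρ = e.eval u' d ρ := by
  induction e generalizing d ρ with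
  | lit z => rfl
  | var v => rfl
  | par c => simp [eval, h40]
  | get a e ih =>
    simp only [ok, Bool.and_eq_true] at he
    simp only [eval, ih d ρ he.2, hu a he.1]
  | add e f ihe ihf | sub e f ihe ihf | mul e f ihe ihf | div e f ihe ihf | lt e f ihe ihf =>
    simp only [ok, Bool.and_eq_true] at he
    simp only [eval, ihe d ρ he.1, ihf d ρ he.2]
  | mod e c ih => simp only [eval, ih d ρ he, h40]
  | sum c e ih | prod c e ih =>
    simp only [eval, h40]
    simp only [ih (d + 1) _ he]

end Term

/-! #### Bit lengths -/

theorem one_le_bits (x : ℤ) : 1 ≤ bits x := by simp [bits]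

theorem bits_le_iff {x : ℤ} {b : ℕ} : bits x ≤ b + 1 ↔ x.natAbs < 2 ^ b := by
  simp [bits, Nat.size_le]

theorem bits_le_of_natAbs_le {x y : ℤ} (h : x.natAbs ≤ y.natAbs) : bits x ≤ bits y := by
  simpa [bits] using Nat.size_le_size h

theorem bits_add_le (x y : ℤ) : bits (x + y) ≤ bits x + bits y := by
  obtain ⟨a, ha⟩ : ∃ a, bits x = a + 1 := ⟨_, rfl⟩
  obtain ⟨b, hb⟩ : ∃ b, bits y = b + 1 := ⟨_, rfl⟩
  have h1 := bits_le_iff.1 ha.le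
  have h2 := bits_le_iff.1 hb.le
  have : bits (x + y) ≤ (a + b + 1) + 1 := by
    rw [bits_le_iff]
    have h3 := Int.natAbs_add_le x y
    have h4 : 2 ^ a ≤ 2 ^ (a + b) := Nat.pow_le_pow_right (by simp) (by simp)
    have h5 : 2 ^ b ≤ 2 ^ (a + b) := Nat.pow_le_pow_right (by simp) (by simp)
    rw [pow_succ]; omega
  omega

theorem bits_neg (x : ℤ) : bits (-x) = bits x := by simp [bits]

theorem bits_sub_le (x y : ℤ) : bits (x - y) ≤ bits x + bits y := by
  rw [sub_eq_add_neg, ← bits_neg y]; exact bits_add_le _ _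

theorem bits_mul_le (x y : ℤ) : bits (x * y) ≤ bits x + bits y := by
  obtain ⟨a, ha⟩ : ∃ a, bits x = a + 1 := ⟨_, rfl⟩
  obtain ⟨b, hb⟩ : ∃ b, bits y = b + 1 := ⟨_, rfl⟩
  have h1 := bits_le_iff.1 ha.le
  have h2 := bits_le_iff.1 hb.le
  have : bits (x * y) ≤ (a + b) + 1 := by
    rw [bits_le_iff, Int.natAbs_mul, pow_add]
    exact Nat.mul_lt_mul'' h1 h2
  omega

theorem bits_div_le (x y : ℤ) : bits (x / y) ≤ bits x :=
  bits_le_of_natAbs_le (by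
    have := Int.abs_ediv_le_abs x y
    zify; exact this)

theorem bits_le_of_lt {x : ℤ} {Z : ℕ} (h0 : 0 ≤ x) (h : x < Z) : bits x ≤ Z := by
  obtain ⟨Z, rfl⟩ : ∃ Y, Z = Y + 1 := ⟨Z - 1, by omega⟩
  rw [bits_le_iff]
  have := Nat.lt_two_pow_self (n := Z)
  omega

theorem bits_natCast_le (n : ℕ) : bits (n : ℤ) ≤ n + 1 :=
  bits_le_of_lt (by positivity) (by push_cast; omega)

theorem bits_lit_le {Z : ℕ} (hZ : 2 ≤ Z) (n : ℕ) : bits (n : ℤ) ≤ Z ^ n :=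
  (bits_natCast_le n).trans ((Nat.lt_pow_self (by omega)))

theorem bits_sum_le {f : ℕ → ℤ} {b : ℕ} (n : ℕ) (h : ∀ k < n, bits (f k) ≤ b) :
    bits (∑ k ∈ Finset.range n, f k) ≤ n * b + 1 := by
  induction n with
  | zero => simp [bits]
  | succ n ih =>
    rw [Finset.sum_range_succ]
    refine (bits_add_le _ _).trans ?_
    have := ih fun k hk => h k (by omega)
    have := h n (by omega)
    rw [add_mul]; omega

theorem bits_prod_le {f : ℕ → ℤ} {b : ℕ} (n : ℕ) (h : ∀ k < n, bits (f k) ≤ b) :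
    bits (∏ k ∈ Finset.range n, f k) ≤ n * b + 2 := by
  induction n with
  | zero => simp [bits]
  | succ n ih =>
    rw [Finset.prod_range_succ]
    refine (bits_mul_le _ _).trans ?_
    have := ih fun k hk => h k (by omega)
    have := h n (by omega)
    rw [add_mul]; omega

/-- All user arrays have cells of bit length at most `Z ^ κ a`, and the parameters are natural
numbers below `Z`. -/
structure Bounded (κ : ℕ → ℕ) (Z : ℕ) (u : Store) : Prop where
  cell : ∀ a < 40, ∀ i, bits (u a i) ≤ Z ^ κ a
  par : ∀ c : ℕ, 0 ≤ u 40 c ∧ u 40 c < Z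

theorem Term.bits_eval_le {κ : ℕ → ℕ} {Z : ℕ} {u : Store} (hZ : 2 ≤ Z) (hu : Bounded κ Z u)
    {r : ℕ → Bool} (hr : ∀ a, r a = true → a < 40)
    (e : Term) (d : ℕ) (ρ : ℕ → ℤ) (he : e.ok r d = true) (hρ : ∀ v < d, 0 ≤ ρ v ∧ ρ v < Z) :
    bits (e.eval u d ρ) ≤ Z ^ e.kap κ := by
  have mono : ∀ {m n : ℕ}, m ≤ n → Z ^ m ≤ Z ^ n := fun h => Nat.pow_le_pow_right (by omega) h
  have two : ∀ {m n : ℕ}, Z ^ m + Z ^ n ≤ Z ^ (max m n + 1) := by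
    intro m n
    have h1 := mono (le_max_left m n)
    have h2 := mono (le_max_right m n)
    have : Z ^ max m n * 2 ≤ Z ^ max m n * Z := Nat.mul_le_mul_left _ hZ
    rw [pow_succ]; omega
  -- With `N < Z` terms of `Z ^ k` bits, sums and products have at most `N * Z ^ k + 2` bits; this
  -- accounts for the two extra powers in `kap`.
  have loop : ∀ {c k : ℕ}, (u 40 c).toNat * Z ^ k + 2 ≤ Z ^ (k + 2) := by
    intro c k
    have h1 : (u 40 c).toNat + 1 ≤ Z := by have := hu.par c; omega
    have h2 : ((u 40 c).toNat + 1) * Z ^ k ≤ Z * Z ^ k := Nat.mul_le_mul_right _ h1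
    have h3 : 1 ≤ Z ^ k := Nat.one_le_pow _ _ (by omega)
    have h4 : Z * Z ^ k * 2 ≤ Z * Z ^ k * Z := Nat.mul_le_mul_left _ hZ
    have h5 : Z ^ (k + 2) = Z * Z ^ k * Z := by ring
    have h6 : 2 * 1 ≤ Z * Z ^ k := Nat.mul_le_mul hZ h3
    rw [add_mul] at h2
    omega
  have upd : ∀ {c k : ℕ} {d : ℕ} {ρ : ℕ → ℤ}, k < (u 40 c).toNat →
      (∀ v < d, 0 ≤ ρ v ∧ ρ v < Z) →
      ∀ v < d + 1, 0 ≤ Function.update ρ d (k : ℤ) v ∧ Function.update ρ d (k : ℤ) v < Z := by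
    intro c k d ρ hk hρ v hv
    by_cases h : v = d
    · subst h; have := hu.par c; simp; omega
    · simpa [Function.update_of_ne h] using hρ v (by omega)
  induction e generalizing d ρ with
  | lit z =>
    have h : bits z ≤ z.natAbs + 1 := by
      simpa only [bits, Int.natAbs_natCast] using bits_natCast_le z.natAbs
    exact h.trans (Nat.lt_pow_self (by omega)).le
  | var v =>
    simp only [ok, decide_eq_true_eq] at he
    simpa [kap, eval] using bits_le_of_lt (hρ v he).1 (hρ v he).2
  | par c => simpa [kap, eval] using bits_le_of_lt (hu.par c).1 (hu.par c).2
  | get a e ih =>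
    simp only [ok, Bool.and_eq_true] at he
    exact hu.cell a (hr a he.1) _
  | add e f ihe ihf =>
    simp only [ok, Bool.and_eq_true] at he
    exact (bits_add_le _ _).trans ((add_le_add (ihe d ρ he.1 hρ) (ihf d ρ he.2 hρ)).trans two)
  | sub e f ihe ihf =>
    simp only [ok, Bool.and_eq_true] at he
    exact (bits_sub_le _ _).trans ((add_le_add (ihe d ρ he.1 hρ) (ihf d ρ he.2 hρ)).trans two)
  | mul e f ihe ihf =>
    simp only [ok, Bool.and_eq_true] at he
    exact (bits_mul_le _ _).trans ((add_le_add (ihe d ρ he.1 hρ) (ihf d ρ he.2 hρ)).trans two)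
  | div e f ihe ihf =>
    simp only [ok, Bool.and_eq_true] at he
    exact (bits_div_le _ _).trans (ihe d ρ he.1 hρ)
  | lt e f ihe ihf =>
    simp only [eval, kap, pow_one]
    split_ifs
    · exact le_trans (by simp [bits]) hZ
    · exact le_trans (by simp [bits]) hZ
  | mod e c ih =>
    have h := hu.par c
    have h1 := Int.emod_nonneg (e.eval u d ρ) (b := u 40 c + 1) (by omega)
    have h2 := Int.emod_lt_of_pos (e.eval u d ρ) (b := u 40 c + 1) (by omega)
    simpa [kap, eval] using bits_le_of_lt h1 (by omega)
  | sum c e ih =>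
    exact (bits_sum_le _ fun k hk => ih (d + 1) _ he (upd hk hρ)).trans
      ((Nat.add_le_add_left one_le_two _).trans loop)
  | prod c e ih =>
    exact (bits_prod_le _ fun k hk => ih (d + 1) _ he (upd hk hρ)).trans loop

/-! #### Compilation -/

/-- Replace the content of one cell. -/
def setCell (s : Store) (a : ℕ) (i v : ℤ) : Store :=
  Function.update s a (Function.update (s a) i v)

theorem setCell_same (s : Store) (a : ℕ) (i v : ℤ) : setCell s a i v a i = v := by simp [setCell]

theorem setCell_ne (s : Store) {a b : ℕ} (i v : ℤ) (h : b ≠ a) : setCell s a i v b = s b := by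
  simp [setCell, h]

theorem setCell_ne_cell (s : Store) (a b : ℕ) {i j : ℤ} (v : ℤ) (h : j ≠ i) :
    setCell s a i v b j = s b j := by
  by_cases hb : b = a
  · subst hb; simp [setCell, h]
  · rw [setCell_ne _ _ _ hb]

/-- The machine expressions for a variable, a temporary value and a parameter. -/
def varE (v : ℕ) : Expr := .load 41 (.lit v)
def tmpE (t : ℕ) : Expr := .load 42 (.lit t)
def parE (c : ℕ) : Expr := .load 40 (.lit c)

/-- A loop whose counter is the variable `d` and whose bound is the parameter `c`. -/
def forLoop (d c : ℕ) (body : Prog) : Prog :=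
  .seq (.store 41 (.lit d) (.lit 0))
    (.loop (.sub (parE c) (varE d))
      (.seq body (.store 41 (.lit d) (.add (varE d) (.lit 1)))))

/-- Code that leaves the value of a term in the temporary cell `t`. -/
def Term.comp : Term → ℕ → ℕ → Prog
  | .lit z, _, t => .store 42 (.lit t) (.lit z)
  | .var v, _, t => .store 42 (.lit t) (varE v)
  | .par c, _, t => .store 42 (.lit t) (parE c)
  | .get a e, d, t => .seq (e.comp d t) (.store 42 (.lit t) (.load a (tmpE t)))
  | .add e f, d, t => .seq (e.comp d t)
      (.seq (f.comp d (t + 1)) (.store 42 (.lit t) (.add (tmpE t) (tmpE (t + 1)))))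
  | .sub e f, d, t => .seq (e.comp d t)
      (.seq (f.comp d (t + 1)) (.store 42 (.lit t) (.sub (tmpE t) (tmpE (t + 1)))))
  | .mul e f, d, t => .seq (e.comp d t)
      (.seq (f.comp d (t + 1)) (.store 42 (.lit t) (.mul (tmpE t) (tmpE (t + 1)))))
  | .div e f, d, t => .seq (e.comp d t)
      (.seq (f.comp d (t + 1)) (.store 42 (.lit t) (.div (tmpE t) (tmpE (t + 1)))))
  | .lt e f, d, t => .seq (e.comp d t)
      (.seq (f.comp d (t + 1)) (.branch (.sub (tmpE (t + 1)) (tmpE t))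
        (.store 42 (.lit t) (.lit 1)) (.store 42 (.lit t) (.lit 0))))
  | .mod e c, d, t => .seq (e.comp d t) (.store 42 (.lit t) (.sub (tmpE t)
      (.mul (.div (tmpE t) (.add (parE c) (.lit 1))) (.add (parE c) (.lit 1)))))
  | .sum c e, d, t => .seq (.store 42 (.lit t) (.lit 0)) (forLoop d c
      (.seq (e.comp (d + 1) (t + 1)) (.store 42 (.lit t) (.add (tmpE t) (tmpE (t + 1))))))
  | .prod c e, d, t => .seq (.store 42 (.lit t) (.lit 1)) (forLoop d c
      (.seq (e.comp (d + 1) (t + 1)) (.store 42 (.lit t) (.mul (tmpE t) (tmpE (t + 1))))))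

theorem Exec.store_lit (a i : ℕ) (e : Expr) (s : Store) :
    Exec (.store a (.lit i) e) s (setCell s a i (e.eval s)) (bits i + e.cost s + 1) :=
  Exec.store a (.lit i) e s

/-- The invariant rule for counted loops, with time. `R k` holds whenever the test is evaluated with
counter `k`, and the body must leave the counter alone. The exponent grows by an amount that depends
only on the addresses of the counter and of the bound. -/
theorem exec_forLoop {Z d c N : ℕ} (hZ : 2 ≤ Z) {body : Prog} {T : ℕ} (R : ℕ → Store → Prop)
    (hN : N < Z) (hpar : ∀ k s, R k s → s 40 c = N) (hvar : ∀ k s, R k s → s 41 d = k)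
    {s : Store} (h0 : R 0 (setCell s 41 d 0))
    (step : ∀ k < N, ∀ s, R k s → ∃ s' t, Exec body s s' t ∧ t ≤ Z ^ T ∧ s' 41 d = k ∧
      R (k + 1) (setCell s' 41 d ((k + 1 : ℕ) : ℤ))) :
    ∃ s' t, Exec (forLoop d c body) s s' t ∧ t ≤ Z ^ (T + c + d + 7) ∧ R N s' := by
  set M := Z ^ (T + c + d + 1) with hM
  have mono : ∀ {m n : ℕ}, m ≤ n → Z ^ m ≤ Z ^ n := fun h => Nat.pow_le_pow_right (by omega) h
  have hTM : Z ^ T ≤ M := mono (by omega)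
  have hcM : bits (c : ℤ) ≤ M := (bits_lit_le hZ c).trans (mono (by omega))
  have hdM : bits (d : ℤ) ≤ M := (bits_lit_le hZ d).trans (mono (by omega))
  have hZM : Z ≤ M := (pow_one Z).symm.le.trans (mono (by omega))
  have hb : ∀ k : ℕ, k < Z → bits (k : ℤ) ≤ M := fun k hk =>
    (bits_le_of_lt (by positivity) (by exact_mod_cast hk)).trans hZM
  have test : ∀ k ≤ N, ∀ s, R k s →
      (Expr.sub (parE c) (varE d)).eval s = (N : ℤ) - k ∧
        (Expr.sub (parE c) (varE d)).cost s ≤ 5 * M := by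
    intro k hk s hs
    have h1 : (Expr.sub (parE c) (varE d)).eval s = (N : ℤ) - k := by
      simp [Expr.eval, parE, varE, hpar k s hs, hvar k s hs]
    refine ⟨h1, ?_⟩
    simp only [Expr.cost, parE, varE, Expr.eval, hpar k s hs, hvar k s hs]
    have h2 : bits ((N : ℤ) - k) ≤ M := by
      rw [← Nat.cast_sub hk]; exact hb _ (by omega)
    have := hb N hN
    have := hb k (by omega)
    omega
  -- Induction on the number of remaining rounds; `16 * M` pays for one test, the body and the
  -- increment.
  have main : ∀ j, ∀ k ≤ N, N - k = j → ∀ s, R k s → ∃ s' t,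
      Exec (.loop (.sub (parE c) (varE d))
        (.seq body (.store 41 (.lit d) (.add (varE d) (.lit 1))))) s s' t ∧
      t ≤ (j + 1) * (16 * M) ∧ R N s' := by
    intro j
    induction j with
    | zero =>
      intro k hk hj s hs
      obtain rfl : k = N := by omega
      obtain ⟨h1, h2⟩ := test k hk s hs
      exact ⟨s, _, Exec.loop_stop (by simp [h1]), by omega, hs⟩
    | succ j ih =>
      intro k hk hj s hs
      have hkN : k < N := by omega
      obtain ⟨h1, h2⟩ := test k hk s hs
      obtain ⟨s₁, t₁, e₁, ht₁, hv, hR⟩ := step k hkN s hs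
      have hval : (Expr.add (varE d) (.lit 1)).eval s₁ = ((k + 1 : ℕ) : ℤ) := by
        simp [Expr.eval, varE, hv]
      have e₂ := Exec.store_lit 41 d (.add (varE d) (.lit 1)) s₁
      rw [hval] at e₂
      obtain ⟨s₃, t₃, e₃, ht₃, hR₃⟩ := ih (k + 1) (by omega) (by omega) _ hR
      refine ⟨s₃, _, Exec.loop_step (by rw [h1]; omega) (Exec.seq e₁ e₂) e₃, ?_, hR₃⟩
      have h3 : (Expr.add (varE d) (.lit 1)).cost s₁ ≤ 5 * M := by
        simp only [Expr.cost, varE, Expr.eval, hv]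
        have := hb k (by omega)
        have h4 := hb (k + 1) (by omega)
        push_cast at h4
        have : bits (1 : ℤ) ≤ M := le_trans (by simp [bits]) (hZ.trans hZM)
        omega
      rw [add_mul (j + 1)]
      omega
  obtain ⟨s', t, e, ht, hR⟩ := main N 0 (by omega) (by omega) _ h0
  have e0 := Exec.store_lit 41 d (.lit 0) s
  refine ⟨s', _, Exec.seq e0 e, ?_, hR⟩
  have h1 : (Expr.lit 0).cost s ≤ M := by
    simpa [Expr.cost, bits] using (show 1 ≤ M by omega)
  have h3 : (N + 1 + 1) * (16 * M) ≤ Z ^ (T + c + d + 7) := by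
    have e : Z ^ (T + c + d + 7) = (Z * Z ^ 5) * M := by rw [hM]; ring
    have h4 : 2 ^ 5 ≤ Z ^ 5 := Nat.pow_le_pow_left hZ 5
    have h5 : Z * 2 ^ 5 ≤ Z * Z ^ 5 := Nat.mul_le_mul_left _ h4
    rw [e, ← mul_assoc]
    exact Nat.mul_le_mul_right _ (by omega)
  have h5 : (N + 1 + 1) * (16 * M) = (N + 1) * (16 * M) + 16 * M := by ring
  omega

/-- The memory `s` agrees with `u` on the user arrays and the parameters, and holds the values `ρ`
of the first `d` variables. -/
structure Match (u : Store) (d : ℕ) (ρ : ℕ → ℤ) (s : Store) : Prop where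
  user : ∀ a ≤ 40, s a = u a
  vars : ∀ v : ℕ, v < d → s 41 v = ρ v

theorem Match.setTmp {u : Store} {d : ℕ} {ρ : ℕ → ℤ} {s : Store} (h : Match u d ρ s) (i v : ℤ) :
    Match u d ρ (setCell s 42 i v) :=
  ⟨fun a ha => by rw [setCell_ne _ _ _ (by omega)]; exact h.user a ha,
    fun v hv => by rw [setCell_ne _ _ _ (by omega)]; exact h.vars v hv⟩

theorem Match.setVar {u : Store} {d : ℕ} {ρ : ℕ → ℤ} {s : Store} (h : Match u d ρ s) (v : ℤ) :
    Match u d ρ (setCell s 41 d v) :=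
  ⟨fun a ha => by rw [setCell_ne _ _ _ (by omega)]; exact h.user a ha,
    fun w hw => by rw [setCell_ne_cell _ _ _ _ (by omega)]; exact h.vars w hw⟩

theorem Match.push {u : Store} {d : ℕ} {ρ : ℕ → ℤ} {s : Store} (h : Match u d ρ s) {x : ℤ}
    (hx : s 41 d = x) : Match u (d + 1) (Function.update ρ d x) s :=
  ⟨h.user, fun v hv => by
    by_cases e : v = d
    · subst e; simpa using hx
    · rw [Function.update_of_ne e]; exact h.vars v (by omega)⟩

theorem Match.pop {u : Store} {d : ℕ} {ρ : ℕ → ℤ} {s : Store} {x : ℤ}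
    (h : Match u (d + 1) (Function.update ρ d x) s) : Match u d ρ s :=
  ⟨h.user, fun v hv => by
    have := h.vars v (by omega)
    rwa [Function.update_of_ne (by omega)] at this⟩

/-- The values of the variables are natural numbers below `Z`. -/
def VarsLt (Z d : ℕ) (ρ : ℕ → ℤ) : Prop := ∀ v < d, 0 ≤ ρ v ∧ ρ v < Z

theorem VarsLt.push {Z d : ℕ} {ρ : ℕ → ℤ} (h : VarsLt Z d ρ) {k : ℕ} (hk : k < Z) :
    VarsLt Z (d + 1) (Function.update ρ d (k : ℤ)) := by
  intro v hv
  by_cases e : v = d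
  · subst e; simp; omega
  · simpa [Function.update_of_ne e] using h v (by omega)

/-- What the code of a term is required to do: `Computes κ r p d t T f` says that `p` computes
the value `f u ρ` in the temporary cell `t`, in time `Z ^ T`. -/
def Computes (κ : ℕ → ℕ) (p : Prog) (d t T : ℕ) (f : Store → (ℕ → ℤ) → ℤ) : Prop :=
  ∀ (Z : ℕ) (u : Store) (ρ : ℕ → ℤ), 2 ≤ Z → Bounded κ Z u → VarsLt Z d ρ →
    ∀ s, Match u d ρ s → ∃ s' τ, Exec p s s' τ ∧ τ ≤ Z ^ T ∧ Match u d ρ s' ∧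
      (∀ i : ℕ, i < t → s' 42 i = s 42 i) ∧ s' 42 t = f u ρ

theorem computes_atom {κ : ℕ → ℕ} {d t m : ℕ} {E : Expr} {f : Store → (ℕ → ℤ) → ℤ}
    (h : ∀ (Z : ℕ) (u : Store) (ρ : ℕ → ℤ), 2 ≤ Z → Bounded κ Z u → VarsLt Z d ρ →
      ∀ s, Match u d ρ s → E.eval s = f u ρ ∧ E.cost s ≤ Z ^ m) :
    Computes κ (.store 42 (.lit t) E) d t (t + m + 2) f := by
  intro Z u ρ hZ hu hρ s hs
  obtain ⟨h1, h2⟩ := h Z u ρ hZ hu hρ s hs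
  refine ⟨_, _, Exec.store_lit 42 t E s, ?_, hs.setTmp _ _, fun i hi => ?_, ?_⟩
  · have mono : ∀ {m n : ℕ}, m ≤ n → Z ^ m ≤ Z ^ n := fun h => Nat.pow_le_pow_right (by omega) h
    have h3 := (bits_lit_le hZ t).trans (mono (show t ≤ t + m by omega))
    have h4 := mono (show m ≤ t + m by omega)
    have h5 : Z ^ (t + m + 2) = Z ^ (t + m) * Z ^ 2 := by rw [pow_add]
    have h6 : Z ^ (t + m) * 2 ^ 2 ≤ Z ^ (t + m) * Z ^ 2 :=
      Nat.mul_le_mul_left _ (Nat.pow_le_pow_left hZ 2)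
    have h7 : 1 ≤ Z ^ (t + m) := Nat.one_le_pow _ _ (by omega)
    omega
  · rw [setCell_ne_cell _ _ _ _ (by omega)]
  · rw [setCell_same, h1]

theorem computes_then {κ : ℕ → ℕ} {d t T m : ℕ} {p : Prog} {E : Expr}
    {f g : Store → (ℕ → ℤ) → ℤ} (hp : Computes κ p d t T f)
    (h : ∀ (Z : ℕ) (u : Store) (ρ : ℕ → ℤ), 2 ≤ Z → Bounded κ Z u → VarsLt Z d ρ →
      ∀ s, Match u d ρ s → s 42 t = f u ρ → E.eval s = g u ρ ∧ E.cost s ≤ Z ^ m) :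
    Computes κ (.seq p (.store 42 (.lit t) E)) d t (T + t + m + 3) g := by
  intro Z u ρ hZ hu hρ s hs
  obtain ⟨s₁, τ₁, e₁, hτ₁, hs₁, hk₁, hv₁⟩ := hp Z u ρ hZ hu hρ s hs
  obtain ⟨h1, h2⟩ := h Z u ρ hZ hu hρ s₁ hs₁ hv₁
  refine ⟨_, _, Exec.seq e₁ (Exec.store_lit 42 t E s₁), ?_, hs₁.setTmp _ _, fun i hi => ?_, ?_⟩
  · have mono : ∀ {m n : ℕ}, m ≤ n → Z ^ m ≤ Z ^ n := fun h => Nat.pow_le_pow_right (by omega) h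
    have h3 := (bits_lit_le hZ t).trans (mono (show t ≤ T + t + m by omega))
    have h4 := mono (show m ≤ T + t + m by omega)
    have h4' := mono (show T ≤ T + t + m by omega)
    have h5 : Z ^ (T + t + m + 3) = Z ^ (T + t + m) * Z ^ 3 := by rw [pow_add]
    have h6 : Z ^ (T + t + m) * 2 ^ 3 ≤ Z ^ (T + t + m) * Z ^ 3 :=
      Nat.mul_le_mul_left _ (Nat.pow_le_pow_left hZ 3)
    have h7 : 1 ≤ Z ^ (T + t + m) := Nat.one_le_pow _ _ (by omega)
    omega
  · rw [setCell_ne_cell _ _ _ _ (by omega), hk₁ i hi]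
  · rw [setCell_same, h1]

/-- The second operand is evaluated with `t + 1`, so the value of the first one survives in cell
`t`. This is why `Computes` demands that lower temporary cells are preserved. -/
theorem computes_binary {κ : ℕ → ℕ} {d t T₁ T₂ T₃ : ℕ} {p q k : Prog}
    {f g h : Store → (ℕ → ℤ) → ℤ} (hp : Computes κ p d t T₁ f) (hq : Computes κ q d (t + 1) T₂ g)
    (hk : ∀ (Z : ℕ) (u : Store) (ρ : ℕ → ℤ), 2 ≤ Z → Bounded κ Z u → VarsLt Z d ρ →
      ∀ s, Match u d ρ s → s 42 t = f u ρ → s 42 ((t + 1 : ℕ) : ℤ) = g u ρ →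
        ∃ τ, Exec k s (setCell s 42 t (h u ρ)) τ ∧ τ ≤ Z ^ T₃) :
    Computes κ (.seq p (.seq q k)) d t (T₁ + T₂ + T₃ + 3) h := by
  intro Z u ρ hZ hu hρ s hs
  obtain ⟨s₁, τ₁, e₁, hτ₁, hs₁, hk₁, hv₁⟩ := hp Z u ρ hZ hu hρ s hs
  obtain ⟨s₂, τ₂, e₂, hτ₂, hs₂, hk₂, hv₂⟩ := hq Z u ρ hZ hu hρ s₁ hs₁
  obtain ⟨τ₃, e₃, hτ₃⟩ := hk Z u ρ hZ hu hρ s₂ hs₂ (by rw [hk₂ t (by omega), hv₁]) hv₂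
  refine ⟨_, _, Exec.seq e₁ (Exec.seq e₂ e₃), ?_, hs₂.setTmp _ _, fun i hi => ?_, ?_⟩
  · have mono : ∀ {m n : ℕ}, m ≤ n → Z ^ m ≤ Z ^ n := fun h => Nat.pow_le_pow_right (by omega) h
    have h3 := mono (show T₁ ≤ T₁ + T₂ + T₃ by omega)
    have h4 := mono (show T₂ ≤ T₁ + T₂ + T₃ by omega)
    have h4' := mono (show T₃ ≤ T₁ + T₂ + T₃ by omega)
    have h5 : Z ^ (T₁ + T₂ + T₃ + 3) = Z ^ (T₁ + T₂ + T₃) * Z ^ 3 := by rw [pow_add]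
    have h6 : Z ^ (T₁ + T₂ + T₃) * 2 ^ 3 ≤ Z ^ (T₁ + T₂ + T₃) * Z ^ 3 :=
      Nat.mul_le_mul_left _ (Nat.pow_le_pow_left hZ 3)
    have h7 : 1 ≤ Z ^ (T₁ + T₂ + T₃) := Nat.one_le_pow _ _ (by omega)
    omega
  · rw [setCell_ne_cell _ _ _ _ (by omega), hk₂ i (by omega), hk₁ i hi]
  · rw [setCell_same]

/-- Common proof for sums and products: `F f n` is the accumulated value after `n` rounds and `op`
is the accumulating operation. The accumulator occupies cell `t`, the current term cell `t + 1`, and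
the running index becomes variable `d`. -/
theorem computes_loop {κ : ℕ → ℕ} {r : ℕ → Bool} (hr : ∀ a, r a = true → a < 40)
    {c d t T : ℕ} {e : Term} (he : e.ok r (d + 1) = true)
    (hp : Computes κ (e.comp (d + 1) (t + 1)) (d + 1) (t + 1) T fun u ρ => e.eval u (d + 1) ρ)
    (z : ℤ) (F : (ℕ → ℤ) → ℕ → ℤ) (hF0 : ∀ f, F f 0 = z) (op : Expr → Expr → Expr)
    (hF : ∀ f n A B s, A.eval s = F f n → B.eval s = f n → (op A B).eval s = F f (n + 1))
    (hcost : ∀ A B s, (op A B).cost s = A.cost s + B.cost s + bits ((op A B).eval s))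
    (hbits : ∀ f n b, (∀ k < n, bits (f k) ≤ b) → bits (F f n) ≤ n * b + 2) :
    ∃ T', Computes κ (.seq (.store 42 (.lit t) (.lit z)) (forLoop d c
      (.seq (e.comp (d + 1) (t + 1)) (.store 42 (.lit t) (op (tmpE t) (tmpE (t + 1))))))) d t T'
      fun u ρ => F (fun k => e.eval u (d + 1) (Function.update ρ d (k : ℤ)))
        (u 40 c).toNat := by
  set m := e.kap κ with hm
  set T₀ := T + m + t + 10 with hT₀
  refine ⟨(T₀ + c + d + 7) + t + bits z + 10, ?_⟩
  intro Z u ρ hZ hu hρ s hs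
  have mono : ∀ {m n : ℕ}, m ≤ n → Z ^ m ≤ Z ^ n := fun h => Nat.pow_le_pow_right (by omega) h
  obtain ⟨N, hN⟩ : ∃ N : ℕ, u 40 c = N := ⟨(u 40 c).toNat, by have := hu.par c; omega⟩
  have hNZ : N < Z := by have := hu.par c; omega
  set f : ℕ → ℤ := fun k => e.eval u (d + 1) (Function.update ρ d (k : ℤ)) with hf
  have hfb : ∀ k < N, bits (f k) ≤ Z ^ m := fun k hk =>
    Term.bits_eval_le hZ hu hr e (d + 1) _ he (hρ.push (by omega))
  have hFb : ∀ k ≤ N, bits (F f k) ≤ Z ^ (m + 2) := by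
    intro k hk
    refine (hbits f k (Z ^ m) fun i hi => hfb i (by omega)).trans ?_
    have h2 : k * Z ^ m ≤ Z * Z ^ m := Nat.mul_le_mul_right _ (by omega)
    have h4 : Z * Z ^ m * 2 ≤ Z * Z ^ m * Z := Nat.mul_le_mul_left _ hZ
    have h5 : Z ^ (m + 2) = Z * Z ^ m * Z := by ring
    have h6 : 2 * 1 ≤ Z * Z ^ m := Nat.mul_le_mul hZ (Nat.one_le_pow _ _ (by omega))
    omega
  let R : ℕ → Store → Prop := fun k st => Match u d ρ st ∧ (∀ i : ℕ, i < t → st 42 i = s 42 i) ∧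
    st 42 t = F f k ∧ st 41 d = k
  have e₀ := Exec.store_lit 42 t (.lit z) s
  obtain ⟨s', τ, e₁, hτ, hR⟩ := exec_forLoop (c := c) (d := d) (T := T₀) hZ
    (body := .seq (e.comp (d + 1) (t + 1)) (.store 42 (.lit t) (op (tmpE t) (tmpE (t + 1)))))
    R hNZ (fun k st h => by rw [h.1.user 40 le_rfl, hN]) (fun k st h => h.2.2.2)
    (s := setCell s 42 t ((Expr.lit z).eval s)) (by
      refine ⟨(hs.setTmp _ _).setVar _, fun i hi => ?_, ?_, ?_⟩
      · rw [setCell_ne _ _ _ (by omega), setCell_ne_cell _ _ _ _ (by omega)]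
      · rw [setCell_ne _ _ _ (by omega), setCell_same, hF0]; rfl
      · rw [setCell_same]; rfl) (by
      intro k hk st hst
      obtain ⟨hM, hlow, hacc, hv⟩ := hst
      obtain ⟨s₁, τ₁, e₁, hτ₁, hs₁, hk₁, hv₁⟩ := hp Z u _ hZ hu
        (hρ.push (k := k) (by omega)) st (hM.push hv)
      have hA : (tmpE t).eval s₁ = F f k := by
        simp only [tmpE, Expr.eval]; rw [hk₁ t (by omega), hacc]
      have hB : (tmpE (t + 1)).eval s₁ = f k := by
        simp only [tmpE, Expr.eval]; exact hv₁
      have hval := hF f k _ _ s₁ hA hB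
      have e₂ := Exec.store_lit 42 t (op (tmpE t) (tmpE (t + 1))) s₁
      rw [hval] at e₂
      refine ⟨_, _, Exec.seq e₁ e₂, ?_, ?_, (hs₁.pop.setTmp _ _).setVar _, fun i hi => ?_, ?_, ?_⟩
      · rw [hcost, hval]
        have h1 : (tmpE t).cost s₁ = bits t + bits (F f k) := by rw [← hA]; rfl
        have h2 : (tmpE (t + 1)).cost s₁ = bits ((t + 1 : ℕ) : ℤ) + bits (f k) := by
          rw [← hB]; rfl
        rw [h1, h2]
        set M := Z ^ (T + m + t + 3) with hM
        have := (hFb k hk.le).trans (mono (show m + 2 ≤ T + m + t + 3 by omega))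
        have := (hFb (k + 1) hk).trans (mono (show m + 2 ≤ T + m + t + 3 by omega))
        have := (hfb k hk).trans (mono (show m ≤ T + m + t + 3 by omega))
        have := (bits_lit_le hZ t).trans (mono (show t ≤ T + m + t + 3 by omega))
        have := (bits_lit_le hZ (t + 1)).trans (mono (show t + 1 ≤ T + m + t + 3 by omega))
        have := hτ₁.trans (mono (show T ≤ T + m + t + 3 by omega))
        have h5 : Z ^ T₀ = M * Z ^ 7 := by rw [hM, hT₀, ← pow_add]
        have h6 : M * 2 ^ 7 ≤ M * Z ^ 7 := Nat.mul_le_mul_left _ (Nat.pow_le_pow_left hZ 7)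
        have h7 : 1 ≤ M := Nat.one_le_pow _ _ (by omega)
        omega
      · rw [setCell_ne _ _ _ (by omega), ]
        have := hs₁.vars d (by omega)
        simpa using this
      · rw [setCell_ne _ _ _ (by omega), setCell_ne_cell _ _ _ _ (by omega), hk₁ i (by omega),
          hlow i hi]
      · rw [setCell_ne _ _ _ (by omega), setCell_same]
      · rw [setCell_same])
  obtain ⟨hM, hlow, hacc, hv⟩ := hR
  refine ⟨s', _, Exec.seq e₀ e₁, ?_, hM, hlow, ?_⟩
  · set Q := T₀ + c + d + 7
    have := hτ.trans (mono (show Q ≤ Q + t + bits z by omega))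
    have := (bits_lit_le hZ t).trans (mono (show t ≤ Q + t + bits z by omega))
    have h1 : (Expr.lit z).cost s ≤ Z ^ (Q + t + bits z) :=
      (show (Expr.lit z).cost s ≤ Z ^ bits z from (Nat.lt_pow_self (by omega : 1 < Z)).le).trans
        (mono (by omega))
    have h5 : Z ^ (Q + t + bits z + 10) = Z ^ (Q + t + bits z) * Z ^ 10 := by rw [pow_add]
    have h6 : Z ^ (Q + t + bits z) * 2 ^ 10 ≤ Z ^ (Q + t + bits z) * Z ^ 10 :=
      Nat.mul_le_mul_left _ (Nat.pow_le_pow_left hZ 10)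
    have h7 : 1 ≤ Z ^ (Q + t + bits z) := Nat.one_le_pow _ _ (by omega)
    omega
  · simp only [hN, Int.toNat_natCast]; exact hacc

theorem le_pow_of_le_mul {Z a m k j : ℕ} (hZ : 2 ≤ Z) (h : a ≤ 2 ^ k * Z ^ m) (hj : m + k ≤ j) :
    a ≤ Z ^ j :=
  calc a ≤ 2 ^ k * Z ^ m := h
    _ ≤ Z ^ k * Z ^ m := Nat.mul_le_mul_right _ (Nat.pow_le_pow_left hZ k)
    _ = Z ^ (m + k) := by rw [pow_add, mul_comm]
    _ ≤ Z ^ j := Nat.pow_le_pow_right (by omega) hj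

/-- Operands, addresses and results all have bit lengths bounded through `Term.bits_eval_le`, so
every instruction costs a constant multiple of a power of `Z`. The constants are absorbed into the
exponent because `2 ≤ Z`. -/
theorem Term.exec_comp {κ : ℕ → ℕ} {r : ℕ → Bool} (hr : ∀ a, r a = true → a < 40) (e : Term) :
    ∀ d t, e.ok r d = true → ∃ T, Computes κ (e.comp d t) d t T fun u ρ => e.eval u d ρ := by
  have binop : ∀ {e f : Term} {d t T₁ T₂ : ℕ} {op : Expr → Expr → Expr} {v : ℤ → ℤ → ℤ},
      e.ok r d = true → f.ok r d = true →
      Computes κ (e.comp d t) d t T₁ (fun u ρ => e.eval u d ρ) →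
      Computes κ (f.comp d (t + 1)) d (t + 1) T₂ (fun u ρ => f.eval u d ρ) →
      (∀ A B s, (op A B).eval s = v (A.eval s) (B.eval s)) →
      (∀ A B s, (op A B).cost s = A.cost s + B.cost s + bits (v (A.eval s) (B.eval s))) →
      (∀ x y, bits (v x y) ≤ bits x + bits y) →
      ∃ T, Computes κ (.seq (e.comp d t) (.seq (f.comp d (t + 1))
        (.store 42 (.lit t) (op (tmpE t) (tmpE (t + 1)))))) d t T
        fun u ρ => v (e.eval u d ρ) (f.eval u d ρ) := by
    intro e f d t T₁ T₂ op v he hf h1 h2 hv hc hb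
    refine ⟨_, computes_binary (T₃ := e.kap κ + f.kap κ + t + 1 + 4) h1 h2 ?_⟩
    intro Z u ρ hZ hu hρ s hs hx hy
    have hev : (op (tmpE t) (tmpE (t + 1))).eval s = v (e.eval u d ρ) (f.eval u d ρ) := by
      rw [hv]; simp only [tmpE, Expr.eval]; rw [hx, hy]
    have e₂ := Exec.store_lit 42 t (op (tmpE t) (tmpE (t + 1))) s
    rw [hev] at e₂
    refine ⟨_, e₂, ?_⟩
    rw [hc]
    have hA : (tmpE t).eval s = e.eval u d ρ := by simpa only [tmpE, Expr.eval] using hx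
    have hB : (tmpE (t + 1)).eval s = f.eval u d ρ := by simpa only [tmpE, Expr.eval] using hy
    have c1 : (tmpE t).cost s = bits t + bits (e.eval u d ρ) := by rw [← hA]; rfl
    have c2 : (tmpE (t + 1)).cost s = bits ((t + 1 : ℕ) : ℤ) + bits (f.eval u d ρ) := by
      rw [← hB]; rfl
    rw [hA, hB, c1, c2]
    have mono : ∀ {m n : ℕ}, m ≤ n → Z ^ m ≤ Z ^ n := fun h => Nat.pow_le_pow_right (by omega) h
    set m := e.kap κ + f.kap κ + t + 1 with hm
    have := (Term.bits_eval_le hZ hu hr e d ρ he hρ).trans (mono (show _ ≤ m by omega))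
    have := (Term.bits_eval_le hZ hu hr f d ρ hf hρ).trans (mono (show _ ≤ m by omega))
    have := hb (e.eval u d ρ) (f.eval u d ρ)
    have := (bits_lit_le hZ t).trans (mono (show t ≤ m by omega))
    have := (bits_lit_le hZ (t + 1)).trans (mono (show t + 1 ≤ m by omega))
    have : 1 ≤ Z ^ m := Nat.one_le_pow _ _ (by omega)
    refine le_pow_of_le_mul (k := 4) (m := m) hZ ?_ le_rfl
    omega
  induction e with
  | lit z =>
    intro d t _
    refine ⟨_, computes_atom (m := bits z) ?_⟩
    intro Z u ρ hZ hu hρ s hs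
    exact ⟨rfl, (Nat.lt_pow_self (by omega : 1 < Z)).le⟩
  | var v =>
    intro d t hv
    simp only [ok, decide_eq_true_eq] at hv
    refine ⟨_, computes_atom (m := v + 1 + 1) ?_⟩
    intro Z u ρ hZ hu hρ s hs
    have h1 : (varE v).eval s = ρ v := by simp only [varE, Expr.eval]; exact hs.vars v hv
    refine ⟨h1, ?_⟩
    have c1 : (varE v).cost s = bits v + bits (ρ v) := by rw [← h1]; rfl
    have mono : ∀ {m n : ℕ}, m ≤ n → Z ^ m ≤ Z ^ n := fun h => Nat.pow_le_pow_right (by omega) h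
    have h2 := bits_le_of_lt (hρ v hv).1 (hρ v hv).2
    have h3 : Z ≤ Z ^ (v + 1) := by simpa using mono (show 1 ≤ v + 1 by omega)
    have h4 := (bits_lit_le hZ v).trans (mono (show v ≤ v + 1 by omega))
    exact le_pow_of_le_mul (k := 1) (m := v + 1) hZ (by omega) le_rfl
  | par c =>
    intro d t _
    refine ⟨_, computes_atom (m := c + 1 + 1) ?_⟩
    intro Z u ρ hZ hu hρ s hs
    have h1 : (parE c).eval s = u 40 c := by
      simp only [parE, Expr.eval]; rw [hs.user 40 le_rfl]
    refine ⟨h1, ?_⟩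
    have c1 : (parE c).cost s = bits c + bits (u 40 c) := by rw [← h1]; rfl
    have mono : ∀ {m n : ℕ}, m ≤ n → Z ^ m ≤ Z ^ n := fun h => Nat.pow_le_pow_right (by omega) h
    have h2 := bits_le_of_lt (hu.par c).1 (hu.par c).2
    have h3 : Z ≤ Z ^ (c + 1) := by simpa using mono (show 1 ≤ c + 1 by omega)
    have h4 := (bits_lit_le hZ c).trans (mono (show c ≤ c + 1 by omega))
    exact le_pow_of_le_mul (k := 1) (m := c + 1) hZ (by omega) le_rfl
  | get a e ih =>
    intro d t he
    simp only [ok, Bool.and_eq_true] at he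
    have ha := hr a he.1
    obtain ⟨T, hT⟩ := ih d t he.2
    refine ⟨_, computes_then (m := t + e.kap κ + κ a + 2) hT ?_⟩
    intro Z u ρ hZ hu hρ s hs hx
    have hA : (tmpE t).eval s = e.eval u d ρ := by simpa only [tmpE, Expr.eval] using hx
    have c1 : (tmpE t).cost s = bits t + bits (e.eval u d ρ) := by rw [← hA]; rfl
    have h1 : (Expr.load a (tmpE t)).eval s = u a (e.eval u d ρ) := by
      simp only [Expr.eval, hA]; rw [hs.user a (by omega)]
    refine ⟨h1, ?_⟩
    have c2 : (Expr.load a (tmpE t)).cost s = (tmpE t).cost s + bits (u a (e.eval u d ρ)) := by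
      rw [← h1]; rfl
    rw [c2, c1]
    have mono : ∀ {m n : ℕ}, m ≤ n → Z ^ m ≤ Z ^ n := fun h => Nat.pow_le_pow_right (by omega) h
    set m := t + e.kap κ + κ a with hm
    have := (Term.bits_eval_le hZ hu hr e d ρ he.2 hρ).trans (mono (show _ ≤ m by omega))
    have := (hu.cell a ha (e.eval u d ρ)).trans (mono (show _ ≤ m by omega))
    have := (bits_lit_le hZ t).trans (mono (show t ≤ m by omega))
    exact le_pow_of_le_mul (k := 2) (m := m) hZ (by omega) le_rfl
  | add e f ihe ihf =>
    intro d t h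
    simp only [ok, Bool.and_eq_true] at h
    obtain ⟨T₁, h1⟩ := ihe d t h.1
    obtain ⟨T₂, h2⟩ := ihf d (t + 1) h.2
    exact binop (op := .add) (v := (· + ·)) h.1 h.2 h1 h2 (fun _ _ _ => rfl) (fun _ _ _ => rfl)
      bits_add_le
  | sub e f ihe ihf =>
    intro d t h
    simp only [ok, Bool.and_eq_true] at h
    obtain ⟨T₁, h1⟩ := ihe d t h.1
    obtain ⟨T₂, h2⟩ := ihf d (t + 1) h.2
    exact binop (op := .sub) (v := (· - ·)) h.1 h.2 h1 h2 (fun _ _ _ => rfl) (fun _ _ _ => rfl)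
      bits_sub_le
  | mul e f ihe ihf =>
    intro d t h
    simp only [ok, Bool.and_eq_true] at h
    obtain ⟨T₁, h1⟩ := ihe d t h.1
    obtain ⟨T₂, h2⟩ := ihf d (t + 1) h.2
    exact binop (op := .mul) (v := (· * ·)) h.1 h.2 h1 h2 (fun _ _ _ => rfl) (fun _ _ _ => rfl)
      bits_mul_le
  | div e f ihe ihf =>
    intro d t h
    simp only [ok, Bool.and_eq_true] at h
    obtain ⟨T₁, h1⟩ := ihe d t h.1
    obtain ⟨T₂, h2⟩ := ihf d (t + 1) h.2
    exact binop (op := .div) (v := (· / ·)) h.1 h.2 h1 h2 (fun _ _ _ => rfl) (fun _ _ _ => rfl)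
      (fun x y => (bits_div_le x y).trans (by omega))
  | lt e f ihe ihf =>
    intro d t h
    simp only [ok, Bool.and_eq_true] at h
    obtain ⟨T₁, h1⟩ := ihe d t h.1
    obtain ⟨T₂, h2⟩ := ihf d (t + 1) h.2
    refine ⟨_, computes_binary (T₃ := e.kap κ + f.kap κ + t + 1 + 5) h1 h2 ?_⟩
    intro Z u ρ hZ hu hρ s hs hx hy
    have hA : (tmpE t).eval s = e.eval u d ρ := by simpa only [tmpE, Expr.eval] using hx
    have hB : (tmpE (t + 1)).eval s = f.eval u d ρ := by simpa only [tmpE, Expr.eval] using hy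
    have hev : (Expr.sub (tmpE (t + 1)) (tmpE t)).eval s = f.eval u d ρ - e.eval u d ρ := by
      rw [← hA, ← hB]; rfl
    have c1 : (Expr.sub (tmpE (t + 1)) (tmpE t)).cost s = bits ((t + 1 : ℕ) : ℤ) +
        bits (f.eval u d ρ) + (bits t + bits (e.eval u d ρ)) +
        bits (f.eval u d ρ - e.eval u d ρ) := by rw [← hA, ← hB]; rfl
    have mono : ∀ {m n : ℕ}, m ≤ n → Z ^ m ≤ Z ^ n := fun h => Nat.pow_le_pow_right (by omega) h
    set m := e.kap κ + f.kap κ + t + 1 with hm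
    have := (Term.bits_eval_le hZ hu hr e d ρ h.1 hρ).trans (mono (show _ ≤ m by omega))
    have := (Term.bits_eval_le hZ hu hr f d ρ h.2 hρ).trans (mono (show _ ≤ m by omega))
    have := bits_sub_le (f.eval u d ρ) (e.eval u d ρ)
    have := (bits_lit_le hZ t).trans (mono (show t ≤ m by omega))
    have := (bits_lit_le hZ (t + 1)).trans (mono (show t + 1 ≤ m by omega))
    have : 1 ≤ Z ^ m := Nat.one_le_pow _ _ (by omega)
    have b0 : bits 0 = 1 := by simp [bits]
    have b1 : bits 1 = 2 := by simp [bits]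
    by_cases hlt : e.eval u d ρ < f.eval u d ρ
    · refine ⟨_, Exec.branch_pos (t₁ := bits t + bits 1 + 1) (by rw [hev]; omega) ?_, ?_⟩
      · simp only [eval, if_pos hlt]; exact Exec.store_lit 42 t (.lit 1) s
      · rw [c1]
        exact le_pow_of_le_mul (k := 5) (m := m) hZ (by omega) le_rfl
    · refine ⟨_, Exec.branch_neg (t₁ := bits t + bits 0 + 1) (by rw [hev]; omega) ?_, ?_⟩
      · simp only [eval, if_neg hlt]; exact Exec.store_lit 42 t (.lit 0) s
      · rw [c1]
        exact le_pow_of_le_mul (k := 5) (m := m) hZ (by omega) le_rfl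
  | mod e c ih =>
    intro d t he
    simp only [ok] at he
    obtain ⟨T, hT⟩ := ih d t he
    refine ⟨_, computes_then (m := t + e.kap κ + c + 1 + 7) hT ?_⟩
    intro Z u ρ hZ hu hρ s hs hx
    have hA : (tmpE t).eval s = e.eval u d ρ := by simpa only [tmpE, Expr.eval] using hx
    have hC : (parE c).eval s = u 40 c := by
      simp only [parE, Expr.eval]; rw [hs.user 40 le_rfl]
    set x := e.eval u d ρ with hxdef
    set y := u 40 c with hy
    have hv : x - x / (y + 1) * (y + 1) = x % (y + 1) := by
      have := Int.ediv_mul_add_emod x (y + 1); linarith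
    have hev : (Expr.sub (tmpE t) (.mul (.div (tmpE t) (.add (parE c) (.lit 1)))
        (.add (parE c) (.lit 1)))).eval s = x % (y + 1) := by
      rw [← hv, ← hA, ← hC]; rfl
    refine ⟨hev, ?_⟩
    have c1 : (Expr.sub (tmpE t) (.mul (.div (tmpE t) (.add (parE c) (.lit 1)))
        (.add (parE c) (.lit 1)))).cost s = (bits t + bits x) + (((bits t + bits x) +
          ((bits c + bits y) + bits 1 + bits (y + 1)) + bits (x / (y + 1))) +
          ((bits c + bits y) + bits 1 + bits (y + 1)) + bits (x / (y + 1) * (y + 1))) +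
          bits (x - x / (y + 1) * (y + 1)) := by
      rw [← hA, ← hC]; rfl
    rw [c1]
    have mono : ∀ {m n : ℕ}, m ≤ n → Z ^ m ≤ Z ^ n := fun h => Nat.pow_le_pow_right (by omega) h
    set m := t + e.kap κ + c + 1 with hm
    have hbx : bits x ≤ Z ^ m :=
      (Term.bits_eval_le hZ hu hr e d ρ he hρ).trans (mono (show _ ≤ m by omega))
    have := (bits_lit_le hZ t).trans (mono (show t ≤ m by omega))
    have := (bits_lit_le hZ c).trans (mono (show c ≤ m by omega))
    have h3 : Z ≤ Z ^ m := by simpa using mono (show 1 ≤ m by omega)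
    have hby : bits y ≤ Z := bits_le_of_lt (hu.par c).1 (hu.par c).2
    have b1 : bits 1 = 2 := by simp [bits]
    have := bits_add_le y 1
    have := bits_div_le x (y + 1)
    have := bits_mul_le (x / (y + 1)) (y + 1)
    have := bits_sub_le x (x / (y + 1) * (y + 1))
    exact le_pow_of_le_mul (k := 7) (m := m) hZ (by omega) le_rfl
  | sum c e ih =>
    intro d t he
    simp only [ok] at he
    obtain ⟨T, hT⟩ := ih (d + 1) (t + 1) he
    exact computes_loop hr he hT 0 (fun f n => ∑ k ∈ Finset.range n, f k) (fun f => by simp) .add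
      (fun f n A B s hA hB => by rw [Finset.sum_range_succ, ← hA, ← hB]; rfl)
      (fun _ _ _ => rfl) (fun f n b h => (bits_sum_le n h).trans (by omega))
  | prod c e ih =>
    intro d t he
    simp only [ok] at he
    obtain ⟨T, hT⟩ := ih (d + 1) (t + 1) he
    exact computes_loop hr he hT 1 (fun f n => ∏ k ∈ Finset.range n, f k) (fun f => by simp) .mul
      (fun f n A B s hA hB => by rw [Finset.prod_range_succ, ← hA, ← hB]; rfl)
      (fun _ _ _ => rfl) (fun f n b h => bits_prod_le n h)

end Ram

/-! ### Commands: filling arrays and repeating -/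

namespace Ram

/-- Commands of the array language: fill the cells `0, …, N - 1` of an array with the values of a
term, execute in sequence, and repeat `N` times. -/
inductive Cmd where
  | arr (a c : ℕ) (e : Term)
  | seq (p q : Cmd)
  | rep (c : ℕ) (p : Cmd)

/-- Replace the cells `0, …, n - 1` of the array `a`. -/
def fill (u : Store) (a : ℕ) (n : ℤ) (f : ℤ → ℤ) : Store :=
  Function.update u a fun i => if 0 ≤ i ∧ i < n then f i else u a i

theorem fill_same (u : Store) (a : ℕ) (n : ℤ) (f : ℤ → ℤ) (i : ℤ) :
    fill u a n f a i = if 0 ≤ i ∧ i < n then f i else u a i := by simp [fill]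

theorem fill_ne (u : Store) {a b : ℕ} (n : ℤ) (f : ℤ → ℤ) (h : b ≠ a) : fill u a n f b = u b := by
  simp [fill, h]

theorem fill_zero (u : Store) (a : ℕ) (f : ℤ → ℤ) : fill u a 0 f = u := by
  funext b
  by_cases h : b = a
  · subst h; funext i; rw [fill_same, if_neg (by omega)]
  · rw [fill_ne _ _ _ h]

theorem setCell_fill (u : Store) (a : ℕ) (n : ℕ) (f : ℤ → ℤ) :
    setCell (fill u a n f) a n (f n) = fill u a ((n + 1 : ℕ) : ℤ) f := by
  funext b
  by_cases h : b = a
  · subst h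
    funext i
    by_cases hi : i = n
    · subst hi; rw [setCell_same, fill_same, if_pos (by omega)]
    · rw [setCell_ne_cell _ _ _ _ hi, fill_same, fill_same]
      congr 1
      simp only [eq_iff_iff]; omega
  · rw [setCell_ne _ _ _ h, fill_ne _ _ _ h, fill_ne _ _ _ h]

namespace Cmd

/-- The effect of a command on the user arrays. -/
def run : Cmd → ℕ → (ℕ → ℤ) → Store → Store
  | .arr a c e, d, ρ, u => fill u a (u 40 c) fun i => e.eval u (d + 1) (Function.update ρ d i)
  | .seq p q, d, ρ, u => q.run d ρ (p.run d ρ u)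
  | .rep c p, d, ρ, u => (List.range (u 40 c).toNat).foldl
      (fun st (k : ℕ) => p.run (d + 1) (Function.update ρ d (k : ℤ)) st) u

/-- The machine code of a command. -/
def comp : Cmd → ℕ → Prog
  | .arr a c e, d => forLoop d c (.seq (e.comp (d + 1) 0) (.store a (varE d) (tmpE 0)))
  | .seq p q, d => .seq (p.comp d) (q.comp d)
  | .rep c p, d => forLoop d c (p.comp (d + 1))

/-- Arrays are filled with terms that do not read them and are small enough for them. -/
def ok (κ : ℕ → ℕ) : Cmd → ℕ → Bool
  | .arr a _ e, d => decide (a < 40) && e.ok (fun b => decide (b < 40) && decide (b ≠ a)) (d + 1) &&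
      decide (e.kap κ ≤ κ a)
  | .seq p q, d => p.ok κ d && q.ok κ d
  | .rep _ p, d => p.ok κ (d + 1)

/-- The conclusion reproduces `Bounded` with the same `κ` and the same `Z`. Hence the sizes do not
accumulate over the rounds of a repetition, whose cost is only multiplied by the number of rounds.
-/
theorem exec_comp {κ : ℕ → ℕ} (p : Cmd) : ∀ d, p.ok κ d = true → ∃ T, ∀ (Z : ℕ) (u : Store)
    (ρ : ℕ → ℤ), 2 ≤ Z → Bounded κ Z u → VarsLt Z d ρ → ∀ s, Match u d ρ s →
      ∃ s' τ, Exec (p.comp d) s s' τ ∧ τ ≤ Z ^ T ∧ Match (p.run d ρ u) d ρ s' ∧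
        Bounded κ Z (p.run d ρ u) ∧ p.run d ρ u 40 = u 40 := by
  induction p with
  | arr a c e =>
    intro d h
    simp only [ok, Bool.and_eq_true, decide_eq_true_eq] at h
    obtain ⟨⟨ha, he⟩, hκ⟩ := h
    have hr : ∀ b, (decide (b < 40) && decide (b ≠ a)) = true → b < 40 := by
      intro b hb; simp only [Bool.and_eq_true, decide_eq_true_eq] at hb; exact hb.1
    obtain ⟨T, hT⟩ := Term.exec_comp (κ := κ) hr e (d + 1) 0 he
    refine ⟨((T + κ a + d + 1 + 4) + c + d + 7), ?_⟩
    intro Z u ρ hZ hu hρ s hs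
    have mono : ∀ {m n : ℕ}, m ≤ n → Z ^ m ≤ Z ^ n := fun h => Nat.pow_le_pow_right (by omega) h
    obtain ⟨N, hN⟩ : ∃ N : ℕ, u 40 c = N := ⟨(u 40 c).toNat, by have := hu.par c; omega⟩
    have hNZ : N < Z := by have := hu.par c; omega
    set f : ℤ → ℤ := fun i => e.eval u (d + 1) (Function.update ρ d i) with hf
    have h40 : ∀ n : ℤ, fill u a n f 40 = u 40 := fun n => fill_ne _ _ _ (by omega)
    -- The term does not read the array being filled, so the cells already written do not influence
    -- the later ones, and filling in place agrees with `run`.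
    have hev : ∀ (n : ℤ) ρ', e.eval (fill u a n f) (d + 1) ρ' = e.eval u (d + 1) ρ' := by
      intro n ρ'
      refine Term.eval_congr (h40 n) (fun b hb => ?_) e _ _ he
      simp only [Bool.and_eq_true, decide_eq_true_eq] at hb
      exact fill_ne _ _ _ hb.2
    have hfb : ∀ k : ℕ, k < N → bits (f k) ≤ Z ^ κ a := fun k hk =>
      (Term.bits_eval_le hZ hu hr e (d + 1) _ he (hρ.push (by omega))).trans (mono hκ)
    have hB : ∀ n : ℕ, n ≤ N → Bounded κ Z (fill u a n f) := by
      intro n hn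
      refine ⟨fun b hb i => ?_, fun c => by rw [h40]; exact hu.par c⟩
      by_cases hba : b = a
      · subst hba
        rw [fill_same]
        split_ifs with hi
        · obtain ⟨k, rfl⟩ := Int.eq_ofNat_of_zero_le hi.1
          exact hfb k (by omega)
        · exact hu.cell b hb i
      · rw [fill_ne _ _ _ hba]; exact hu.cell b hb i
    have hrun : (arr a c e).run d ρ u = fill u a N f := by simp only [run, hN, hf]
    rw [hrun]
    obtain ⟨s', τ, e₁, hτ, hR⟩ := exec_forLoop (c := c) (d := d) (T := T + κ a + d + 1 + 4) hZ
      (body := .seq (e.comp (d + 1) 0) (.store a (varE d) (tmpE 0)))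
      (fun k st => Match (fill u a k f) d ρ st ∧ st 41 d = k) hNZ
      (fun k st h => by rw [h.1.user 40 le_rfl, h40, hN]) (fun k st h => h.2)
      (s := s) (by
        refine ⟨?_, setCell_same _ _ _ _⟩
        rw [Nat.cast_zero, fill_zero]; exact hs.setVar _) (by
        intro k hk st hst
        obtain ⟨hM, hv⟩ := hst
        obtain ⟨s₁, τ₁, e₁, hτ₁, hs₁, -, hv₁⟩ := hT Z _ _ hZ (hB k hk.le)
          (hρ.push (k := k) (by omega)) st (hM.push hv)
        have hd : s₁ 41 d = k := by have := hs₁.vars d (by omega); simpa using this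
        simp only [hev] at hv₁
        have hA : (varE d).eval s₁ = k := by simpa only [varE, Expr.eval] using hd
        have hC : (tmpE 0).eval s₁ = f k := by simpa only [tmpE, Expr.eval] using hv₁
        have e₂ := Exec.store a (varE d) (tmpE 0) s₁
        rw [hA, hC] at e₂
        refine ⟨_, _, Exec.seq e₁ e₂, ?_, ?_, ?_, setCell_same _ _ _ _⟩
        · have c1 : (varE d).cost s₁ = bits d + bits k := by rw [← hA]; rfl
          have c2 : (tmpE 0).cost s₁ = bits 0 + bits (f k) := by rw [← hC]; rfl
          rw [c1, c2]
          set m := T + κ a + d + 1 with hm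
          have := hτ₁.trans (mono (show T ≤ m by omega))
          have := (hfb k hk).trans (mono (show κ a ≤ m by omega))
          have := (bits_lit_le hZ d).trans (mono (show d ≤ m by omega))
          have hkb : bits (k : ℤ) ≤ Z := bits_le_of_lt (by omega) (by omega)
          have h3 : Z ≤ Z ^ m := by simpa using mono (show 1 ≤ m by omega)
          have b0 : bits 0 = 1 := by simp [bits]
          exact le_pow_of_le_mul (k := 4) (m := m) hZ (by omega) le_rfl
        · rw [Function.update_of_ne (by omega)]; exact hd
        · have key : Match (fill u a ((k + 1 : ℕ) : ℤ) f) d ρ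
              (Function.update s₁ a (Function.update (s₁ a) (k : ℤ) (f k))) := by
            refine ⟨fun b hb => ?_, fun v hv => ?_⟩
            · rw [← setCell_fill]
              by_cases hba : b = a
              · subst hba
                simp only [setCell, Function.update_self, hs₁.user b hb]
              · rw [Function.update_of_ne hba, setCell_ne _ _ _ hba, hs₁.user b hb]
            · rw [Function.update_of_ne (by omega)]
              exact hs₁.pop.vars v hv
          exact key.setVar _)
    exact ⟨s', τ, e₁, hτ, hR.1, hB N le_rfl, h40 _⟩
  | seq p q ihp ihq =>
    intro d h
    simp only [ok, Bool.and_eq_true] at h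
    obtain ⟨T₁, h1⟩ := ihp d h.1
    obtain ⟨T₂, h2⟩ := ihq d h.2
    refine ⟨T₁ + T₂ + 2, ?_⟩
    intro Z u ρ hZ hu hρ s hs
    obtain ⟨s₁, τ₁, e₁, hτ₁, hM₁, hB₁, hP₁⟩ := h1 Z u ρ hZ hu hρ s hs
    obtain ⟨s₂, τ₂, e₂, hτ₂, hM₂, hB₂, hP₂⟩ := h2 Z _ ρ hZ hB₁ hρ s₁ hM₁
    refine ⟨s₂, _, Exec.seq e₁ e₂, ?_, hM₂, hB₂, hP₂.trans hP₁⟩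
    have mono : ∀ {m n : ℕ}, m ≤ n → Z ^ m ≤ Z ^ n := fun h => Nat.pow_le_pow_right (by omega) h
    have := hτ₁.trans (mono (show T₁ ≤ T₁ + T₂ by omega))
    have := hτ₂.trans (mono (show T₂ ≤ T₁ + T₂ by omega))
    have : 1 ≤ Z ^ (T₁ + T₂) := Nat.one_le_pow _ _ (by omega)
    exact le_pow_of_le_mul (k := 2) (m := T₁ + T₂) hZ (by omega) le_rfl
  | rep c p ih =>
    intro d h
    simp only [ok] at h
    obtain ⟨T, hT⟩ := ih (d + 1) h
    refine ⟨T + c + d + 7, ?_⟩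
    intro Z u ρ hZ hu hρ s hs
    obtain ⟨N, hN⟩ : ∃ N : ℕ, u 40 c = N := ⟨(u 40 c).toNat, by have := hu.par c; omega⟩
    have hNZ : N < Z := by have := hu.par c; omega
    let F : ℕ → Store := fun n => (List.range n).foldl
      (fun st (k : ℕ) => p.run (d + 1) (Function.update ρ d (k : ℤ)) st) u
    have hF : ∀ n, F (n + 1) = p.run (d + 1) (Function.update ρ d (n : ℤ)) (F n) := by
      intro n; simp only [F, List.range_succ, List.foldl_append, List.foldl_cons, List.foldl_nil]
    have hrun : (rep c p).run d ρ u = F N := by simp only [run, hN, Int.toNat_natCast, F]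
    rw [hrun]
    obtain ⟨s', τ, e₁, hτ, hR⟩ := exec_forLoop (c := c) (d := d) (T := T) hZ
      (body := p.comp (d + 1))
      (fun k st => (Match (F k) d ρ st ∧ Bounded κ Z (F k) ∧ F k 40 = u 40) ∧ st 41 d = k) hNZ
      (fun k st h => by rw [h.1.1.user 40 le_rfl, h.1.2.2, hN]) (fun k st h => h.2)
      (s := s) ⟨⟨hs.setVar _, hu, rfl⟩, setCell_same _ _ _ _⟩ (by
        intro k hk st hst
        obtain ⟨⟨hM, hB, hP⟩, hv⟩ := hst
        obtain ⟨s₁, τ₁, e₁, hτ₁, hM₁, hB₁, hP₁⟩ := hT Z _ _ hZ hB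
          (hρ.push (k := k) (by omega)) st (hM.push hv)
        rw [← hF] at hM₁ hB₁ hP₁
        refine ⟨s₁, τ₁, e₁, hτ₁, ?_, ⟨hM₁.pop.setVar _, hB₁, hP₁.trans hP⟩, setCell_same _ _ _ _⟩
        have := hM₁.vars d (by omega)
        simpa using this)
    exact ⟨s', τ, e₁, hτ, hR.1⟩

end Cmd

theorem Cmd.run_rep_induction {c d N : ℕ} {p : Cmd} {ρ : ℕ → ℤ} {u : Store}
    (Inv : ℕ → Store → Prop) (hN : u 40 c = N) (h0 : Inv 0 u)
    (step : ∀ k < N, ∀ st, Inv k st → Inv (k + 1) (p.run (d + 1) (Function.update ρ d (k : ℤ)) st)) :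
    Inv N ((Cmd.rep c p).run d ρ u) := by
  have key : ∀ n ≤ N, Inv n ((List.range n).foldl
      (fun st (k : ℕ) => p.run (d + 1) (Function.update ρ d (k : ℤ)) st) u) := by
    intro n
    induction n with
    | zero => intro _; exact h0
    | succ n ih =>
      intro hn
      simp only [List.range_succ, List.foldl_append, List.foldl_cons, List.foldl_nil]
      exact step n hn _ (ih (by omega))
  have := key N le_rfl
  simpa only [Cmd.run, hN, Int.toNat_natCast] using this

/-- A repetition preserves what its body preserves. -/
theorem Cmd.run_rep_preserves {c d : ℕ} {p : Cmd} {ρ : ℕ → ℤ} {u : Store} (Inv : Store → Prop)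
    (hc : 0 ≤ u 40 c) (h0 : Inv u)
    (step : ∀ (k : ℕ) st, Inv st → Inv (p.run (d + 1) (Function.update ρ d (k : ℤ)) st)) :
    Inv ((Cmd.rep c p).run d ρ u) :=
  Cmd.run_rep_induction (N := (u 40 c).toNat) (fun _ => Inv) (by omega) h0
    fun k _ st h => step k st h

/-- If one round of a repetition achieves `Q`, and all rounds preserve it, then `Q` holds in the
end. -/
theorem Cmd.run_rep_reaches {c d k₀ : ℕ} {p : Cmd} {ρ : ℕ → ℤ} {u : Store} (Inv Q : Store → Prop)
    (hk : (k₀ : ℤ) < u 40 c) (h0 : Inv u)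
    (step : ∀ (k : ℕ) st, Inv st → Inv (p.run (d + 1) (Function.update ρ d (k : ℤ)) st))
    (keep : ∀ (k : ℕ) st, Inv st → Q st → Q (p.run (d + 1) (Function.update ρ d (k : ℤ)) st))
    (reach : ∀ st, Inv st → Q (p.run (d + 1) (Function.update ρ d (k₀ : ℤ)) st)) :
    Q ((Cmd.rep c p).run d ρ u) := by
  obtain ⟨N, hN⟩ : ∃ N : ℕ, u 40 c = N := ⟨(u 40 c).toNat, by omega⟩
  have := Cmd.run_rep_induction (c := c) (d := d) (p := p) (ρ := ρ) (u := u)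
    (fun k st => Inv st ∧ (k₀ < k → Q st)) hN ⟨h0, fun h => absurd h (by omega)⟩
    (by
      intro k _ st ⟨hI, hQ⟩
      refine ⟨step k st hI, fun h => ?_⟩
      by_cases hlt : k₀ < k
      · exact keep k st hI (hQ hlt)
      · obtain rfl : k₀ = k := by omega
        exact reach st hI)
  exact this.2 (by omega)

/-! #### Setting the parameters -/

/-- Code that sets the parameters `c, c + 1, …` to the values of the given terms. -/
def setPars : List Term → ℕ → Prog
  | [], _ => .skip
  | e :: l, c => .seq (e.comp 0 0) (.seq (.store 40 (.lit c) (tmpE 0)) (setPars l (c + 1)))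

/-- The effect of `setPars`. -/
def runPars (ρ : ℕ → ℤ) : List Term → ℕ → Store → Store
  | [], _, u => u
  | e :: l, c, u => runPars ρ l (c + 1) (setCell u 40 c (e.eval u 0 ρ))

/-- All parameters computed by `setPars` are natural numbers below `Z`. -/
def ParsLt (Z : ℕ) (ρ : ℕ → ℤ) : List Term → ℕ → Store → Prop
  | [], _, _ => True
  | e :: l, c, u => (0 ≤ e.eval u 0 ρ ∧ e.eval u 0 ρ < Z) ∧
      ParsLt Z ρ l (c + 1) (setCell u 40 c (e.eval u 0 ρ))

theorem exec_setPars {κ : ℕ → ℕ} (ρ : ℕ → ℤ) (l : List Term) :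
    (∀ e ∈ l, e.ok (fun b => decide (b < 40)) 0 = true) →
    ∀ c, ∃ T, ∀ (Z : ℕ) (u : Store), 2 ≤ Z → Bounded κ Z u → ParsLt Z ρ l c u → ∀ s,
      Match u 0 ρ s → ∃ s' τ, Exec (setPars l c) s s' τ ∧ τ ≤ Z ^ T ∧
        Match (runPars ρ l c u) 0 ρ s' ∧ Bounded κ Z (runPars ρ l c u) := by
  induction l with
  | nil =>
    intro _ c
    refine ⟨0, fun Z u hZ hu _ s hs => ⟨s, 1, Exec.skip s, by simp, hs, hu⟩⟩
  | cons e l ih =>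
    intro hl c
    obtain ⟨T₁, h1⟩ := Term.exec_comp (κ := κ) (fun b hb => by simpa using hb) e 0 0
      (hl e (by simp))
    obtain ⟨T₂, h2⟩ := ih (fun e he => hl e (by simp [he])) (c + 1)
    refine ⟨T₁ + T₂ + c + 1 + 4, ?_⟩
    intro Z u hZ hu hp s hs
    obtain ⟨s₁, τ₁, e₁, hτ₁, hM₁, -, hv₁⟩ := h1 Z u ρ hZ hu (fun v hv => by omega) s hs
    set x := e.eval u 0 ρ with hx
    have hC : (tmpE 0).eval s₁ = x := by simpa only [tmpE, Expr.eval] using hv₁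
    have e₂ := Exec.store_lit 40 c (tmpE 0) s₁
    rw [hC] at e₂
    have hB : Bounded κ Z (setCell u 40 c x) := by
      refine ⟨fun a ha i => ?_, fun k => ?_⟩
      · rw [setCell_ne _ _ _ (by omega)]; exact hu.cell a ha i
      · by_cases hk : k = c
        · subst hk; rw [setCell_same]; exact hp.1
        · rw [setCell_ne_cell _ _ _ _ (by exact_mod_cast hk)]; exact hu.par k
    have hM : Match (setCell u 40 c x) 0 ρ (setCell s₁ 40 c x) := by
      refine ⟨fun a ha => ?_, fun v hv => by omega⟩
      by_cases h : a = 40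
      · subst h; simp only [setCell, Function.update_self, hM₁.user 40 le_rfl]
      · rw [setCell_ne _ _ _ h, setCell_ne _ _ _ h, hM₁.user a ha]
    obtain ⟨s₃, τ₃, e₃, hτ₃, hM₃, hB₃⟩ := h2 Z _ hZ hB hp.2 _ hM
    refine ⟨s₃, _, Exec.seq e₁ (Exec.seq e₂ e₃), ?_, hM₃, hB₃⟩
    have mono : ∀ {m n : ℕ}, m ≤ n → Z ^ m ≤ Z ^ n := fun h => Nat.pow_le_pow_right (by omega) h
    have c2 : (tmpE 0).cost s₁ = bits 0 + bits x := by rw [← hC]; rfl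
    rw [c2]
    set m := T₁ + T₂ + c + 1 with hm
    have := hτ₁.trans (mono (show T₁ ≤ m by omega))
    have := hτ₃.trans (mono (show T₂ ≤ m by omega))
    have := (bits_lit_le hZ c).trans (mono (show c ≤ m by omega))
    have hkb : bits x ≤ Z := bits_le_of_lt hp.1.1 hp.1.2
    have h3 : Z ≤ Z ^ m := by simpa using mono (show 1 ≤ m by omega)
    have b0 : bits 0 = 1 := by simp [bits]
    exact le_pow_of_le_mul (k := 4) (m := m) hZ (by omega) le_rfl

end Ram

/-! ### Three-wise independent sampling -/

namespace Sampling

/-- The hash value of `i` under the seed `σ`: a polynomial of degree at most two. -/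
def hash {P : ℕ} (σ : ZMod P × ZMod P × ZMod P) (i : ℕ) : ZMod P :=
  (σ.1 * i + σ.2.1) * i + σ.2.2

/-- The random set given by a seed: `i` is chosen if its hash value is less than `τ i`. -/
def sample {P n : ℕ} (τ : Fin n → ℕ) (σ : ZMod P × ZMod P × ZMod P) : Finset (Fin n) :=
  Finset.univ.filter fun i => (hash σ i).val < τ i

/-- The indicator function of the sample. -/
def ind {P n : ℕ} (τ : Fin n → ℕ) (σ : ZMod P × ZMod P × ZMod P) (i : Fin n) : ℝ :=
  if i ∈ sample τ σ then 1 else 0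

theorem ind_eq {P n : ℕ} (τ : Fin n → ℕ) (σ : ZMod P × ZMod P × ZMod P) (i : Fin n) :
    ind τ σ i = if (hash σ i).val < τ i then 1 else 0 := by
  simp only [ind, sample, Finset.mem_filter, Finset.mem_univ, true_and]

section
variable {P : ℕ} [hP : Fact P.Prime]

theorem natCast_injOn {i j : ℕ} (hi : i < P) (hj : j < P) (h : (i : ZMod P) = j) : i = j := by
  have := congrArg ZMod.val h
  rwa [ZMod.val_natCast_of_lt hi, ZMod.val_natCast_of_lt hj] at this

theorem sub_ne_zero_of_ne {i j : ℕ} (hi : i < P) (hj : j < P) (h : i ≠ j) :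
    (i : ZMod P) - j ≠ 0 := sub_ne_zero.2 fun e => h (natCast_injOn hi hj e)

/-- For fixed first two coefficients the constant coefficient shifts the hash value through all
residues. Single points need this lower bound; pairs and triples need only upper bounds. -/
theorem le_card_hash_lt (i τ : ℕ) (hτ : τ ≤ P) :
    P ^ 2 * τ ≤ (Finset.univ.filter fun σ : ZMod P × ZMod P × ZMod P =>
      (hash σ i).val < τ).card := by
  classical
  have e : P ^ 2 * τ = ((Finset.univ : Finset (ZMod P)) ×ˢ (Finset.univ : Finset (ZMod P)) ×ˢ
      Finset.range τ).card := by
    simp [ZMod.card]; ring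
  rw [e]
  refine Finset.card_le_card_of_injOn
    (fun x => (x.1, x.2.1, (x.2.2 : ZMod P) - (x.1 * i + x.2.1) * i)) ?_ ?_
  · rintro ⟨a, b, k⟩ hx
    simp only [Finset.coe_product, Set.mem_prod, Finset.mem_coe, Finset.mem_univ,
      Finset.mem_range, true_and] at hx
    simp only [Finset.mem_coe, Finset.mem_filter, Finset.mem_univ, true_and]
    simp only [hash]
    rw [add_sub_cancel, ZMod.val_natCast_of_lt (by omega)]
    exact hx
  · rintro ⟨a, b, k⟩ hx ⟨a', b', k'⟩ hx' h
    simp only [Finset.coe_product, Set.mem_prod, Finset.mem_coe, Finset.mem_univ,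
      Finset.mem_range, true_and] at hx hx'
    simp only [Prod.mk.injEq] at h
    obtain ⟨rfl, rfl, h⟩ := h
    rw [natCast_injOn (P := P) (by omega) (by omega) (sub_left_injective h)]

/-- Given the leading coefficient, a polynomial of degree at most two is determined by its values at
two points. -/
theorem card_hash_lt_pair {i j : ℕ} (hi : i < P) (hj : j < P) (hij : i ≠ j) (τ τ' : ℕ) :
    (Finset.univ.filter fun σ : ZMod P × ZMod P × ZMod P =>
      (hash σ i).val < τ ∧ (hash σ j).val < τ').card ≤ P * τ * τ' := by
  classical
  have e : P * τ * τ' = ((Finset.univ : Finset (ZMod P)) ×ˢ Finset.range τ ×ˢ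
      Finset.range τ').card := by
    simp [ZMod.card]; ring
  rw [e]
  refine Finset.card_le_card_of_injOn (fun σ => (σ.1, (hash σ i).val, (hash σ j).val)) ?_ ?_
  · intro σ hσ
    simpa using hσ
  · rintro ⟨a, b, c⟩ - ⟨a', b', c'⟩ - h
    simp only [Prod.mk.injEq, (ZMod.val_injective P).eq_iff, hash] at h
    obtain ⟨rfl, h1, h2⟩ := h
    have h3 : ((i : ZMod P) - j) * (b - b') = 0 := by linear_combination h1 - h2
    have hb : b = b' :=
      sub_eq_zero.1 ((mul_eq_zero.1 h3).resolve_left (sub_ne_zero_of_ne hi hj hij))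
    subst hb
    have hc : c = c' := by linear_combination h1
    rw [hc]

/-- A polynomial of degree at most two is determined by its values at three points. The proof takes
divided differences; the points are distinct modulo `P` because they are less than `P`. -/
theorem card_hash_lt_triple {i j k : ℕ} (hi : i < P) (hj : j < P) (hk : k < P) (hij : i ≠ j)
    (hik : i ≠ k) (hjk : j ≠ k) (τ τ' τ'' : ℕ) :
    (Finset.univ.filter fun σ : ZMod P × ZMod P × ZMod P =>
      (hash σ i).val < τ ∧ (hash σ j).val < τ' ∧ (hash σ k).val < τ'').card ≤ τ * τ' * τ'' := by
  classical
  have e : τ * τ' * τ'' = (Finset.range τ ×ˢ Finset.range τ' ×ˢ Finset.range τ'').card := by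
    simp; ring
  rw [e]
  refine Finset.card_le_card_of_injOn
    (fun σ => ((hash σ i).val, (hash σ j).val, (hash σ k).val)) ?_ ?_
  · intro σ hσ
    simpa using hσ
  · rintro ⟨a, b, c⟩ - ⟨a', b', c'⟩ - h
    simp only [Prod.mk.injEq, (ZMod.val_injective P).eq_iff, hash] at h
    obtain ⟨h1, h2, h3⟩ := h
    have e1 : ((i : ZMod P) - j) * ((a - a') * (i + j) + (b - b')) = 0 := by
      linear_combination h1 - h2
    have e2 : ((i : ZMod P) - k) * ((a - a') * (i + k) + (b - b')) = 0 := by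
      linear_combination h1 - h3
    have e3 := (mul_eq_zero.1 e1).resolve_left (sub_ne_zero_of_ne hi hj hij)
    have e4 := (mul_eq_zero.1 e2).resolve_left (sub_ne_zero_of_ne hi hk hik)
    have e5 : ((j : ZMod P) - k) * (a - a') = 0 := by linear_combination e3 - e4
    have ha : a = a' :=
      sub_eq_zero.1 ((mul_eq_zero.1 e5).resolve_left (sub_ne_zero_of_ne hj hk hjk))
    subst ha
    have hb : b = b' := by linear_combination e3
    subst hb
    have hc : c = c' := by linear_combination h1
    rw [hc]

theorem le_sum_ind {n : ℕ} {τ : Fin n → ℕ} (hτ : ∀ i, τ i ≤ P) (i : Fin n) :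
    (P : ℝ) ^ 2 * τ i ≤ ∑ σ : ZMod P × ZMod P × ZMod P, ind τ σ i := by
  simp only [ind_eq]
  rw [Finset.sum_boole]
  exact_mod_cast le_card_hash_lt (P := P) i (τ i) (hτ i)

theorem sum_ind_pair {n : ℕ} (hn : n ≤ P) (τ : Fin n → ℕ) (i j : Fin n) (hij : i ≠ j) :
    ∑ σ : ZMod P × ZMod P × ZMod P, ind τ σ i * ind τ σ j ≤ (P : ℝ) * τ i * τ j := by
  simp only [ind_eq, ite_mul, one_mul, zero_mul, ← ite_and]
  rw [Finset.sum_boole]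
  exact_mod_cast card_hash_lt_pair (P := P) (i := i) (j := j) (by omega) (by omega)
    (fun h => hij (Fin.ext h)) (τ i) (τ j)

theorem sum_ind_triple {n : ℕ} (hn : n ≤ P) (τ : Fin n → ℕ) (i j k : Fin n) (hij : i ≠ j)
    (hik : i ≠ k) (hjk : j ≠ k) :
    ∑ σ : ZMod P × ZMod P × ZMod P, ind τ σ i * (ind τ σ j * ind τ σ k) ≤
      (τ i : ℝ) * τ j * τ k := by
  simp only [ind_eq, ite_mul, one_mul, zero_mul, ← ite_and]
  rw [Finset.sum_boole]
  exact_mod_cast card_hash_lt_triple (P := P) (i := i) (j := j) (k := k) (by omega) (by omega)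
    (by omega) (fun h => hij (Fin.ext h)) (fun h => hik (Fin.ext h)) (fun h => hjk (Fin.ext h))
    (τ i) (τ j) (τ k)

/-- If the expected number of reasons to discard a sampled element is at most `1 / 2`, then
some seed leaves half of the expected weight. -/
theorem exists_seed {n : ℕ} (hn : n ≤ P) {τ : Fin n → ℕ} (hτ : ∀ i, τ i ≤ P) {w : Fin n → ℝ}
    (hw : ∀ i, τ i ≠ 0 → 0 ≤ w i) {α : Fin n → Fin n → ℝ} {β : Fin n → Fin n → Fin n → ℝ}
    (hα : ∀ i j, 0 ≤ α i j) (hβ : ∀ i j k, 0 ≤ β i j k) (hα' : ∀ i, α i i = 0)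
    (hβ' : ∀ i j k, i = j ∨ i = k ∨ j = k → β i j k = 0)
    (good : Finset (Fin n) → Finset (Fin n))
    (hgood : ∀ S, good S ⊆ S)
    (hbad : ∀ S, ∀ i ∈ S, i ∉ good S →
      1 ≤ ∑ j ∈ S, α i j + ∑ j ∈ S, ∑ k ∈ S, β i j k)
    (hsmall : ∀ i, τ i ≠ 0 → ∑ j, α i j * ((τ j : ℝ) / P) +
      ∑ j, ∑ k, β i j k * ((τ j : ℝ) / P * ((τ k : ℝ) / P)) ≤ 1 / 2) :
    ∃ σ : ZMod P × ZMod P × ZMod P,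
      1 / 2 * ∑ i, w i * ((τ i : ℝ) / P) ≤ ∑ i ∈ good (sample τ σ), w i := by
  classical
  have hP0 : (0 : ℝ) < P := by exact_mod_cast hP.out.pos
  set x : ZMod P × ZMod P × ZMod P → Fin n → ℝ := ind τ with hxdef
  have hx : ∀ σ i, x σ i = if i ∈ sample τ σ then 1 else 0 := fun _ _ => rfl
  -- A lower bound for the surviving weight that has degree three in the indicators, so that the
  -- counts for single points, pairs and triples control its sum over all seeds.
  let G : ZMod P × ZMod P × ZMod P → ℝ := fun σ => ∑ i, w i *
    (x σ i - ∑ j, α i j * (x σ i * x σ j) - ∑ j, ∑ k, β i j k * (x σ i * (x σ j * x σ k)))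
  have hτ0 : ∀ (σ : ZMod P × ZMod P × ZMod P) i, i ∈ sample τ σ → τ i ≠ 0 := by
    intro σ i hi
    simp only [sample, Finset.mem_filter] at hi
    omega
  have hG : ∀ σ, G σ ≤ ∑ i ∈ good (sample τ σ), w i := by
    intro σ
    have h1 : ∑ i ∈ good (sample τ σ), w i = ∑ i, if i ∈ good (sample τ σ) then w i else 0 := by
      rw [Finset.sum_ite_mem, Finset.univ_inter]
    rw [h1]
    refine Finset.sum_le_sum fun i _ => ?_
    by_cases hi : i ∈ sample τ σ
    · have hwi := hw i (hτ0 σ i hi)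
      have hxi : x σ i = 1 := if_pos hi
      have e1 : ∑ j, α i j * (x σ i * x σ j) = ∑ j ∈ sample τ σ, α i j := by
        rw [hxi, ← Finset.univ_inter (sample τ σ), ← Finset.sum_ite_mem]
        refine Finset.sum_congr rfl fun j _ => ?_
        rw [hx]; split_ifs <;> simp
      have e2 : ∑ j, ∑ k, β i j k * (x σ i * (x σ j * x σ k)) =
          ∑ j ∈ sample τ σ, ∑ k ∈ sample τ σ, β i j k := by
        rw [hxi, ← Finset.univ_inter (sample τ σ), ← Finset.sum_ite_mem]
        refine Finset.sum_congr rfl fun j _ => ?_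
        rw [hx]; split_ifs with hj
        · rw [← Finset.sum_ite_mem]
          refine Finset.sum_congr rfl fun k _ => ?_
          rw [hx]; split_ifs <;> simp
        · simp
      rw [e1, e2, hxi]
      have p1 : 0 ≤ ∑ j ∈ sample τ σ, α i j := Finset.sum_nonneg fun j _ => hα i j
      have p2 : 0 ≤ ∑ j ∈ sample τ σ, ∑ k ∈ sample τ σ, β i j k :=
        Finset.sum_nonneg fun j _ => Finset.sum_nonneg fun k _ => hβ i j k
      split_ifs with hg
      · nlinarith
      · have := hbad _ i hi hg
        nlinarith
    · have hxi : x σ i = 0 := if_neg hi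
      rw [hxi, if_neg fun h => hi (hgood _ h)]
      simp
  have c1 := le_sum_ind (P := P) hτ
  have c2 := sum_ind_pair (P := P) hn τ
  have c3 := sum_ind_triple (P := P) hn τ
  have hsum : ∑ σ : ZMod P × ZMod P × ZMod P, (1 / 2 * ∑ i, w i * ((τ i : ℝ) / P)) ≤
      ∑ σ, G σ := by
    have hG' : ∑ σ, G σ = ∑ i, w i * (∑ σ, x σ i - ∑ j, α i j * ∑ σ, x σ i * x σ j -
        ∑ j, ∑ k, β i j k * ∑ σ, x σ i * (x σ j * x σ k)) := by
      simp only [G]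
      rw [Finset.sum_comm]
      refine Finset.sum_congr rfl fun i _ => ?_
      rw [← Finset.mul_sum, Finset.sum_sub_distrib, Finset.sum_sub_distrib]
      have h2 : ∑ σ, ∑ j, α i j * (x σ i * x σ j) = ∑ j, α i j * ∑ σ, x σ i * x σ j := by
        rw [Finset.sum_comm]
        exact Finset.sum_congr rfl fun j _ => (Finset.mul_sum _ _ _).symm
      have h3 : ∑ σ, ∑ j, ∑ k, β i j k * (x σ i * (x σ j * x σ k)) =
          ∑ j, ∑ k, β i j k * ∑ σ, x σ i * (x σ j * x σ k) := by
        rw [Finset.sum_comm]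
        refine Finset.sum_congr rfl fun j _ => ?_
        rw [Finset.sum_comm]
        exact Finset.sum_congr rfl fun k _ => (Finset.mul_sum _ _ _).symm
      rw [h2, h3]
    rw [hG', Finset.sum_const, nsmul_eq_mul, Finset.mul_sum, Finset.mul_sum]
    refine Finset.sum_le_sum fun i _ => ?_
    have hcard : ((Finset.univ : Finset (ZMod P × ZMod P × ZMod P)).card : ℝ) = (P : ℝ) ^ 3 := by
      simp [ZMod.card]; ring
    rw [hcard]
    by_cases hi : τ i = 0
    · have z : ∀ σ, x σ i = 0 := fun σ => if_neg fun h => hτ0 σ i h hi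
      simp [z, hi]
    have hwi := hw i hi
    -- `P ^ 2 * τ i` seeds sample `i`, at least. The pair and triple bounds say that, relative to
    -- this number, the charges of `i` are at most the expectation in `hsmall`. Charges vanish on
    -- coinciding indices, where these bounds are not available.
    have b2 : ∑ j, α i j * ∑ σ, x σ i * x σ j ≤
        P ^ 2 * τ i * ∑ j, α i j * ((τ j : ℝ) / P) := by
      rw [Finset.mul_sum]
      refine Finset.sum_le_sum fun j _ => ?_
      by_cases hij : i = j
      · subst hij; simp [hα']
      · calc _ ≤ α i j * ((P : ℝ) * τ i * τ j) := mul_le_mul_of_nonneg_left (c2 i j hij) (hα i j)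
          _ = _ := by field_simp
    have b3 : ∑ j, ∑ k, β i j k * ∑ σ, x σ i * (x σ j * x σ k) ≤
        P ^ 2 * τ i * ∑ j, ∑ k, β i j k * ((τ j : ℝ) / P * ((τ k : ℝ) / P)) := by
      rw [Finset.mul_sum]
      refine Finset.sum_le_sum fun j _ => ?_
      rw [Finset.mul_sum]
      refine Finset.sum_le_sum fun k _ => ?_
      by_cases h : i = j ∨ i = k ∨ j = k
      · simp [hβ' i j k h]
      · push Not at h
        calc _ ≤ β i j k * ((τ i : ℝ) * τ j * τ k) :=
              mul_le_mul_of_nonneg_left (c3 i j k h.1 h.2.1 h.2.2) (hβ i j k)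
          _ = _ := by field_simp
    have b1 := c1 i
    have hs := hsmall i hi
    have hpos : 0 ≤ (P : ℝ) ^ 2 * τ i := by positivity
    have key := mul_le_mul_of_nonneg_left hs hpos
    calc (P : ℝ) ^ 3 * (1 / 2 * (w i * ((τ i : ℝ) / P))) = w i * (P ^ 2 * τ i * (1 / 2)) := by
          field_simp
      _ ≤ _ := mul_le_mul_of_nonneg_left (by linarith) hwi
  obtain ⟨σ, -, hσ⟩ := Finset.exists_le_of_sum_le Finset.univ_nonempty hsum
  exact ⟨σ, hσ.trans (hG σ)⟩

end

end Sampling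

/-! ### Multiplicative weights for packing linear programs -/

namespace MultWeights

/-- A piecewise linear interpolation of `2 ^ (L / b)`. -/
noncomputable def phi (b L : ℕ) : ℝ := 2 ^ (L / b) * (1 + ((L % b : ℕ) : ℝ) / b)

theorem pow_le_phi (b L : ℕ) : (2 : ℝ) ^ (L / b) ≤ phi b L := by
  have : (0 : ℝ) ≤ ((L % b : ℕ) : ℝ) / b := by positivity
  exact le_mul_of_one_le_right (by positivity) (by linarith)

/-- The slope is constant between consecutive multiples of `b`. Increments of the potential are
therefore exactly the prices, which involve only integral powers of two and can be computed. -/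
theorem phi_succ {b : ℕ} (hb : 1 ≤ b) (L : ℕ) : phi b (L + 1) = phi b L + 2 ^ (L / b) / b := by
  have hb0 : (b : ℝ) ≠ 0 := by positivity
  have hdm := Nat.div_add_mod L b
  have hlt := Nat.mod_lt L (show 0 < b by omega)
  set q := L / b with hq
  set r := L % b with hr
  by_cases h : r + 1 < b
  · have h1 : (L + 1) / b = q := by
      rw [Nat.div_eq_iff (by omega)]
      constructor
      · rw [mul_comm]; omega
      · rw [Nat.mul_comm] at hdm; omega
    have h2 : (L + 1) % b = r + 1 := by
      have := Nat.div_add_mod (L + 1) b; rw [h1] at this; omega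
    simp only [phi, h1, h2, ← hq, ← hr]
    push_cast
    field_simp
    ring
  · have hbr : b = r + 1 := by omega
    have h0 : L + 1 = b * (q + 1) := by rw [mul_add]; omega
    have h1 : (L + 1) / b = q + 1 := by rw [h0, Nat.mul_div_cancel_left _ (by omega)]
    have h2 : (L + 1) % b = 0 := by rw [h0, Nat.mul_mod_right]
    simp only [phi, h1, h2, ← hq, ← hr]
    have : (r : ℝ) = b - 1 := by rw [hbr]; push_cast; ring
    rw [this]
    field_simp
    push_cast
    ring

section
variable {n : ℕ} {ι : Type*} (A : ι → Finset (Fin n)) (b : ι → ℕ)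

/-- The load of a row. -/
def load (c : Fin n → ℕ) (ρ : ι) : ℕ := ∑ i ∈ A ρ, c i

theorem load_update {A : ι → Finset (Fin n)} (c : Fin n → ℕ) (i : Fin n) (ρ : ι) :
    load A (Function.update c i (c i + 1)) ρ = load A c ρ + if i ∈ A ρ then 1 else 0 := by
  have : ∀ k, Function.update c i (c i + 1) k = c k + if k = i then 1 else 0 := by
    intro k
    by_cases h : k = i
    · subst h; simp
    · simp [h]
  simp only [load, this, Finset.sum_add_distrib, Finset.sum_ite_eq']

variable [Fintype ι]

/-- The rounded price of a column. -/
def price (K : ℕ) (c : Fin n → ℕ) (i : Fin n) : ℕ :=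
  ∑ ρ, if i ∈ A ρ then K * 2 ^ (load A c ρ / b ρ) / b ρ else 0

/-- Some row has reached the load `H` times its capacity. -/
def Stopped (H : ℕ) (c : Fin n → ℕ) : Prop := ∃ ρ, H * b ρ ≤ load A c ρ

/-- The column `i` has the best ratio of price and weight. -/
def IsBest (K : ℕ) (w : Fin n → ℤ) (c : Fin n → ℕ) (i : Fin n) : Prop :=
  0 < w i ∧ ∀ k, 0 < w k → (price A b K c i : ℤ) * w k ≤ price A b K c k * w i

/-- One step of the algorithm: unless some row is full, a best column is increased by one. -/
def Step (K H : ℕ) (w : Fin n → ℤ) (c c' : Fin n → ℕ) : Prop :=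
  (Stopped A b H c → c' = c) ∧
    (¬ Stopped A b H c → ∃ i, IsBest A b K w c i ∧ c' = Function.update c i (c i + 1))

variable {A b}

theorem load_le_of_step {K H : ℕ} {w : Fin n → ℤ} {c c' : Fin n → ℕ} (hs : Step A b K H w c c')
    (h : ∀ ρ, load A c ρ ≤ H * b ρ) (ρ : ι) : load A c' ρ ≤ H * b ρ := by
  by_cases hst : Stopped A b H c
  · rw [hs.1 hst]; exact h ρ
  · obtain ⟨i, -, rfl⟩ := hs.2 hst
    rw [load_update]
    have : ¬ H * b ρ ≤ load A c ρ := fun hh => hst ⟨ρ, hh⟩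
    split_ifs <;> omega

theorem load_le_of_steps {K H T : ℕ} {w : Fin n → ℤ} {c : ℕ → Fin n → ℕ} (hc0 : c 0 = 0)
    (hstep : ∀ t < T, Step A b K H w (c t) (c (t + 1))) :
    ∀ t ≤ T, ∀ ρ, load A (c t) ρ ≤ H * b ρ := by
  intro t
  induction t with
  | zero => intro _ ρ; simp [load, hc0]
  | succ t ih =>
    intro ht ρ
    exact load_le_of_step (hstep t (by omega)) (ih (by omega)) ρ

/-- The exact price of a column. -/
noncomputable def exactPrice (A : ι → Finset (Fin n)) (b : ι → ℕ) (c : Fin n → ℕ) (i : Fin n) :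
    ℝ := ∑ ρ, if i ∈ A ρ then (2 : ℝ) ^ (load A c ρ / b ρ) / b ρ else 0

/-- Rounding down a quotient that is at least one loses at most a factor of two; `b ρ ≤ K` ensures
this for every row. -/
theorem price_bounds (hb : ∀ ρ, 1 ≤ b ρ) {K : ℕ} (hK : ∀ ρ, b ρ ≤ K) (c : Fin n → ℕ)
    (i : Fin n) : (price A b K c i : ℝ) ≤ K * exactPrice A b c i ∧
      K * exactPrice A b c i ≤ 2 * price A b K c i := by
  have key : ∀ ρ, ((K * 2 ^ (load A c ρ / b ρ) / b ρ : ℕ) : ℝ) ≤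
        K * ((2 : ℝ) ^ (load A c ρ / b ρ) / b ρ) ∧
      K * ((2 : ℝ) ^ (load A c ρ / b ρ) / b ρ) ≤
        2 * ((K * 2 ^ (load A c ρ / b ρ) / b ρ : ℕ) : ℝ) := by
    intro ρ
    set y := 2 ^ (load A c ρ / b ρ) with hy
    have hy1 : 1 ≤ y := Nat.one_le_two_pow
    have hb1 := hb ρ
    have hbK := hK ρ
    have hbr : (0 : ℝ) < b ρ := by positivity
    have e : (2 : ℝ) ^ (load A c ρ / b ρ) = (y : ℝ) := by rw [hy]; push_cast; rfl
    rw [e, ← mul_div_assoc]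
    constructor
    · have := Nat.cast_div_le (α := ℝ) (m := K * y) (n := b ρ)
      simpa using this
    · rw [div_le_iff₀ hbr]
      have h1 : b ρ ≤ K * y := le_trans hbK (Nat.le_mul_of_pos_right _ (by omega))
      have h2 : 1 ≤ K * y / b ρ := (Nat.one_le_div_iff (by omega)).2 h1
      have h3 := Nat.div_add_mod (K * y) (b ρ)
      have h4 := Nat.mod_lt (K * y) (show 0 < b ρ by omega)
      have h5 : K * y ≤ 2 * (K * y / b ρ) * b ρ := by
        set q := K * y / b ρ
        have : b ρ * 1 ≤ b ρ * q := Nat.mul_le_mul_left _ h2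
        have e : 2 * q * b ρ = b ρ * q + b ρ * q := by ring
        omega
      exact_mod_cast h5
  constructor
  · simp only [price, exactPrice, Finset.mul_sum, Nat.cast_sum]
    refine Finset.sum_le_sum fun ρ _ => ?_
    split_ifs
    · exact (key ρ).1
    · simp
  · simp only [price, exactPrice, Finset.mul_sum, Nat.cast_sum]
    refine Finset.sum_le_sum fun ρ _ => ?_
    split_ifs
    · exact (key ρ).2
    · simp

/-- The potential. -/
noncomputable def potential (A : ι → Finset (Fin n)) (b : ι → ℕ) (c : Fin n → ℕ) : ℝ :=
  ∑ ρ, phi (b ρ) (load A c ρ)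

theorem potential_update (hb : ∀ ρ, 1 ≤ b ρ) (c : Fin n → ℕ) (i : Fin n) :
    potential A b (Function.update c i (c i + 1)) = potential A b c + exactPrice A b c i := by
  simp only [potential, exactPrice, ← Finset.sum_add_distrib]
  refine Finset.sum_congr rfl fun ρ _ => ?_
  rw [load_update]
  split_ifs
  · rw [phi_succ (hb ρ)]
  · simp

/-- Weak duality: the prices of a fractional solution are at most the potential. -/
theorem sum_exactPrice_le (hb : ∀ ρ, 1 ≤ b ρ) (c : Fin n → ℕ) {x : Fin n → ℝ}
    (hx : ∀ ρ, ∑ i ∈ A ρ, x i ≤ b ρ) : ∑ i, x i * exactPrice A b c i ≤ potential A b c := by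
  have e : ∑ i, x i * exactPrice A b c i =
      ∑ ρ, (2 : ℝ) ^ (load A c ρ / b ρ) / b ρ * ∑ i ∈ A ρ, x i := by
    simp only [exactPrice, Finset.mul_sum]
    rw [Finset.sum_comm]
    refine Finset.sum_congr rfl fun ρ _ => ?_
    rw [← Finset.univ_inter (A ρ), ← Finset.sum_ite_mem]
    refine Finset.sum_congr rfl fun i _ => ?_
    simp only [Finset.univ_inter]
    split_ifs <;> ring
  rw [e]
  refine Finset.sum_le_sum fun ρ _ => ?_
  have hb0 : (0 : ℝ) < b ρ := by have := hb ρ; positivity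
  calc _ ≤ (2 : ℝ) ^ (load A c ρ / b ρ) / b ρ * b ρ :=
        mul_le_mul_of_nonneg_left (hx ρ) (by positivity)
    _ = 2 ^ (load A c ρ / b ρ) := by field_simp
    _ ≤ _ := pow_le_phi _ _

theorem exactPrice_nonneg (c : Fin n → ℕ) (i : Fin n) : 0 ≤ exactPrice A b c i :=
  Finset.sum_nonneg fun ρ _ => by split_ifs <;> positivity

/-- By weak duality the average ratio of price and weight, taken over `x`, is at most the potential
divided by the value of `x`. A best column is no worse than the average, up to the factor two from
rounding. Columns without positive weight contribute nothing positive to the left side. -/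
theorem exactPrice_le_of_isBest (hb : ∀ ρ, 1 ≤ b ρ) {K : ℕ} (hK1 : 1 ≤ K) (hK : ∀ ρ, b ρ ≤ K)
    {w : Fin n → ℤ} {c : Fin n → ℕ} {i : Fin n} (hi : IsBest A b K w c i) {x : Fin n → ℝ}
    (hx0 : ∀ i, 0 ≤ x i) (hx : ∀ ρ, ∑ i ∈ A ρ, x i ≤ b ρ) :
    (∑ k, (w k : ℝ) * x k) * exactPrice A b c i ≤ 2 * w i * potential A b c := by
  have hKr : (0 : ℝ) < K := by positivity
  have hwi : (0 : ℝ) < w i := by exact_mod_cast hi.1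
  have h1 : ∀ k, (w k : ℝ) * x k * exactPrice A b c i ≤ 2 * w i * (x k * exactPrice A b c k) := by
    intro k
    have hpi := exactPrice_nonneg (A := A) (b := b) c i
    have hpk := exactPrice_nonneg (A := A) (b := b) c k
    by_cases hk : 0 < w k
    · have hkr : (0 : ℝ) < w k := by exact_mod_cast hk
      have h2 : (price A b K c i : ℝ) * w k ≤ price A b K c k * w i := by
        exact_mod_cast hi.2 k hk
      have h3 := (price_bounds hb hK c i (A := A)).2
      have h4 := (price_bounds hb hK c k (A := A)).1
      have h5 : K * (w k * exactPrice A b c i) ≤ K * (2 * w i * exactPrice A b c k) := by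
        nlinarith
      have h6 := le_of_mul_le_mul_left h5 hKr
      nlinarith [hx0 k]
    · have hkr : (w k : ℝ) ≤ 0 := by exact_mod_cast not_lt.1 hk
      have h2 : (w k : ℝ) * x k * exactPrice A b c i ≤ 0 :=
        mul_nonpos_of_nonpos_of_nonneg (mul_nonpos_of_nonpos_of_nonneg hkr (hx0 k)) hpi
      have h3 : 0 ≤ 2 * w i * (x k * exactPrice A b c k) := by have := hx0 k; positivity
      linarith
  calc _ = ∑ k, (w k : ℝ) * x k * exactPrice A b c i := Finset.sum_mul _ _ _
    _ ≤ ∑ k, 2 * w i * (x k * exactPrice A b c k) := Finset.sum_le_sum fun k _ => h1 k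
    _ = 2 * w i * ∑ k, x k * exactPrice A b c k := (Finset.mul_sum _ _ _).symm
    _ ≤ _ := mul_le_mul_of_nonneg_left (sum_exactPrice_le hb c hx) (by positivity)

/-- Increasing the best column `i` multiplies the potential by at most `1 + 2 * w i / L ≤ exp (2 * w
i / L)`, where `L` is the value of `x`, while the collected weight grows by `w i`. -/
theorem potential_step (hb : ∀ ρ, 1 ≤ b ρ) {K H : ℕ} (hK1 : 1 ≤ K) (hK : ∀ ρ, b ρ ≤ K)
    {w : Fin n → ℤ} {c c' : Fin n → ℕ} (hs : Step A b K H w c c') {x : Fin n → ℝ}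
    (hx0 : ∀ i, 0 ≤ x i) (hx : ∀ ρ, ∑ i ∈ A ρ, x i ≤ b ρ) {N : ℝ}
    (hL : 0 < ∑ k, (w k : ℝ) * x k)
    (h : potential A b c ≤ N * Real.exp (2 * (∑ i, (w i : ℝ) * c i) / ∑ k, (w k : ℝ) * x k)) :
    potential A b c' ≤
      N * Real.exp (2 * (∑ i, (w i : ℝ) * c' i) / ∑ k, (w k : ℝ) * x k) := by
  by_cases hst : Stopped A b H c
  · rw [hs.1 hst]; exact h
  · obtain ⟨i, hi, rfl⟩ := hs.2 hst
    set L := ∑ k, (w k : ℝ) * x k with hLdef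
    have hV : ∑ k, (w k : ℝ) * ((Function.update c i (c i + 1) k : ℕ) : ℝ) =
        ∑ k, (w k : ℝ) * c k + w i := by
      have : ∀ k, (w k : ℝ) * ((Function.update c i (c i + 1) k : ℕ) : ℝ) =
          (w k : ℝ) * c k + if k = i then (w i : ℝ) else 0 := by
        intro k
        by_cases h : k = i
        · subst h; simp; ring
        · simp [h]
      simp only [this, Finset.sum_add_distrib, Finset.sum_ite_eq', Finset.mem_univ, if_true]
    rw [hV, potential_update hb]
    have h1 := exactPrice_le_of_isBest hb hK1 hK hi hx0 hx
    have hP0 : 0 ≤ potential A b c := Finset.sum_nonneg fun ρ _ =>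
      le_trans (by positivity) (pow_le_phi _ _)
    have h2 : exactPrice A b c i ≤ 2 * w i / L * potential A b c := by
      rw [div_mul_eq_mul_div, le_div_iff₀ hL]; linarith
    calc potential A b c + exactPrice A b c i ≤ potential A b c * (2 * w i / L + 1) := by linarith
      _ ≤ potential A b c * Real.exp (2 * w i / L) :=
          mul_le_mul_of_nonneg_left (Real.add_one_le_exp _) hP0
      _ ≤ N * Real.exp (2 * (∑ i, (w i : ℝ) * c i) / L) * Real.exp (2 * w i / L) :=
          mul_le_mul_of_nonneg_right h (Real.exp_pos _).le
      _ = _ := by rw [mul_assoc, ← Real.exp_add]; congr 2; ring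

/-- Absorbs the initial potential, which is at most `H`, into half of the exponent gained when a row
becomes full. -/
theorem nat_le_exp (H : ℕ) : (H : ℝ) ≤ Real.exp (H / 2) := by
  have h1 := Real.add_one_le_exp ((H : ℝ) / 2 - 1)
  have h2 : Real.exp ((H : ℝ) / 2) = Real.exp ((H : ℝ) / 2 - 1) * Real.exp 1 := by
    rw [← Real.exp_add]; congr 1; ring
  have h3 : (2 : ℝ) ≤ Real.exp 1 := by have := Real.add_one_le_exp (1 : ℝ); linarith
  rw [h2]
  have : 0 ≤ Real.exp ((H : ℝ) / 2 - 1) := (Real.exp_pos _).le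
  nlinarith

/-- The multiplicative weights algorithm approximates a packing linear program. -/
theorem approx {K H : ℕ} {w : Fin n → ℤ} (hb : ∀ ρ, 1 ≤ b ρ) (hK1 : 1 ≤ K) (hK : ∀ ρ, b ρ ≤ K)
    (hH : Fintype.card ι ≤ H) (hH1 : 1 ≤ H) (hsingle : ∀ i, ∃ ρ, A ρ = {i} ∧ b ρ = 1)
    {c : ℕ → Fin n → ℕ} (hc0 : c 0 = 0) (hstep : ∀ t < n * H, Step A b K H w (c t) (c (t + 1)))
    {x : Fin n → ℝ} (hx0 : ∀ i, 0 ≤ x i) (hx : ∀ ρ, ∑ i ∈ A ρ, x i ≤ b ρ)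
    (hL : 0 < ∑ k, (w k : ℝ) * x k) :
    (∑ k, (w k : ℝ) * x k) * H ≤ 11 * ∑ i, (w i : ℝ) * c (n * H) i := by
  set L := ∑ k, (w k : ℝ) * x k with hLdef
  have hpot : ∀ t ≤ n * H, potential A b (c t) ≤
      H * Real.exp (2 * (∑ i, (w i : ℝ) * c t i) / L) := by
    intro t
    induction t with
    | zero =>
      intro _
      simp only [hc0, Pi.zero_apply, Nat.cast_zero, mul_zero, Finset.sum_const_zero, zero_div,
        Real.exp_zero, mul_one]
      simp only [potential, load, phi, Pi.zero_apply, Finset.sum_const_zero, Nat.zero_div,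
        Nat.zero_mod, Nat.cast_zero, zero_div, add_zero, pow_zero, mul_one, Finset.sum_const,
        nsmul_eq_mul, Finset.card_univ]
      exact_mod_cast hH
    | succ t ih =>
      intro ht
      exact potential_step hb hK1 hK (hstep t (by omega)) hx0 hx hL (ih (by omega))
  -- Otherwise all `n * H` steps increase the total count by one, whereas the rows of single columns
  -- keep each count below `H`.
  have hfull : Stopped A b H (c (n * H)) := by
    by_contra hns
    have hne : ∃ i : Fin n, True := by
      by_contra hne
      push Not at hne
      have : L = 0 := Finset.sum_eq_zero fun k _ => (hne k).elim
      linarith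
    obtain ⟨i₀, -⟩ := hne
    -- Backwards from the end: once a row is full, the counts no longer change.
    have hnot : ∀ j ≤ n * H, ¬ Stopped A b H (c (n * H - j)) := by
      intro j
      induction j with
      | zero => intro _; exact hns
      | succ j ih =>
        intro hj hst
        have h1 := (hstep (n * H - (j + 1)) (by omega)).1 hst
        have h2 : n * H - (j + 1) + 1 = n * H - j := by omega
        rw [h2] at h1
        exact ih (by omega) (h1 ▸ hst)
    have hsum : ∀ t ≤ n * H, ∑ i, c t i = t := by
      intro t
      induction t with
      | zero => intro _; simp [hc0]
      | succ t ih =>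
        intro ht
        have h1 := hnot (n * H - t) (by omega)
        rw [show n * H - (n * H - t) = t by omega] at h1
        obtain ⟨i, -, hi⟩ := (hstep t (by omega)).2 h1
        rw [hi]
        have := load_update (A := fun _ : Unit => Finset.univ) (c t) i ()
        simp only [load, Finset.mem_univ, if_true] at this
        rw [this, ih (by omega)]
    have h1 := hsum (n * H) le_rfl
    have h2 : ∀ i, c (n * H) i < H := by
      intro i
      obtain ⟨ρ, hA, hbρ⟩ := hsingle i
      by_contra hge
      refine hns ⟨ρ, ?_⟩
      simp only [load, hA, hbρ, Finset.sum_singleton]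
      omega
    have h3 : ∑ i, c (n * H) i < ∑ _i : Fin n, H :=
      Finset.sum_lt_sum_of_nonempty ⟨i₀, Finset.mem_univ _⟩ fun i _ => h2 i
    simp at h3
    omega
  obtain ⟨ρ, hρ⟩ := hfull
  set V := ∑ i, (w i : ℝ) * c (n * H) i with hV
  have h1 : (2 : ℝ) ^ H ≤ potential A b (c (n * H)) := by
    have h2 : H ≤ load A (c (n * H)) ρ / b ρ := (Nat.le_div_iff_mul_le (hb ρ)).2 hρ
    calc (2 : ℝ) ^ H ≤ 2 ^ (load A (c (n * H)) ρ / b ρ) :=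
          pow_le_pow_right₀ (by norm_num) h2
      _ ≤ phi (b ρ) (load A (c (n * H)) ρ) := pow_le_phi _ _
      _ ≤ _ := Finset.single_le_sum (f := fun ρ => phi (b ρ) (load A (c (n * H)) ρ))
          (fun ρ _ => le_trans (by positivity) (pow_le_phi _ _)) (Finset.mem_univ ρ)
  have h2 := h1.trans (hpot _ le_rfl)
  have h3 : (2 : ℝ) ^ H = Real.exp (H * Real.log 2) := by
    rw [mul_comm, Real.exp_mul, Real.exp_log (by norm_num), Real.rpow_natCast]
  have h4 : Real.exp (H * Real.log 2) ≤ Real.exp (H / 2 + 2 * V / L) := by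
    rw [← h3, Real.exp_add]
    exact h2.trans (mul_le_mul_of_nonneg_right (nat_le_exp H) (Real.exp_pos _).le)
  have h5 := Real.exp_le_exp.1 h4
  -- A full row makes the potential at least `2 ^ H`, so `H * log 2 ≤ H / 2 + 2 * V / L`. As `log 2
  -- - 1 / 2 > 0.19` and `2 / 0.19 < 11`, the constant is 11.
  have h6 := Real.log_two_gt_d9
  have hHr : (1 : ℝ) ≤ H := by exact_mod_cast hH1
  have h7 : (H : ℝ) * 0.19 ≤ 2 * V / L := by nlinarith
  rw [le_div_iff₀ hL] at h7
  nlinarith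

end

end MultWeights

/-! ### Blocks, levels and the surviving points -/

/-- The level of a rectangle is defined by counting, because the array language has sums but no
search. For a predicate inherited by smaller numbers, the count is the first number at which it
fails. -/
theorem card_filter_range_spec {p : ℕ → Prop} [DecidablePred p] (hp : ∀ l, p (l + 1) → p l)
    {N : ℕ} (hN : ¬ p N) : ¬ p ((Finset.range N).filter p).card ∧
      ∀ l < ((Finset.range N).filter p).card, p l := by
  have hex : ∃ m, ¬ p m := ⟨N, hN⟩
  have hmono : ∀ {a b}, a ≤ b → p b → p a := by
    intro a b hab
    induction b, hab using Nat.le_induction with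
    | base => exact id
    | succ b _ ih => exact fun h => ih (hp b h)
  have h : (Finset.range N).filter p = Finset.range (Nat.find hex) := by
    ext l
    simp only [Finset.mem_filter, Finset.mem_range]
    constructor
    · rintro ⟨_, hl⟩
      by_contra hge
      exact Nat.find_spec hex (hmono (by omega) hl)
    · intro hl
      refine ⟨lt_of_lt_of_le hl (Nat.find_min' hex hN), ?_⟩
      by_contra hnl
      exact Nat.find_min hex hl hnl
  rw [h, Finset.card_range]
  exact ⟨Nat.find_spec hex, fun l hl => by
    by_contra hnl
    exact Nat.find_min hex hl hnl⟩

namespace PackInstance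

section
variable (I : PackInstance) (H : ℕ) (c : Fin I.n → ℕ)

/-- The position of a point in the order from left to right. -/
def key (i : Fin I.n) : ℚ ×ₗ Fin I.n := toLex ((I.point i).1, i)

/-- The mass to the left of a point. -/
def leftMass (i : Fin I.n) : ℕ := ∑ k, if I.key k < I.key i then c k else 0

/-- The block of a point; blocks have mass about `H`. -/
def blk (i : Fin I.n) : ℕ := I.leftMass c i / H

/-- The points of the rectangle `j` lie in different intervals of `2 ^ l` blocks. -/
def Splits (j : Fin I.m) (l : ℕ) : Prop :=
  ∃ i ∈ I.inside j, ∃ k ∈ I.inside j, I.blk H c i / 2 ^ l < I.blk H c k / 2 ^ l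

instance (j : Fin I.m) : DecidablePred (I.Splits H c j) := fun l => by
  unfold Splits; infer_instance

/-- The level of a rectangle in the binary tree of blocks. -/
def lev (j : Fin I.m) : ℕ := ((Finset.range (I.n + 2)).filter (I.Splits H c j)).card

/-- The half of the rectangle `j` in which the point lies: the left half if it is even. -/
def half (j : Fin I.m) (i : Fin I.n) : ℕ := 2 * I.blk H c i / 2 ^ I.lev H c j

/-- `k` lies in the same half of `j` as `i` and in a block closer to the middle. -/
def Closer (j : Fin I.m) (i k : Fin I.n) : Prop :=
  I.half H c j k = I.half H c j i ∧
    if I.half H c j i % 2 = 0 then I.blk H c i < I.blk H c k else I.blk H c k < I.blk H c i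

instance (j : Fin I.m) (i : Fin I.n) : DecidablePred (I.Closer H c j i) := fun k => by
  unfold Closer; infer_instance

/-- The capacity of the halves of a rectangle. -/
def halfCap (j : Fin I.m) : ℕ := max 1 (I.cap j / 2)

/-- The points of `S` that are alone in their block and do not exceed, together with the points
closer to the middle, the capacity of a half rectangle. -/
def survivors (S : Finset (Fin I.n)) : Finset (Fin I.n) :=
  S.filter fun i => (∀ k ∈ S, I.blk H c k = I.blk H c i → k = i) ∧
    ∀ j, i ∈ I.inside j → ((S ∩ I.inside j).filter (I.Closer H c j i)).card < I.halfCap j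

variable {I H c}

theorem key_injective : Function.Injective I.key := fun i k h => by
  have := congrArg (fun z => (ofLex z).2) h
  exact this

theorem leftMass_mono {i k : Fin I.n} (h : I.key i ≤ I.key k) :
    I.leftMass c i ≤ I.leftMass c k :=
  Finset.sum_le_sum fun z _ => by
    by_cases hz : I.key z < I.key i
    · rw [if_pos hz, if_pos (lt_of_lt_of_le hz h)]
    · rw [if_neg hz]; exact Nat.zero_le _

theorem fst_le_of_blk_lt {i k : Fin I.n} (h : I.blk H c i < I.blk H c k) :
    (I.point i).1 ≤ (I.point k).1 := by
  by_contra hlt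
  push Not at hlt
  have : I.key k ≤ I.key i := le_of_lt (by
    unfold key; exact Prod.Lex.toLex_lt_toLex.2 (Or.inl hlt))
  have := Nat.div_le_div_right (c := H) (leftMass_mono (c := c) this)
  exact absurd h (not_lt.2 this)

theorem blk_le {M : ℕ} (hc : ∑ i, c i ≤ H * M) (i : Fin I.n) : I.blk H c i ≤ M := by
  have h1 : I.leftMass c i ≤ ∑ k, c k := Finset.sum_le_sum fun k _ => by split_ifs <;> simp
  exact Nat.div_le_of_le_mul (h1.trans hc)

theorem blk_le_n (hc : ∀ i, c i ≤ H) (i : Fin I.n) : I.blk H c i ≤ I.n :=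
  blk_le (by
    calc ∑ i, c i ≤ ∑ _i : Fin I.n, H := Finset.sum_le_sum fun i _ => hc i
      _ = H * I.n := by simp [mul_comm]) i

/-- The left masses of the first and the last point of a block differ by less than `H`, and this
difference accounts for all points of the block but the last, whose own mass is at most `H`. -/
theorem sum_blk_le (hH : 1 ≤ H) (hc : ∀ i, c i ≤ H) (v : ℕ) :
    ∑ k with I.blk H c k = v, c k ≤ 2 * H := by
  classical
  set B := Finset.univ.filter fun k => I.blk H c k = v with hB
  by_cases hne : B.Nonempty
  · obtain ⟨z, hz, hzmax⟩ := Finset.exists_max_image B I.key hne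
    obtain ⟨a, ha, hamin⟩ := Finset.exists_min_image B I.key hne
    have h1 : I.leftMass c a + ∑ k ∈ B.erase z, c k ≤ I.leftMass c z := by
      have e1 : ∑ k ∈ B.erase z, c k = ∑ k, if k ∈ B.erase z then c k else 0 := by
        rw [Finset.sum_ite_mem, Finset.univ_inter]
      rw [leftMass, e1, ← Finset.sum_add_distrib, leftMass]
      refine Finset.sum_le_sum fun k _ => ?_
      by_cases hk : k ∈ B.erase z
      · have hkB := Finset.mem_of_mem_erase hk
        have hlt : I.key k < I.key z := lt_of_le_of_ne (hzmax k hkB)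
          fun h => Finset.ne_of_mem_erase hk (key_injective h)
        rw [if_pos hk, if_neg (not_lt.2 (hamin k hkB)), if_pos hlt, zero_add]
      · rw [if_neg hk, add_zero]
        by_cases hka : I.key k < I.key a
        · rw [if_pos hka, if_pos (lt_of_lt_of_le hka (hzmax a ha))]
        · rw [if_neg hka]; exact Nat.zero_le _
    have h2 : v * H ≤ I.leftMass c a := by
      have : I.leftMass c a / H = v := (Finset.mem_filter.1 ha).2
      rw [← this]; exact Nat.div_mul_le_self _ _
    have h3 : I.leftMass c z < (v + 1) * H := by
      have : I.leftMass c z / H = v := (Finset.mem_filter.1 hz).2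
      rw [← this]
      exact Nat.lt_mul_of_div_lt (by omega) hH
    have h4 := Finset.add_sum_erase B c hz
    have h5 := hc z
    rw [add_mul] at h3
    omega
  · rw [Finset.not_nonempty_iff_eq_empty.1 hne]; simp

/-- Dyadic intervals are nested, so points separated at level `l + 1` are separated at level `l`; at
level `n + 2` one interval contains all blocks. Hence `lev` is the first level at which the
rectangle fits into one interval. -/
theorem lev_spec (hc : ∀ i, c i ≤ H) (j : Fin I.m) :
    ¬ I.Splits H c j (I.lev H c j) ∧ ∀ l < I.lev H c j, I.Splits H c j l := by
  refine card_filter_range_spec ?_ ?_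
  · rintro l ⟨i, hi, k, hk, h⟩
    refine ⟨i, hi, k, hk, ?_⟩
    rw [pow_succ, ← Nat.div_div_eq_div_mul, ← Nat.div_div_eq_div_mul] at h
    by_contra hge
    exact absurd h (not_lt.2 (Nat.div_le_div_right (not_lt.1 hge)))
  · rintro ⟨i, hi, k, hk, h⟩
    have h1 := blk_le_n (I := I) hc k
    have h2 : I.n < 2 ^ (I.n + 2) :=
      Nat.lt_two_pow_self.trans (Nat.pow_lt_pow_right (by norm_num) (by omega))
    rw [Nat.div_eq_of_lt (lt_of_le_of_lt h1 h2)] at h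
    exact Nat.not_lt_zero _ h

theorem half_div_two (j : Fin I.m) (i : Fin I.n) :
    I.half H c j i / 2 = I.blk H c i / 2 ^ I.lev H c j := by
  rw [half, Nat.div_div_eq_div_mul, mul_comm _ 2, Nat.mul_div_mul_left _ _ (by norm_num)]

/-- All points of a rectangle lie in the same interval of its level, so its two halves are told
apart by parity. -/
theorem half_div_two_eq (hc : ∀ i, c i ≤ H) {j : Fin I.m} {i k : Fin I.n}
    (hi : i ∈ I.inside j) (hk : k ∈ I.inside j) :
    I.half H c j i / 2 = I.half H c j k / 2 := by
  rw [half_div_two, half_div_two]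
  have h := (lev_spec (I := I) hc j).1
  by_contra hne
  rcases lt_or_gt_of_ne hne with hlt | hgt
  · exact h ⟨i, hi, k, hk, hlt⟩
  · exact h ⟨k, hk, i, hi, hgt⟩

/-- The set of survivors respects the capacities, if these are at least two. -/
theorem card_survivors_le (hc : ∀ i, c i ≤ H) (S : Finset (Fin I.n))
    (j : Fin I.m) : (I.survivors H c S ∩ I.inside j).card ≤ max (I.cap j) 2 := by
  classical
  set T := I.survivors H c S ∩ I.inside j with hT
  have hTS : ∀ i ∈ T, i ∈ S ∧ (∀ k ∈ S, I.blk H c k = I.blk H c i → k = i) ∧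
      i ∈ I.inside j ∧ ((S ∩ I.inside j).filter (I.Closer H c j i)).card < I.halfCap j := by
    intro i hi
    obtain ⟨h1, h2⟩ := Finset.mem_inter.1 hi
    obtain ⟨h3, h4, h5⟩ := Finset.mem_filter.1 h1
    exact ⟨h3, h4, h2, h5 j h2⟩
  -- Applied to the survivor `i` of a half that is farthest from the middle: all other survivors of
  -- this half are closer, hence are among the fewer than `halfCap` points that `i` tolerates.
  have hone : ∀ U ⊆ T, (∃ i ∈ U, ∀ k ∈ U, k ≠ i → I.Closer H c j i k) ∨ U = ∅ →
      U.card ≤ I.halfCap j := by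
    rintro U hU (⟨i, hi, hcl⟩ | rfl)
    · have h1 : (U.erase i).card ≤ ((S ∩ I.inside j).filter (I.Closer H c j i)).card := by
        refine Finset.card_le_card fun k hk => ?_
        have hkU := Finset.mem_of_mem_erase hk
        have := hTS k (hU hkU)
        exact Finset.mem_filter.2 ⟨Finset.mem_inter.2 ⟨this.1, this.2.2.1⟩,
          hcl k hkU (Finset.ne_of_mem_erase hk)⟩
      rw [Finset.card_erase_of_mem hi] at h1
      have := (hTS i (hU hi)).2.2.2
      omega
    · simp
  have hhalf : ∀ i ∈ T, ∀ k ∈ T, I.half H c j i % 2 = I.half H c j k % 2 →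
      I.half H c j i = I.half H c j k := by
    intro i hi k hk h
    have := half_div_two_eq (c := c) hc (hTS i hi).2.2.1 (hTS k hk).2.2.1
    omega
  have heven : (T.filter fun i => I.half H c j i % 2 = 0).card ≤ I.halfCap j := by
    set U := T.filter fun i => I.half H c j i % 2 = 0 with hU
    refine hone U (Finset.filter_subset _ _) ?_
    by_cases hne : U.Nonempty
    · left
      obtain ⟨i, hi, hmin⟩ := Finset.exists_min_image U (I.blk H c) hne
      obtain ⟨hiT, hi2⟩ := Finset.mem_filter.1 hi
      refine ⟨i, hi, fun k hk hki => ?_⟩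
      obtain ⟨hkT, hk2⟩ := Finset.mem_filter.1 hk
      refine ⟨hhalf k hkT i hiT (by omega), ?_⟩
      rw [if_pos hi2]
      exact lt_of_le_of_ne (hmin k hk) fun h => hki ((hTS i hiT).2.1 k (hTS k hkT).1 h.symm)
    · exact Or.inr (Finset.not_nonempty_iff_eq_empty.1 hne)
  have hodd : (T.filter fun i => ¬ I.half H c j i % 2 = 0).card ≤ I.halfCap j := by
    set U := T.filter fun i => ¬ I.half H c j i % 2 = 0 with hU
    refine hone U (Finset.filter_subset _ _) ?_
    by_cases hne : U.Nonempty
    · left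
      obtain ⟨i, hi, hmax⟩ := Finset.exists_max_image U (I.blk H c) hne
      obtain ⟨hiT, hi2⟩ := Finset.mem_filter.1 hi
      refine ⟨i, hi, fun k hk hki => ?_⟩
      obtain ⟨hkT, hk2⟩ := Finset.mem_filter.1 hk
      refine ⟨hhalf k hkT i hiT (by omega), ?_⟩
      rw [if_neg hi2]
      exact lt_of_le_of_ne (hmax k hk) fun h => hki ((hTS i hiT).2.1 k (hTS k hkT).1 h)
    · exact Or.inr (Finset.not_nonempty_iff_eq_empty.1 hne)
  have h1 := Finset.card_filter_add_card_filter_not (s := T) fun i => I.half H c j i % 2 = 0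
  -- Each half is granted at least one point, which is why capacity 1 is relaxed to 2.
  have h2 : 2 * I.halfCap j ≤ max (I.cap j) 2 := by
    simp only [halfCap]; omega
  omega

end

end PackInstance

/-! ### A good seed exists -/

namespace PackInstance

section
variable (I : PackInstance) (H Λ : ℕ) (c : Fin I.n → ℕ)

/-- `k` is not below, or not above, the point `i`. -/
def Side (up : Bool) (i k : Fin I.n) : Prop :=
  if up then (I.point i).2 ≤ (I.point k).2 else (I.point k).2 ≤ (I.point i).2

/-- The logarithmic size class of the capacity of a quarter of the rectangle `j`. -/
def sizeClass (j : Fin I.m) : ℕ := min (Nat.log 2 ((I.halfCap j + 1) / 2)) Λ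

/-- The points that a rectangle around `i` of level `l` and size class `t` may contain on one
side of `i`, closer to the middle. -/
noncomputable def rivals (i : Fin I.n) (l : ℕ) (up : Bool) (t : ℕ) : Finset (Fin I.n) :=
  open Classical in Finset.univ.filter fun k => ∃ j, i ∈ I.inside j ∧ I.lev H c j = l ∧
    I.sizeClass Λ j = t ∧ k ∈ I.inside j ∧ I.Closer H c j i k ∧ I.Side up i k

variable {I H Λ c}

theorem mem_rivals {i k : Fin I.n} {l t : ℕ} {up : Bool} : k ∈ I.rivals H Λ c i l up t ↔
    ∃ j, i ∈ I.inside j ∧ I.lev H c j = l ∧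
    I.sizeClass Λ j = t ∧ k ∈ I.inside j ∧ I.Closer H c j i k ∧ I.Side up i k := by
  simp [rivals]

theorem mem_inside {j : Fin I.m} {i : Fin I.n} :
    i ∈ I.inside j ↔ (I.rect j).Contains (I.point i) := by simp [inside]

theorem blk_lt_of_half_lt {j : Fin I.m} {i k : Fin I.n}
    (h : I.half H c j i < I.half H c j k) : I.blk H c i < I.blk H c k := by
  by_contra hge
  exact absurd h (not_lt.2 (Nat.div_le_div_right (by omega)))

/-- If `k` is closer than `i` to the middle of `j`, then it lies in the `x`-range of `j`. -/
theorem fst_mem_of_closer (hc : ∀ i, c i ≤ H) {j : Fin I.m} {i k : Fin I.n}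
    (hi : i ∈ I.inside j) (h : I.Closer H c j i k) :
    (I.rect j).left ≤ (I.point k).1 ∧ (I.point k).1 ≤ (I.rect j).right := by
  obtain ⟨hsplit, hbelow⟩ := lev_spec (I := I) hc j
  obtain ⟨h1, h2⟩ := h
  have hi' := mem_inside.1 hi
  -- At level 0 a half is a single block, and no point is strictly closer to the middle than
  -- another.
  have hl : I.lev H c j ≠ 0 := by
    intro h0
    simp only [half, h0, pow_zero, Nat.div_one] at h1
    split_ifs at h2 <;> omega
  obtain ⟨l, hl⟩ := Nat.exists_eq_succ_of_ne_zero hl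
  -- By minimality of the level, `j` has points `a` and `b` in its left and right half. The block of
  -- `k` lies strictly between that of `i` and that of the one in the opposite half.
  obtain ⟨a, ha, b, hb, hab⟩ := hbelow l (by omega)
  have hh : ∀ q, I.half H c j q = I.blk H c q / 2 ^ l := by
    intro q
    rw [half, hl, Nat.succ_eq_add_one, pow_succ, mul_comm _ 2,
      Nat.mul_div_mul_left _ _ (by norm_num)]
  rw [← hh, ← hh] at hab
  have e1 := half_div_two_eq (c := c) hc ha hb
  have e2 := half_div_two_eq (c := c) hc ha hi
  split_ifs at h2 with hpar
  · have h3 : I.blk H c k < I.blk H c b := blk_lt_of_half_lt (j := j) (by omega)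
    exact ⟨hi'.1.trans (fst_le_of_blk_lt h2), (fst_le_of_blk_lt h3).trans (mem_inside.1 hb).2.1⟩
  · have h3 : I.blk H c a < I.blk H c k := blk_lt_of_half_lt (j := j) (by omega)
    exact ⟨(mem_inside.1 ha).1.trans (fst_le_of_blk_lt h3), (fst_le_of_blk_lt h2).trans hi'.2.1⟩

/-- A rectangle enters `Closer` only through its level. -/
theorem closer_congr {j j' : Fin I.m} (h : I.lev H c j = I.lev H c j') {i k : Fin I.n}
    (hc : I.Closer H c j i k) : I.Closer H c j' i k := by
  have hh : I.half H c j' = I.half H c j := by funext q; simp only [half, h]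
  obtain ⟨h1, h2⟩ := hc
  unfold Closer
  rw [hh]
  exact ⟨h1, h2⟩

/-- Take, among the rectangles around `i` of this level and class, one with the highest top side (or
the lowest bottom side, for the points below `i`). By `fst_mem_of_closer` its horizontal range
contains every rival, and vertically a rival lies between `i` and the extreme side. This spares a
union bound over the rectangles. -/
theorem rivals_subset (hc : ∀ i, c i ≤ H) (i : Fin I.n) (l : ℕ) (up : Bool) (t : ℕ) :
    I.rivals H Λ c i l up t = ∅ ∨
      ∃ j, I.sizeClass Λ j = t ∧ I.rivals H Λ c i l up t ⊆ I.inside j := by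
  classical
  set J := Finset.univ.filter fun j => i ∈ I.inside j ∧ I.lev H c j = l ∧ I.sizeClass Λ j = t
    with hJ
  have hmem : ∀ j, j ∈ J ↔ i ∈ I.inside j ∧ I.lev H c j = l ∧ I.sizeClass Λ j = t := by
    intro j; simp [hJ]
  by_cases hne : J.Nonempty
  · right
    cases up with
    | true =>
      obtain ⟨j, hj, hmax⟩ := Finset.exists_max_image J (fun j => (I.rect j).top) hne
      obtain ⟨hij, hlj, htj⟩ := (hmem j).1 hj
      refine ⟨j, htj, fun k hk => ?_⟩
      obtain ⟨j', hi', hl', ht', hk', hcl, hs⟩ := mem_rivals.1 hk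
      have hx := fst_mem_of_closer hc hij (closer_congr (hl'.trans hlj.symm) hcl)
      simp only [Side, if_true] at hs
      exact mem_inside.2 ⟨hx.1, hx.2, (mem_inside.1 hij).2.2.1.trans hs,
        (mem_inside.1 hk').2.2.2.trans (hmax j' ((hmem j').2 ⟨hi', hl', ht'⟩))⟩
    | false =>
      obtain ⟨j, hj, hmin⟩ := Finset.exists_min_image J (fun j => (I.rect j).bottom) hne
      obtain ⟨hij, hlj, htj⟩ := (hmem j).1 hj
      refine ⟨j, htj, fun k hk => ?_⟩
      obtain ⟨j', hi', hl', ht', hk', hcl, hs⟩ := mem_rivals.1 hk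
      have hx := fst_mem_of_closer hc hij (closer_congr (hl'.trans hlj.symm) hcl)
      simp only [Side, Bool.false_eq_true, if_false] at hs
      exact mem_inside.2 ⟨hx.1, hx.2,
        (hmin j' ((hmem j').2 ⟨hi', hl', ht'⟩)).trans (mem_inside.1 hk').2.2.1,
        hs.trans (mem_inside.1 hij).2.2.2⟩
  · left
    rw [Finset.eq_empty_iff_forall_notMem]
    intro k hk
    obtain ⟨j', hi', hl', ht', -⟩ := mem_rivals.1 hk
    exact hne ⟨j', (hmem j').2 ⟨hi', hl', ht'⟩⟩

/-- The rivals lie in one rectangle of class `t`, whose capacity is at most `10 * 2 ^ t` if the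
class is not truncated. In the truncated class `t = Λ` the total mass, less than `H * 2 ^ Λ`, is
used instead. -/
theorem sum_rivals_le {B : ℕ} (hc : ∀ i, c i ≤ H)
    (hload : ∀ j, ∑ i ∈ I.inside j, c i ≤ H * I.cap j) (htot : ∑ i, c i ≤ H * B)
    (hB : B < 2 ^ Λ) (i : Fin I.n) (l : ℕ) (up : Bool) (t : ℕ) :
    ∑ k ∈ I.rivals H Λ c i l up t, c k ≤ H * (10 * 2 ^ t) := by
  rcases rivals_subset (Λ := Λ) hc i l up t with h | ⟨j, ht, h⟩
  · rw [h]; simp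
  · by_cases hlt : Nat.log 2 ((I.halfCap j + 1) / 2) < Λ
    · refine (Finset.sum_le_sum_of_subset h).trans ((hload j).trans (Nat.mul_le_mul_left _ ?_))
      have h1 : Nat.log 2 ((I.halfCap j + 1) / 2) = t := by
        rw [← ht, sizeClass, min_eq_left hlt.le]
      have h2 := Nat.lt_pow_succ_log_self (b := 2) (by norm_num) ((I.halfCap j + 1) / 2)
      rw [h1, pow_succ] at h2
      have h3 : I.cap j ≤ 2 * I.halfCap j + 1 := by simp only [halfCap]; omega
      omega
    · have h1 : t = Λ := by rw [← ht, sizeClass, min_eq_right (by omega)]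
      refine (Finset.sum_le_univ_sum_of_nonneg fun _ => Nat.zero_le _).trans
        (htot.trans (Nat.mul_le_mul_left _ ?_))
      rw [h1]; omega

/-- Block numbers are at most `B < 2 ^ Λ`, so at level `Λ` nothing is separated any more. This is
where the energy enters the approximation factor. -/
theorem lev_le {B : ℕ} (hc : ∀ i, c i ≤ H) (htot : ∑ i, c i ≤ H * B)
    (hB : B < 2 ^ Λ) (j : Fin I.m) : I.lev H c j ≤ Λ := by
  by_contra hgt
  obtain ⟨i, -, k, -, h⟩ := (lev_spec (I := I) hc j).2 Λ (by omega)
  have h1 : I.blk H c k ≤ B := blk_le htot k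
  rw [Nat.div_eq_of_lt (lt_of_le_of_lt h1 hB)] at h
  exact Nat.not_lt_zero _ h

/-- Why a point of `S` does not survive. -/
theorem exists_rivals_of_notMem_survivors {B : ℕ} (hc : ∀ i, c i ≤ H)
    (htot : ∑ i, c i ≤ H * B) (hB : B < 2 ^ Λ) {S : Finset (Fin I.n)} {i : Fin I.n} (hi : i ∈ S)
    (hns : i ∉ I.survivors H c S) :
    (∃ k ∈ S, k ≠ i ∧ I.blk H c k = I.blk H c i) ∨
      ∃ l ∈ Finset.Icc 1 Λ, ∃ up, ∃ t ≤ Λ, 2 ^ t ≤ (S ∩ I.rivals H Λ c i l up t).card := by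
  classical
  by_cases h1 : ∀ k ∈ S, I.blk H c k = I.blk H c i → k = i
  · right
    have h2 : ¬ ∀ j, i ∈ I.inside j →
        ((S ∩ I.inside j).filter (I.Closer H c j i)).card < I.halfCap j := fun h2 =>
      hns (Finset.mem_filter.2 ⟨hi, h1, h2⟩)
    push Not at h2
    obtain ⟨j, hij, hge⟩ := h2
    set F := (S ∩ I.inside j).filter (I.Closer H c j i) with hF
    set κ := (I.halfCap j + 1) / 2 with hκ
    have hk1 : 1 ≤ I.halfCap j := le_max_left _ _
    have hsub : ∀ up, F.filter (I.Side up i) ⊆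
        S ∩ I.rivals H Λ c i (I.lev H c j) up (I.sizeClass Λ j) := by
      intro up k hk
      obtain ⟨hkF, hks⟩ := Finset.mem_filter.1 hk
      obtain ⟨hkSj, hcl⟩ := Finset.mem_filter.1 hkF
      obtain ⟨hkS, hkj⟩ := Finset.mem_inter.1 hkSj
      exact Finset.mem_inter.2 ⟨hkS, mem_rivals.2 ⟨j, hij, rfl, rfl, hkj, hcl, hks⟩⟩
    have hcover : F.card ≤ (F.filter (I.Side true i)).card + (F.filter (I.Side false i)).card := by
      refine le_trans (Finset.card_le_card ?_) (Finset.card_union_le _ _)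
      intro k hk
      rcases le_total (I.point i).2 (I.point k).2 with h | h
      · exact Finset.mem_union_left _ (Finset.mem_filter.2 ⟨hk, by simpa [Side] using h⟩)
      · exact Finset.mem_union_right _ (Finset.mem_filter.2 ⟨hk, by simpa [Side] using h⟩)
    -- At least `halfCap` sampled points are closer to the middle; one of the two sides, above or
    -- below `i`, has at least half of them, rounded up.
    obtain ⟨up, hup⟩ : ∃ up, κ ≤ (F.filter (I.Side up i)).card := by
      by_contra hno
      push Not at hno
      have := hno true
      have := hno false
      omega
    have hlev : 1 ≤ I.lev H c j := by
      by_contra h0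
      have h0 : I.lev H c j = 0 := by omega
      have hFe : F = ∅ := by
        rw [Finset.eq_empty_iff_forall_notMem]
        intro k hk
        obtain ⟨-, h1, h2⟩ := Finset.mem_filter.1 hk
        simp only [half, h0, pow_zero, Nat.div_one] at h1
        split_ifs at h2 <;> omega
      rw [hFe] at hge
      simp at hge
      omega
    refine ⟨I.lev H c j, Finset.mem_Icc.2 ⟨hlev, lev_le hc htot hB j⟩, up, I.sizeClass Λ j,
      min_le_right _ _, ?_⟩
    calc 2 ^ I.sizeClass Λ j ≤ 2 ^ Nat.log 2 κ :=
          Nat.pow_le_pow_right (by norm_num) (min_le_left _ _)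
      _ ≤ κ := Nat.pow_log_le_self 2 (by omega)
      _ ≤ _ := hup
      _ ≤ _ := Finset.card_le_card (hsub up)
  · left
    push Not at h1
    obtain ⟨k, hk, hb, hne⟩ := h1
    exact ⟨k, hk, hne, hb⟩

variable (I H Λ c) in
/-- The charges of pairs. -/
noncomputable def pairCharge (i k : Fin I.n) : ℝ :=
  -- The first term charges a companion in the same block, the second a rival of class 0, where one
  -- sampled rival may already be too many.
  (if k ≠ i ∧ I.blk H c k = I.blk H c i then 1 else 0) +
    ∑ l ∈ Finset.Icc 1 Λ, ∑ up : Bool, if k ∈ I.rivals H Λ c i l up 0 then 1 else 0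

variable (I H Λ c) in
/-- The charges of triples. -/
noncomputable def tripleCharge (i k k' : Fin I.n) : ℝ :=
  -- At least `2 ^ t` sampled rivals, with `t ≥ 1`, form at least `4 ^ t / 2` ordered pairs, so that
  -- a charge of `2 / 4 ^ t` per pair adds up to one.
  ∑ l ∈ Finset.Icc 1 Λ, ∑ up : Bool, ∑ t ∈ Finset.Icc 1 Λ,
    if k ∈ I.rivals H Λ c i l up t ∧ k' ∈ I.rivals H Λ c i l up t ∧ k ≠ k' then 2 / 4 ^ t else 0

theorem pairCharge_nonneg (i k : Fin I.n) : 0 ≤ I.pairCharge H Λ c i k :=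
  add_nonneg (by split_ifs <;> norm_num) (Finset.sum_nonneg fun _ _ => Finset.sum_nonneg fun _ _ =>
    by split_ifs <;> norm_num)

theorem tripleCharge_nonneg (i k k' : Fin I.n) : 0 ≤ I.tripleCharge H Λ c i k k' :=
  Finset.sum_nonneg fun _ _ => Finset.sum_nonneg fun _ _ => Finset.sum_nonneg fun _ _ => by
    split_ifs <;> positivity

theorem self_notMem_rivals (i : Fin I.n) (l : ℕ) (up : Bool) (t : ℕ) :
    i ∉ I.rivals H Λ c i l up t := by
  intro h
  obtain ⟨j, -, -, -, -, ⟨-, h2⟩, -⟩ := mem_rivals.1 h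
  split_ifs at h2 <;> omega

theorem pairCharge_self (i : Fin I.n) : I.pairCharge H Λ c i i = 0 := by
  simp [pairCharge, self_notMem_rivals]

theorem tripleCharge_eq_zero (i k k' : Fin I.n) (h : i = k ∨ i = k' ∨ k = k') :
    I.tripleCharge H Λ c i k k' = 0 := by
  refine Finset.sum_eq_zero fun l _ => Finset.sum_eq_zero fun up _ => Finset.sum_eq_zero
    fun t _ => if_neg ?_
  rintro ⟨h1, h2, h3⟩
  rcases h with rfl | rfl | rfl
  · exact self_notMem_rivals _ _ _ _ h1
  · exact self_notMem_rivals _ _ _ _ h2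
  · exact h3 rfl

theorem sum_ite_ne_eq {n : ℕ} (U : Finset (Fin n)) (x : ℝ) :
    ∑ k ∈ U, ∑ k' ∈ U, (if k ≠ k' then x else 0) = (U.card : ℝ) * ((U.card : ℝ) - 1) * x := by
  have h1 : ∀ k ∈ U, ∑ k' ∈ U, (if k ≠ k' then x else 0) = ((U.card : ℝ) - 1) * x := by
    intro k hk
    have : ∀ k', (if k ≠ k' then x else 0) = x - if k = k' then x else 0 := by
      intro k'; by_cases h : k = k' <;> simp [h]
    simp only [this, Finset.sum_sub_distrib, Finset.sum_const, nsmul_eq_mul, Finset.sum_ite_eq,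
      if_pos hk]
    ring
  rw [Finset.sum_congr rfl h1, Finset.sum_const, nsmul_eq_mul]; ring

/-- Points that do not survive are charged at least one. -/
theorem one_le_charge {B : ℕ} (hc : ∀ i, c i ≤ H)
    (htot : ∑ i, c i ≤ H * B) (hB : B < 2 ^ Λ) {S : Finset (Fin I.n)} {i : Fin I.n} (hi : i ∈ S)
    (hns : i ∉ I.survivors H c S) :
    1 ≤ ∑ k ∈ S, I.pairCharge H Λ c i k + ∑ k ∈ S, ∑ k' ∈ S, I.tripleCharge H Λ c i k k' := by
  classical
  have p1 : 0 ≤ ∑ k ∈ S, I.pairCharge H Λ c i k :=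
    Finset.sum_nonneg fun k _ => pairCharge_nonneg i k
  have p2 : 0 ≤ ∑ k ∈ S, ∑ k' ∈ S, I.tripleCharge H Λ c i k k' :=
    Finset.sum_nonneg fun k _ => Finset.sum_nonneg fun k' _ => tripleCharge_nonneg i k k'
  have hrest : ∀ k, 0 ≤ ∑ l ∈ Finset.Icc 1 Λ, ∑ up : Bool,
      if k ∈ I.rivals H Λ c i l up 0 then (1 : ℝ) else 0 := fun k =>
    Finset.sum_nonneg fun _ _ => Finset.sum_nonneg fun _ _ => by split_ifs <;> norm_num
  rcases exists_rivals_of_notMem_survivors hc htot hB hi hns with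
    ⟨k, hk, hki, hb⟩ | ⟨l, hl, up, t, ht, hcard⟩
  · have h1 : I.pairCharge H Λ c i k ≤ ∑ k ∈ S, I.pairCharge H Λ c i k :=
      Finset.single_le_sum (fun k _ => pairCharge_nonneg i k) hk
    have h2 : 1 ≤ I.pairCharge H Λ c i k := by
      rw [pairCharge, if_pos ⟨hki, hb⟩]; linarith [hrest k]
    linarith
  · rcases Nat.eq_zero_or_pos t with rfl | htpos
    · obtain ⟨k, hk⟩ := Finset.card_pos.1 (lt_of_lt_of_le (by norm_num) hcard)
      obtain ⟨hkS, hkr⟩ := Finset.mem_inter.1 hk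
      have h1 : I.pairCharge H Λ c i k ≤ ∑ k ∈ S, I.pairCharge H Λ c i k :=
        Finset.single_le_sum (fun k _ => pairCharge_nonneg i k) hkS
      have h2 : (if k ∈ I.rivals H Λ c i l up 0 then (1 : ℝ) else 0) ≤ ∑ up : Bool,
          if k ∈ I.rivals H Λ c i l up 0 then (1 : ℝ) else 0 :=
        Finset.single_le_sum (f := fun up => if k ∈ I.rivals H Λ c i l up 0 then (1 : ℝ) else 0)
          (fun _ _ => by split_ifs <;> norm_num) (Finset.mem_univ up)
      have h3 : (∑ up : Bool, if k ∈ I.rivals H Λ c i l up 0 then (1 : ℝ) else 0) ≤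
          ∑ l ∈ Finset.Icc 1 Λ, ∑ up : Bool,
            if k ∈ I.rivals H Λ c i l up 0 then (1 : ℝ) else 0 :=
        Finset.single_le_sum (f := fun l => ∑ up : Bool,
          if k ∈ I.rivals H Λ c i l up 0 then (1 : ℝ) else 0)
          (fun _ _ => Finset.sum_nonneg fun _ _ => by split_ifs <;> norm_num) hl
      rw [if_pos hkr] at h2
      have h4 : 1 ≤ I.pairCharge H Λ c i k := by
        rw [pairCharge]
        have : (0 : ℝ) ≤ if k ≠ i ∧ I.blk H c k = I.blk H c i then 1 else 0 := by
          split_ifs <;> norm_num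
        linarith
      linarith
    · set U := S ∩ I.rivals H Λ c i l up t with hU
      have h1 : ∑ k ∈ U, ∑ k' ∈ U, (if k ≠ k' then (2 : ℝ) / 4 ^ t else 0) ≤
          ∑ k ∈ S, ∑ k' ∈ S, I.tripleCharge H Λ c i k k' := by
        have hle : ∀ k ∈ U, ∀ k' ∈ U, (if k ≠ k' then (2 : ℝ) / 4 ^ t else 0) ≤
            I.tripleCharge H Λ c i k k' := by
          intro k hk k' hk'
          have hkr := (Finset.mem_inter.1 hk).2
          have hkr' := (Finset.mem_inter.1 hk').2
          have e : (if k ≠ k' then (2 : ℝ) / 4 ^ t else 0) =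
              if k ∈ I.rivals H Λ c i l up t ∧ k' ∈ I.rivals H Λ c i l up t ∧ k ≠ k' then
                2 / 4 ^ t else 0 := by simp [hkr, hkr']
          rw [e]
          have s1 := Finset.single_le_sum (s := Finset.Icc 1 Λ) (f := fun t =>
            if k ∈ I.rivals H Λ c i l up t ∧ k' ∈ I.rivals H Λ c i l up t ∧ k ≠ k' then
                (2 : ℝ) / 4 ^ t else 0) (fun _ _ => by split_ifs <;> positivity)
              (Finset.mem_Icc.2 ⟨htpos, ht⟩)
          have s2 := Finset.single_le_sum (s := Finset.univ) (f := fun up : Bool =>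
            ∑ t ∈ Finset.Icc 1 Λ,
            if k ∈ I.rivals H Λ c i l up t ∧ k' ∈ I.rivals H Λ c i l up t ∧ k ≠ k' then
                (2 : ℝ) / 4 ^ t else 0)
              (fun _ _ => Finset.sum_nonneg fun _ _ => by split_ifs <;> positivity)
              (Finset.mem_univ up)
          have s3 := Finset.single_le_sum (s := Finset.Icc 1 Λ) (f := fun l =>
            ∑ up : Bool, ∑ t ∈ Finset.Icc 1 Λ,
            if k ∈ I.rivals H Λ c i l up t ∧ k' ∈ I.rivals H Λ c i l up t ∧ k ≠ k' then
                (2 : ℝ) / 4 ^ t else 0)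
              (fun _ _ => Finset.sum_nonneg fun _ _ => Finset.sum_nonneg fun _ _ => by
                split_ifs <;> positivity) hl
          exact s1.trans (s2.trans s3)
        refine (Finset.sum_le_sum fun k hk => Finset.sum_le_sum fun k' hk' => hle k hk k' hk').trans
          ?_
        refine le_trans (Finset.sum_le_sum fun k _ => Finset.sum_le_sum_of_subset_of_nonneg
          Finset.inter_subset_left fun k' _ _ => tripleCharge_nonneg i k k') ?_
        exact Finset.sum_le_sum_of_subset_of_nonneg Finset.inter_subset_left fun k _ _ =>
          Finset.sum_nonneg fun k' _ => tripleCharge_nonneg i k k'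
      rw [sum_ite_ne_eq] at h1
      have h2 : (2 : ℝ) ^ t ≤ U.card := by exact_mod_cast hcard
      have h3 : (2 : ℝ) ≤ 2 ^ t := by
        calc (2 : ℝ) = 2 ^ 1 := by norm_num
          _ ≤ 2 ^ t := pow_le_pow_right₀ (by norm_num) htpos
      have h4 : (4 : ℝ) ^ t = 2 ^ t * 2 ^ t := by rw [← mul_pow]; norm_num
      have h5 : 1 ≤ (U.card : ℝ) * ((U.card : ℝ) - 1) * (2 / 4 ^ t) := by
        rw [h4, ← mul_div_assoc, le_div_iff₀ (by positivity)]
        have h6 : (2 : ℝ) ^ t - 1 ≤ (U.card : ℝ) - 1 := by linarith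
        have h7 : (2 : ℝ) ^ t * (2 ^ t - 1) ≤ U.card * (U.card - 1) :=
          mul_le_mul h2 h6 (by linarith) (by linarith)
        nlinarith
      linarith

/-- The expected charge of a point is at most `1 / 2`. -/
theorem sum_charge_le {B : ℕ} {μ : ℝ} (hH : 1 ≤ H) (hΛ : 1 ≤ Λ) (hc : ∀ i, c i ≤ H)
    (hload : ∀ j, ∑ i ∈ I.inside j, c i ≤ H * I.cap j) (htot : ∑ i, c i ≤ H * B)
    (hB : B < 2 ^ Λ) (hμ0 : 0 ≤ μ) (hμ : μ * (H * 64 * Λ) ≤ 1) (i : Fin I.n) :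
    ∑ k, I.pairCharge H Λ c i k * (c k * μ) +
      ∑ k, ∑ k', I.tripleCharge H Λ c i k k' * (c k * μ * (c k' * μ)) ≤ 1 / 2 := by
  classical
  have hΛr : (1 : ℝ) ≤ Λ := by exact_mod_cast hΛ
  -- The expected number of sampled points in a set of mass `H`, that is, of fractional mass one.
  set δ := μ * H with hδ
  have hδ0 : 0 ≤ δ := by positivity
  have hδΛ : δ * Λ ≤ 1 / 64 := by rw [hδ]; nlinarith
  have hδ1 : δ ≤ 1 / 64 := by nlinarith
  have hmass : ∀ (l : ℕ) (up : Bool) (t : ℕ),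
      ∑ k, (if k ∈ I.rivals H Λ c i l up t then c k * μ else 0) ≤ 10 * 2 ^ t * δ := by
    intro l up t
    rw [Finset.sum_ite_mem, Finset.univ_inter, ← Finset.sum_mul]
    have := sum_rivals_le (Λ := Λ) hc hload htot hB i l up t
    have h1 : (∑ k ∈ I.rivals H Λ c i l up t, (c k : ℝ)) ≤ H * (10 * 2 ^ t) := by
      exact_mod_cast this
    calc _ ≤ H * (10 * 2 ^ t) * μ := mul_le_mul_of_nonneg_right h1 hμ0
      _ = _ := by rw [hδ]; ring
  have hblock : ∑ k, (if k ≠ i ∧ I.blk H c k = I.blk H c i then (1 : ℝ) else 0) * (c k * μ) ≤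
      2 * δ := by
    have h1 : ∑ k, (if k ≠ i ∧ I.blk H c k = I.blk H c i then (1 : ℝ) else 0) * (c k * μ) ≤
        ∑ k with I.blk H c k = I.blk H c i, (c k : ℝ) * μ := by
      rw [Finset.sum_filter]
      refine Finset.sum_le_sum fun k _ => ?_
      have : 0 ≤ (c k : ℝ) * μ := by positivity
      split_ifs with h1 h2 h2
      · simp
      · exact absurd h1.2 h2
      · simpa using this
      · simp
    have h2 := sum_blk_le (I := I) hH hc (I.blk H c i)
    rw [← Finset.sum_mul] at h1
    have h3 : (∑ k with I.blk H c k = I.blk H c i, (c k : ℝ)) ≤ 2 * H := by exact_mod_cast h2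
    calc _ ≤ _ := h1
      _ ≤ 2 * H * μ := mul_le_mul_of_nonneg_right h3 hμ0
      _ = _ := by rw [hδ]; ring
  have hcardΛ : ((Finset.Icc 1 Λ).card : ℝ) = Λ := by simp
  have hpair : ∑ k, I.pairCharge H Λ c i k * (c k * μ) ≤ 2 * δ + Λ * (2 * (10 * δ)) := by
    simp only [pairCharge, add_mul, Finset.sum_add_distrib]
    refine add_le_add hblock ?_
    have e : ∑ k, (∑ l ∈ Finset.Icc 1 Λ, ∑ up : Bool,
        if k ∈ I.rivals H Λ c i l up 0 then (1 : ℝ) else 0) * (c k * μ) =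
        ∑ l ∈ Finset.Icc 1 Λ, ∑ up : Bool,
          ∑ k, if k ∈ I.rivals H Λ c i l up 0 then c k * μ else 0 := by
      simp only [Finset.sum_mul, ite_mul, one_mul, zero_mul]
      rw [Finset.sum_comm]
      exact Finset.sum_congr rfl fun l _ => Finset.sum_comm
    rw [e]
    calc _ ≤ ∑ l ∈ Finset.Icc 1 Λ, ∑ up : Bool, 10 * 2 ^ 0 * δ :=
          Finset.sum_le_sum fun l _ => Finset.sum_le_sum fun up _ => hmass l up 0
      _ = _ := by
        rw [Finset.sum_const, nsmul_eq_mul, hcardΛ]; simp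
  have htriple : ∑ k, ∑ k', I.tripleCharge H Λ c i k k' * (c k * μ * (c k' * μ)) ≤
      Λ * (2 * (Λ * (200 * δ ^ 2))) := by
    have e : ∑ k, ∑ k', I.tripleCharge H Λ c i k k' * (c k * μ * (c k' * μ)) =
        ∑ l ∈ Finset.Icc 1 Λ, ∑ up : Bool, ∑ t ∈ Finset.Icc 1 Λ, ∑ k, ∑ k',
          (if k ∈ I.rivals H Λ c i l up t ∧ k' ∈ I.rivals H Λ c i l up t ∧ k ≠ k' then
            (2 : ℝ) / 4 ^ t else 0) * (c k * μ * (c k' * μ)) := by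
      simp only [tripleCharge, Finset.sum_mul]
      have sw : ∀ {α β : Type} (s : Finset α) (u : Finset β) (f : Fin I.n → Fin I.n → α → ℝ),
          ∑ k, ∑ k', ∑ a ∈ s, f k k' a = ∑ a ∈ s, ∑ k, ∑ k', f k k' a := by
        intro α β s u f
        rw [Finset.sum_comm]
        simp_rw [Finset.sum_comm (s := s)]
        rw [Finset.sum_comm]
      rw [sw (β := ℕ) _ ∅]
      refine Finset.sum_congr rfl fun l _ => ?_
      rw [sw (β := ℕ) _ ∅]
      refine Finset.sum_congr rfl fun up _ => ?_
      rw [sw (β := ℕ) _ ∅]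
    rw [e]
    -- The rivals' expected number is at most `10 * 2 ^ t * δ`; its square cancels `4 ^ t`, and all
    -- classes contribute equally.
    have hone : ∀ (l : ℕ) (up : Bool) (t : ℕ), ∑ k, ∑ k',
          (if k ∈ I.rivals H Λ c i l up t ∧ k' ∈ I.rivals H Λ c i l up t ∧ k ≠ k' then
            (2 : ℝ) / 4 ^ t else 0) * (c k * μ * (c k' * μ)) ≤ 200 * δ ^ 2 := by
      intro l up t
      set M := ∑ k, (if k ∈ I.rivals H Λ c i l up t then c k * μ else 0) with hM
      have hM0 : 0 ≤ M := Finset.sum_nonneg fun k _ => by split_ifs <;> positivity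
      have h4 : (4 : ℝ) ^ t = 2 ^ t * 2 ^ t := by rw [← mul_pow]; norm_num
      calc _ ≤ ∑ k, ∑ k', 2 / 4 ^ t * ((if k ∈ I.rivals H Λ c i l up t then c k * μ else 0) *
            (if k' ∈ I.rivals H Λ c i l up t then c k' * μ else 0)) := by
            refine Finset.sum_le_sum fun k _ => Finset.sum_le_sum fun k' _ => ?_
            have q : 0 ≤ (c k : ℝ) * μ * (c k' * μ) := by positivity
            by_cases hk : k ∈ I.rivals H Λ c i l up t
            · by_cases hk' : k' ∈ I.rivals H Λ c i l up t
              · rw [if_pos hk, if_pos hk']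
                refine mul_le_mul_of_nonneg_right ?_ q
                split_ifs
                · exact le_rfl
                · positivity
              · simp [hk']
            · simp [hk]
        _ = 2 / 4 ^ t * (M * M) := by
            rw [hM, Finset.sum_mul_sum, Finset.mul_sum]
            exact Finset.sum_congr rfl fun k _ => (Finset.mul_sum _ _ _).symm
        _ ≤ 2 / 4 ^ t * ((10 * 2 ^ t * δ) * (10 * 2 ^ t * δ)) :=
            mul_le_mul_of_nonneg_left (mul_self_le_mul_self hM0 (hmass l up t)) (by positivity)
        _ = 200 * δ ^ 2 := by rw [h4]; field_simp; ring
    calc _ ≤ ∑ l ∈ Finset.Icc 1 Λ, ∑ up : Bool, ∑ t ∈ Finset.Icc 1 Λ, 200 * δ ^ 2 :=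
          Finset.sum_le_sum fun l _ => Finset.sum_le_sum fun up _ =>
            Finset.sum_le_sum fun t _ => hone l up t
      _ = _ := by
        simp only [Finset.sum_const, nsmul_eq_mul, hcardΛ]; simp
  -- In total `2 δ + 20 δ Λ + 400 (δ Λ) ^ 2 ≤ 2 / 64 + 20 / 64 + 400 / 4096 < 1 / 2`.
  have hsq : (δ * Λ) ^ 2 ≤ (1 / 64) ^ 2 := pow_le_pow_left₀ (by positivity) hδΛ 2
  nlinarith

/-- Some seed leaves survivors of large weight. -/
theorem exists_good_seed {B : ℕ} {w : Fin I.n → ℝ} (hn : 1 ≤ I.n) (hH : 1 ≤ H) (hΛ : 1 ≤ Λ)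
    (hc : ∀ i, c i ≤ H)
    (hload : ∀ j, ∑ i ∈ I.inside j, c i ≤ H * I.cap j) (htot : ∑ i, c i ≤ H * B)
    (hB : B < 2 ^ Λ) (hw : ∀ i, c i ≠ 0 → 0 ≤ w i) :
    ∃ P ≤ 128 * I.n * H * Λ, ∃ a < P, ∃ b < P, ∃ e < P, ∑ i, w i * c i ≤ 256 * H * Λ *
      ∑ i ∈ I.survivors H c (Finset.univ.filter fun i : Fin I.n =>
        ((a * i + b) * i + e) % P < I.n * c i), w i := by
  set X := I.n * H * 64 * Λ with hX
  have hX1 : 1 ≤ X := Nat.mul_pos (Nat.mul_pos (Nat.mul_pos hn hH) (by norm_num)) hΛ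
  -- Bertrand's postulate. The sampling probability is `n * c i / P`; the factor `n` in threshold
  -- and modulus makes `P` larger than `n`, so that the indices of the points are distinct modulo
  -- `P`.
  obtain ⟨P, hP, hXP, hP2⟩ := Nat.exists_prime_lt_and_le_two_mul X (by omega)
  have := Fact.mk hP
  have hP0 : (0 : ℝ) < P := by exact_mod_cast hP.pos
  set μ : ℝ := I.n / P with hμ
  have hnH : I.n * H ≤ X := by
    rw [hX, mul_assoc (I.n * H)]; exact Nat.le_mul_of_pos_right _ (by omega)
  have hnX : I.n ≤ X := (Nat.le_mul_of_pos_right _ hH).trans hnH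
  have hμΛ : μ * (H * 64 * Λ) ≤ 1 := by
    rw [hμ, div_mul_eq_mul_div, div_le_one hP0]
    have : ((X : ℕ) : ℝ) ≤ P := by exact_mod_cast hXP.le
    calc (I.n : ℝ) * (H * 64 * Λ) = (X : ℕ) := by rw [hX]; push_cast; ring
      _ ≤ P := this
  have hτμ : ∀ k, ((I.n * c k : ℕ) : ℝ) / P = c k * μ := by
    intro k; rw [hμ]; push_cast; ring
  obtain ⟨⟨a, b, e⟩, hσ⟩ := Sampling.exists_seed (P := P) (n := I.n) (by omega)
    (τ := fun i => I.n * c i)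
    (fun i => ((Nat.mul_le_mul_left _ (hc i)).trans hnH).trans hXP.le) (w := w)
    (fun i hi => hw i fun h => hi (by simp [h]))
    (α := I.pairCharge H Λ c) (β := I.tripleCharge H Λ c) pairCharge_nonneg
    tripleCharge_nonneg pairCharge_self tripleCharge_eq_zero (I.survivors H c)
    (fun S => Finset.filter_subset _ _)
    (fun S i hi hns => one_le_charge hc htot hB hi hns)
    (fun i _ => by
      simp only [hτμ]
      exact sum_charge_le hH hΛ hc hload htot hB (by positivity) hμΛ i)
  refine ⟨P, by rw [hX] at hP2; linarith, a.val, a.val_lt, b.val, b.val_lt, e.val, e.val_lt, ?_⟩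
  have hset : (Finset.univ.filter fun i : Fin I.n =>
      ((a.val * i + b.val) * i + e.val) % P < I.n * c i) =
      Sampling.sample (fun i => I.n * c i) (a, b, e) := by
    ext i
    simp only [Sampling.sample, Finset.mem_filter, Finset.mem_univ, true_and]
    simp only [Sampling.hash]
    rw [← ZMod.val_natCast]
    simp only [Nat.cast_add, Nat.cast_mul, ZMod.natCast_zmod_val]
  rw [hset]
  set Y := ∑ i ∈ I.survivors H c (Sampling.sample (fun i => I.n * c i) (a, b, e)), w i with hY
  simp only [hτμ] at hσ
  have hV : ∑ i, w i * (c i * μ) = (∑ i, w i * c i) * μ := by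
    rw [Finset.sum_mul]; exact Finset.sum_congr rfl fun i _ => by ring
  rw [hV] at hσ
  set V := ∑ i, w i * (c i : ℝ) with hVdef
  have hV0 : 0 ≤ V := Finset.sum_nonneg fun i _ => by
    by_cases h : c i = 0
    · simp [h]
    · exact mul_nonneg (hw i h) (by positivity)
  have hnr : (0 : ℝ) < I.n := by exact_mod_cast hn
  have h1 : V * I.n ≤ 2 * Y * P := by
    rw [hμ] at hσ
    have : 1 / 2 * (V * (I.n / P)) = V * I.n / (2 * P) := by field_simp
    rw [this, div_le_iff₀ (by positivity)] at hσ
    linarith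
  have hY0 : 0 ≤ Y := by
    have : 0 ≤ 2 * Y * P := le_trans (by positivity) h1
    nlinarith
  have hP2r : (P : ℝ) ≤ 2 * (I.n * H * 64 * Λ) := by
    have : ((P : ℕ) : ℝ) ≤ ((2 * X : ℕ) : ℝ) := by exact_mod_cast hP2
    rw [hX] at this; push_cast at this; exact this
  have h2 : V * I.n ≤ (256 * H * Λ * Y) * I.n := by
    calc V * I.n ≤ 2 * Y * P := h1
      _ ≤ 2 * Y * (2 * (I.n * H * 64 * Λ)) := mul_le_mul_of_nonneg_left hP2r (by positivity)
      _ = _ := by ring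
  exact le_of_mul_le_mul_right h2 hnr

end

end PackInstance

/-! ### The program -/

namespace Ram

namespace Term

/-- Comparisons and tests with values `0` and `1`. -/
def le (e f : Term) : Term := lit 1 - lt f e
def eq (e f : Term) : Term := le e f * le f e
def pos (e : Term) : Term := lt (lit 0) e
def no (e : Term) : Term := lit 1 - lt (lit 0) e
/-- The remainder of a division. -/
def rem (e f : Term) : Term := e - e / f * f
/-- A power of two, for an exponent that is at most the parameter `c`. -/
def pow2 (c d : ℕ) (e : Term) : Term := prod c (lit 1 + lt (var d) e)

end Term

open Term

/-- Comparison of two rational numbers, given by arrays of numerators and denominators. -/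
def ratLe (a b : ℕ) (i : Term) (a' b' : ℕ) (k : Term) : Term :=
  le (get a i * get b' k) (get a' k * get b i)

/-- The rectangle `j` contains the point `i`. -/
def insideT (j i : Term) : Term :=
  ratLe 7 8 j 1 2 i * ratLe 1 2 i 9 10 j * (ratLe 11 12 j 3 4 i * ratLe 3 4 i 13 14 j)

/-- The point `k` precedes the point `i`. -/
def beforeT (k i : Term) : Term :=
  no (ratLe 1 2 i 1 2 k) + ratLe 1 2 i 1 2 k * ratLe 1 2 k 1 2 i * lt k i

/-- The load of a rectangle, and of all points. -/
def loadT : Term := sum 1 (insideT (var 2) (var 3) * get 20 (var 3))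
def totalT : Term := sum 1 (get 20 (var 3))

/-- The price of a point. -/
def priceT : Term :=
  sum 2 (insideT (var 3) (var 2) * (get 19 (lit 0) *
    pow2 3 4 (get 21 (var 3) / get 15 (var 3)) / get 15 (var 3))) +
  -- The row of the point alone and the row of all points. Variable 0 counts the energy bounds from
  -- 0, so the current bound is `B = var 0 + 1`; cell 0 of array 19 holds the scaling factor `K`.
  (get 19 (lit 0) * pow2 3 3 (get 20 (var 2)) +
  get 19 (lit 0) * pow2 3 3 (get 22 (lit 0) / (var 0 + lit 1)) / (var 0 + lit 1))

/-- No row is full. -/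
def goT : Term :=
  no (sum 2 (le (par 3 * get 15 (var 3)) (get 21 (var 3))) +
    (sum 1 (le (par 3) (get 20 (var 3))) + le (par 3 * (var 0 + lit 1)) (get 22 (lit 0))))

/-- The point is the first one with the best ratio of price and weight. -/
def selectT : Term :=
  get 24 (lit 0) * (pos (get 18 (var 2)) * no (sum 1 (pos (get 18 (var 3)) *
    -- Ratios are compared by cross multiplication; multiplying by `n` and adding the index breaks
    -- ties in favour of the smaller index.
    lt (par 1 * (get 23 (var 3) * get 18 (var 2)) + var 3)
      (par 1 * (get 23 (var 2) * get 18 (var 3)) + var 2))))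

/-- The block of a point. -/
def blockT : Term := sum 1 (beforeT (var 2) (var 1) * get 20 (var 2)) / par 3

/-- The level of a rectangle. -/
def levelT : Term :=
  sum 6 (pos (sum 1 (sum 1 (insideT (var 1) (var 3) * insideT (var 1) (var 4) *
    lt (get 27 (var 3) / get 28 (var 2)) (get 27 (var 4) / get 28 (var 2))))))

/-- The point is sampled. -/
def sampleT : Term :=
  lt (rem ((var 2 * var 5 + var 3) * var 5 + var 4) (var 1)) (par 1 * get 20 (var 5))

def halfT (j i : Term) : Term := lit 2 * get 27 i / get 30 j

def closerT (j i k : Term) : Term :=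
  eq (halfT j k) (halfT j i) *
    ((lit 1 - rem (halfT j i) (lit 2)) * lt (get 27 i) (get 27 k) +
      rem (halfT j i) (lit 2) * lt (get 27 k) (get 27 i))

/-- The point survives. -/
def surviveT : Term :=
  get 31 (var 5) *
    (no (sum 1 (get 31 (var 6) * (eq (get 27 (var 6)) (get 27 (var 5)) *
      (lit 1 - eq (var 6) (var 5))))) *
    -- For a positive capacity, `cap / 2` plus the truth value of `cap < 2` equals `max 1 (cap /
    -- 2)`.
    no (sum 2 (insideT (var 6) (var 5) * le (get 15 (var 6) / lit 2 + lt (get 15 (var 6)) (lit 2))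
      (sum 1 (get 31 (var 7) * (insideT (var 6) (var 7) * closerT (var 6) (var 5) (var 7)))))))

/-- The survivors have a larger weight than the best set found so far. -/
def improvesT : Term :=
  lt (sum 1 (get 18 (var 6) * get 16 (var 6))) (sum 1 (get 18 (var 6) * get 32 (var 6)))

namespace Cmd

/-- Integer weights. -/
def weights : Cmd :=
  .seq (.arr 17 0 (prod 1 (get 6 (var 1))))
    (.arr 18 1 (get 5 (var 0) * (get 17 (lit 0) / get 6 (var 0))))

/-- One step of the multiplicative weights algorithm. -/
def mwStep : Cmd :=
  .seq (.arr 21 2 loadT) <|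
  .seq (.arr 22 0 totalT) <|
  .seq (.arr 23 1 priceT) <|
  .seq (.arr 24 0 goT) <|
  .seq (.arr 25 1 selectT) <|
  -- A term must not read the array it fills, so array 20 is updated by way of array 26. The
  -- remainders modulo `H + 1` do not change counts that are at most `H`; they are there for the
  -- static size bound. Arrays 34 and 16 below are treated in the same way, modulo 2.
  .seq (.arr 26 1 (mod (get 20 (var 2) + get 25 (var 2)) 3)) <|
  .arr 20 1 (mod (get 26 (var 2)) 3)

/-- Blocks, levels, and the powers of two of the levels. -/
def blocks : Cmd :=
  .seq (.arr 27 1 blockT) <|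
  .seq (.arr 28 6 (pow2 6 2 (var 1))) <|
  .seq (.arr 29 2 levelT) <|
  .arr 30 2 (pow2 6 2 (get 29 (var 1)))

/-- Sample, discard, and keep the result if it is better than the best one found so far. -/
def trySeed : Cmd :=
  .seq (.arr 31 1 sampleT) <|
  .seq (.arr 32 1 surviveT) <|
  .seq (.arr 33 0 improvesT) <|
  .seq (.arr 34 1 (mod (get 33 (lit 0) * get 32 (var 5) +
    (lit 1 - get 33 (lit 0)) * get 16 (var 5)) 0)) <|
  .arr 16 1 (mod (get 34 (var 5)) 0)

/-- Everything that is done for one bound on the energy. -/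
def tryEnergy : Cmd :=
  .seq (.arr 19 0 (var 0 + lit 1 + sum 2 (get 15 (var 2)))) <|
  .seq (.arr 20 1 (lit 0)) <|
  .seq (.rep 4 mwStep) <|
  .seq blocks <|
  -- The modulus and the three coefficients, exhaustively; moduli that are not prime do no harm.
  .rep 5 (.rep 5 (.rep 5 (.rep 5 trySeed)))

/-- The main part of the program. -/
def main : Cmd := .seq weights (.rep 1 tryEnergy)

/-- Arrays are filled from arrays with smaller numbers, or else by remainders, whose exponent is 1.
The slope 60 leaves room for the growth of the exponent within one term. -/
theorem main_ok : main.ok (fun a => 60 * a + 1) 0 = true := by decide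

end Cmd

/-- The parameters: `1`, `n`, `m`, `H = n + m + 1`, `n * H`, a bound for the moduli, and `n + 2`. -/
def params : List Term :=
  let n := get 0 (lit 0)
  let m := get 0 (lit 1)
  let H := n + m + lit 1
  [lit 1, n, m, H, n * H, lit 128 * n * H * (n + lit 1) + lit 1, n + lit 2]

theorem params_ok : ∀ e ∈ params, e.ok (fun b => decide (b < 40)) 0 = true := by decide

/-- The program. -/
def program : Prog := .seq (setPars params 0) (Cmd.main.comp 0)

/-! #### Values of terms -/

namespace Term

section
variable {u : Store} {d : ℕ} {ρ : ℕ → ℤ} {e f : Term}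

theorem eval_le : (le e f).eval u d ρ = if e.eval u d ρ ≤ f.eval u d ρ then 1 else 0 := by
  simp only [le, eval_sub, eval_lit, eval_lt]
  split_ifs <;> omega

theorem eval_eq : (eq e f).eval u d ρ = if e.eval u d ρ = f.eval u d ρ then 1 else 0 := by
  simp only [eq, eval_mul, eval_le]
  split_ifs <;> omega

theorem eval_pos : (pos e).eval u d ρ = if 0 < e.eval u d ρ then 1 else 0 := by
  rfl

theorem eval_no : (no e).eval u d ρ = if 0 < e.eval u d ρ then 0 else 1 := by
  change 1 - (if 0 < e.eval u d ρ then (1 : ℤ) else 0) = _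
  split_ifs <;> rfl

theorem eval_rem {a b : ℕ} (he : e.eval u d ρ = a) (hf : f.eval u d ρ = b) :
    (rem e f).eval u d ρ = (a % b : ℕ) := by
  simp only [rem, eval_sub, eval_mul, eval_div, he, hf]
  push_cast
  rw [Int.emod_def, mul_comm]

theorem eval_sum_eq {c N : ℕ} (hN : u 40 c = N) {F : Fin N → ℤ}
    (h : ∀ i : Fin N, e.eval u (d + 1) (Function.update ρ d ((i : ℕ) : ℤ)) = F i) :
    (sum c e).eval u d ρ = ∑ i, F i := by
  rw [eval_sum, hN, Int.toNat_natCast, Finset.sum_range]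
  exact Finset.sum_congr rfl fun i _ => h i

theorem eval_prod_eq {c N : ℕ} (hN : u 40 c = N) {F : Fin N → ℤ}
    (h : ∀ i : Fin N, e.eval u (d + 1) (Function.update ρ d ((i : ℕ) : ℤ)) = F i) :
    (prod c e).eval u d ρ = ∏ i, F i := by
  rw [eval_prod, hN, Int.toNat_natCast, Finset.prod_range]
  exact Finset.prod_congr rfl fun i _ => h i

/-- The language has no powers with variable exponent. The product over all `k < N` has a factor two
for `k < x` and a factor one otherwise, so it requires an a priori bound `N` for the exponent. -/
theorem eval_pow2 {c N x : ℕ} (hN : u 40 c = N) (hx : x ≤ N)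
    (he : ∀ k : ℤ, e.eval u (d + 1) (Function.update ρ d k) = x) :
    (pow2 c d e).eval u d ρ = (2 ^ x : ℕ) := by
  have h : ∀ k : ℕ, (lit 1 + lt (var d) e).eval u (d + 1) (Function.update ρ d (k : ℤ)) =
      if k < x then 2 else 1 := by
    intro k
    simp only [eval_add, eval_lit, eval_lt, eval_var, Function.update_self, he, Nat.cast_lt]
    split_ifs <;> rfl
  rw [pow2, eval_prod, hN, Int.toNat_natCast, Finset.prod_congr rfl fun k _ => h k,
    Finset.prod_ite, Finset.prod_const, Finset.prod_const_one, mul_one]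
  have : (Finset.range N).filter (· < x) = Finset.range x := by
    ext k; simp only [Finset.mem_filter, Finset.mem_range]; omega
  rw [this, Finset.card_range]
  push_cast; rfl

end

end Term

theorem run_arr {a c N : ℕ} {e : Term} {d : ℕ} {ρ : ℕ → ℤ} {u : Store} (hN : u 40 c = N)
    {F : Fin N → ℤ}
    (h : ∀ i : Fin N, e.eval u (d + 1) (Function.update ρ d ((i : ℕ) : ℤ)) = F i) :
    (∀ b, b ≠ a → (Cmd.arr a c e).run d ρ u b = u b) ∧
      ∀ i : Fin N, (Cmd.arr a c e).run d ρ u a i = F i := by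
  refine ⟨fun b hb => fill_ne _ _ _ hb, fun i => ?_⟩
  rw [Cmd.run, fill_same, if_pos (by rw [hN]; omega)]
  exact h i

end Ram

/-! ### The instance in memory, and the terms of the multiplicative weights step -/

open Ram Ram.Term

namespace PackInstance

variable (I : PackInstance)

/-- The number of rows of the linear program. -/
def rows : ℕ := I.n + I.m + 1

/-- The product of the denominators of the weights. -/
def denom : ℤ := ∏ i, ((I.weight i).den : ℤ)

/-- The weights, scaled to integers. -/
def intWeight (i : Fin I.n) : ℤ := (I.weight i).num * (I.denom / (I.weight i).den)

/-- The memory contains the instance and the parameters. -/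
structure Loaded (u : Store) : Prop where
  par0 : u 40 ((0 : ℕ) : ℤ) = (1 : ℕ)
  par1 : u 40 ((1 : ℕ) : ℤ) = I.n
  par2 : u 40 ((2 : ℕ) : ℤ) = I.m
  par3 : u 40 ((3 : ℕ) : ℤ) = I.rows
  par4 : u 40 ((4 : ℕ) : ℤ) = (I.n * I.rows : ℕ)
  par5 : u 40 ((5 : ℕ) : ℤ) = (128 * I.n * I.rows * (I.n + 1) + 1 : ℕ)
  par6 : u 40 ((6 : ℕ) : ℤ) = (I.n + 2 : ℕ)
  xnum : ∀ i : Fin I.n, u 1 i = (I.point i).1.num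
  xden : ∀ i : Fin I.n, u 2 i = (I.point i).1.den
  ynum : ∀ i : Fin I.n, u 3 i = (I.point i).2.num
  yden : ∀ i : Fin I.n, u 4 i = (I.point i).2.den
  lnum : ∀ j : Fin I.m, u 7 j = (I.rect j).left.num
  lden : ∀ j : Fin I.m, u 8 j = (I.rect j).left.den
  rnum : ∀ j : Fin I.m, u 9 j = (I.rect j).right.num
  rden : ∀ j : Fin I.m, u 10 j = (I.rect j).right.den
  bnum : ∀ j : Fin I.m, u 11 j = (I.rect j).bottom.num
  bden : ∀ j : Fin I.m, u 12 j = (I.rect j).bottom.den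
  tnum : ∀ j : Fin I.m, u 13 j = (I.rect j).top.num
  tden : ∀ j : Fin I.m, u 14 j = (I.rect j).top.den
  cap : ∀ j : Fin I.m, u 15 j = I.cap j

variable {I}

theorem Loaded.congr {u u' : Store} (h : I.Loaded u) (hu : ∀ a, a ≤ 15 ∨ a = 40 → u' a = u a) :
    I.Loaded u' := by
  constructor
  all_goals first
    | (intro i; rw [hu _ (by omega)]; first
        | exact h.xnum i | exact h.xden i | exact h.ynum i | exact h.yden i | exact h.lnum i
        | exact h.lden i | exact h.rnum i | exact h.rden i | exact h.bnum i | exact h.bden i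
        | exact h.tnum i | exact h.tden i | exact h.cap i)
    | (rw [hu _ (by omega)]; first
        | exact h.par0 | exact h.par1 | exact h.par2 | exact h.par3 | exact h.par4 | exact h.par5
        | exact h.par6)

theorem eval_ratLe {u : Store} {a b a' b' d : ℕ} {i k : Term} {ρ : ℕ → ℤ} {p q : ℚ}
    (h1 : u a (i.eval u d ρ) = p.num) (h2 : u b (i.eval u d ρ) = p.den)
    (h3 : u a' (k.eval u d ρ) = q.num) (h4 : u b' (k.eval u d ρ) = q.den) :
    (ratLe a b i a' b' k).eval u d ρ = if p ≤ q then 1 else 0 := by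
  simp only [ratLe, eval_le, eval_mul, eval_get, h1, h2, h3, h4, Rat.le_iff]

theorem ite_mul_ite {p q : Prop} [Decidable p] [Decidable q] :
    (if p then (1 : ℤ) else 0) * (if q then 1 else 0) = if p ∧ q then 1 else 0 := by
  split_ifs <;> simp_all

theorem Loaded.eval_insideT {u : Store} (h : I.Loaded u) {d : ℕ} {ρ : ℕ → ℤ} {s t : Term}
    {j : Fin I.m} {i : Fin I.n} (hj : s.eval u d ρ = (j : ℕ)) (hi : t.eval u d ρ = (i : ℕ)) :
    (insideT s t).eval u d ρ = if i ∈ I.inside j then 1 else 0 := by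
  simp only [insideT, eval_mul]
  rw [eval_ratLe (p := (I.rect j).left) (q := (I.point i).1) (by rw [hj, h.lnum])
      (by rw [hj, h.lden]) (by rw [hi, h.xnum]) (by rw [hi, h.xden]),
    eval_ratLe (p := (I.point i).1) (q := (I.rect j).right) (by rw [hi, h.xnum])
      (by rw [hi, h.xden]) (by rw [hj, h.rnum]) (by rw [hj, h.rden]),
    eval_ratLe (p := (I.rect j).bottom) (q := (I.point i).2) (by rw [hj, h.bnum])
      (by rw [hj, h.bden]) (by rw [hi, h.ynum]) (by rw [hi, h.yden]),
    eval_ratLe (p := (I.point i).2) (q := (I.rect j).top) (by rw [hi, h.ynum])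
      (by rw [hi, h.yden]) (by rw [hj, h.tnum]) (by rw [hj, h.tden]),
    ite_mul_ite, ite_mul_ite, ite_mul_ite]
  simp only [mem_inside, Rect.Contains, and_assoc]

theorem key_lt_key {i k : Fin I.n} : I.key k < I.key i ↔
    ¬ (I.point i).1 ≤ (I.point k).1 ∨
      ((I.point i).1 ≤ (I.point k).1 ∧ (I.point k).1 ≤ (I.point i).1) ∧ k < i := by
  unfold key
  rw [Prod.Lex.toLex_lt_toLex, not_le, ← le_antisymm_iff, eq_comm]

theorem Loaded.eval_beforeT {u : Store} (h : I.Loaded u) {d : ℕ} {ρ : ℕ → ℤ} {s t : Term}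
    {k i : Fin I.n} (hk : s.eval u d ρ = (k : ℕ)) (hi : t.eval u d ρ = (i : ℕ)) :
    (beforeT s t).eval u d ρ = if I.key k < I.key i then 1 else 0 := by
  simp only [beforeT, eval_mul, eval_add, eval_no, eval_lt]
  rw [eval_ratLe (p := (I.point i).1) (q := (I.point k).1) (by rw [hi, h.xnum])
      (by rw [hi, h.xden]) (by rw [hk, h.xnum]) (by rw [hk, h.xden]),
    eval_ratLe (p := (I.point k).1) (q := (I.point i).1) (by rw [hk, h.xnum])
      (by rw [hk, h.xden]) (by rw [hi, h.xnum]) (by rw [hi, h.xden]), hi, hk]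
  simp only [ite_mul_ite, key_lt_key, Nat.cast_lt, Fin.val_fin_lt]
  by_cases h1 : (I.point i).1 ≤ (I.point k).1
  · simp [h1]
  · simp [h1]

theorem sum_ite_pos_iff {n : ℕ} {p : Fin n → Prop} [DecidablePred p] :
    0 < ∑ i, (if p i then (1 : ℤ) else 0) ↔ ∃ i, p i := by
  rw [Finset.sum_boole]
  simp [Finset.card_pos, Finset.filter_nonempty_iff]

/-- The memory holds the numbers `c` in the array `a`. -/
def Holds {n : ℕ} (u : Store) (a : ℕ) (c : Fin n → ℤ) : Prop := ∀ i : Fin n, u a (i : ℕ) = c i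

/-- Rows of the linear program: rectangles, single points, and all points. -/
def row : Fin I.m ⊕ Fin I.n ⊕ Unit → Finset (Fin I.n)
  | .inl j => I.inside j
  | .inr (.inl i) => {i}
  | .inr (.inr _) => Finset.univ

/-- The capacities of the rows. -/
def rowCap (I : PackInstance) (B : ℕ) : Fin I.m ⊕ Fin I.n ⊕ Unit → ℕ
  | .inl j => I.cap j
  | .inr (.inl _) => 1
  | .inr (.inr _) => B

/-- A bound for the capacities. -/
def capSum (I : PackInstance) (B : ℕ) : ℕ := B + ∑ j, I.cap j

open MultWeights

section
variable {u : Store} {c : Fin I.n → ℕ} {B : ℕ} {ρ : ℕ → ℤ}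

theorem Loaded.eval_loadT (h : I.Loaded u) (hc : Holds u 20 fun i => (c i : ℤ)) {j : Fin I.m}
    (hj : ρ 2 = (j : ℕ)) : loadT.eval u 3 ρ = (load (row (I := I)) c (.inl j) : ℕ) := by
  have := eval_sum_eq (u := u) (d := 3) (ρ := ρ) (e := insideT (var 2) (var 3) * get 20 (var 3))
    h.par1 (F := fun i => if i ∈ I.inside j then (c i : ℤ) else 0) fun i => by
      rw [eval_mul, h.eval_insideT (j := j) (i := i) (by simpa [Function.update_apply] using hj)
        (by simp), eval_get, eval_var, Function.update_self, hc]
      simp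
  rw [loadT, this, Finset.sum_ite_mem, Finset.univ_inter]
  simp [load, row]

theorem Loaded.eval_totalT (h : I.Loaded u) (hc : Holds u 20 fun i => (c i : ℤ)) :
    totalT.eval u 3 ρ = (load (row (I := I)) c (.inr (.inr ())) : ℕ) := by
  have := eval_sum_eq (u := u) (d := 3) (ρ := ρ) (e := get 20 (var 3))
    h.par1 (F := fun i => (c i : ℤ)) fun i => by
      rw [eval_get, eval_var, Function.update_self, hc]
  rw [totalT, this]
  simp [load, row]

/-- Loads never exceed `H` times the capacity, so the exponents of the prices are at most `H` and
the bounded products yield the full powers of two. -/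
theorem Loaded.eval_priceT (h : I.Loaded u) {K : ℕ} (hc : Holds u 20 fun i => (c i : ℤ))
    (hK : u 19 0 = K) (hl : Holds u 21 fun j => (load (row (I := I)) c (.inl j) : ℤ))
    (ht : u 22 0 = (load (row (I := I)) c (.inr (.inr ())) : ℕ)) (hB : ρ 0 + 1 = B)
    (hload : ∀ r, load (row (I := I)) c r ≤ I.rows * I.rowCap B r) {i : Fin I.n}
    (hi : ρ 2 = (i : ℕ)) :
    priceT.eval u 3 ρ = (price (row (I := I)) (I.rowCap B) K c i : ℕ) := by
  have h1 := eval_sum_eq (u := u) (d := 3) (ρ := ρ)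
    (e := insideT (var 3) (var 2) * (get 19 (lit 0) *
      pow2 3 4 (get 21 (var 3) / get 15 (var 3)) / get 15 (var 3)))
    h.par2 (F := fun j => ((if i ∈ I.inside j then
      K * 2 ^ (load (row (I := I)) c (.inl j) / I.cap j) / I.cap j else 0 : ℕ) : ℤ)) fun j => by
      rw [eval_mul, h.eval_insideT (j := j) (i := i) (by simp)
        (by simpa [Function.update_apply] using hi), eval_div, eval_mul,
        eval_pow2 (x := load (row (I := I)) c (.inl j) / I.cap j) h.par3
          (Nat.div_le_of_le_mul (by rw [mul_comm]; exact hload (.inl j)))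
          (fun k => by
            simp only [eval_div, eval_get, eval_var, Function.update_apply]
            norm_num
            rw [hl j, h.cap j])]
      simp only [eval_get, eval_lit, eval_var, Function.update_self, hK, h.cap j]
      split_ifs <;> simp
  have h2 : (pow2 3 3 (get 20 (var 2))).eval u 3 ρ = (2 ^ c i : ℕ) :=
    eval_pow2 h.par3 (by simpa [load, row, rowCap] using hload (.inr (.inl i))) fun k => by
      simp only [eval_get, eval_var, Function.update_apply]
      norm_num
      rw [hi, hc i]
  have h3 : (pow2 3 3 (get 22 (lit 0) / (var 0 + lit 1))).eval u 3 ρ =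
      (2 ^ (load (row (I := I)) c (.inr (.inr ())) / B) : ℕ) :=
    eval_pow2 h.par3 (Nat.div_le_of_le_mul (by
      rw [mul_comm]; exact hload (.inr (.inr ())))) fun k => by
      simp only [eval_get, eval_var, eval_div, eval_add, eval_lit, Function.update_apply]
      norm_num
      rw [ht, hB]
  simp only [priceT, eval_add, h1, eval_mul, eval_div, h2, h3, eval_get, eval_lit, hK, eval_var,
    hB, price, Fintype.sum_sum_type]
  simp only [row, rowCap, Finset.mem_singleton, Finset.mem_univ, if_true, Finset.univ_unique,
    Finset.sum_singleton, Finset.sum_ite_eq, Nat.div_one]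
  have e : load (row (I := I)) c (.inr (.inl i)) = c i := by simp [load, row]
  rw [e, Nat.cast_add, Nat.cast_add, Nat.cast_sum]
  simp only [Nat.cast_mul, Int.natCast_ediv]
  rfl

theorem ite_eq_natCast {p q : Prop} [Decidable p] [Decidable q] (h : p ↔ q) :
    (if p then (1 : ℤ) else 0) = if q then 1 else 0 := by
  simp only [h]

open Classical in
theorem Loaded.eval_goT (h : I.Loaded u) (hc : Holds u 20 fun i => (c i : ℤ))
    (hl : Holds u 21 fun j => (load (row (I := I)) c (.inl j) : ℤ))
    (ht : u 22 0 = (load (row (I := I)) c (.inr (.inr ())) : ℕ)) (hB : ρ 0 + 1 = B) :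
    goT.eval u 3 ρ = if Stopped (row (I := I)) (I.rowCap B) I.rows c then 0 else 1 := by
  have h1 := eval_sum_eq (u := u) (d := 3) (ρ := ρ)
    (e := le (par 3 * get 15 (var 3)) (get 21 (var 3)))
    h.par2 (F := fun j => if I.rows * I.cap j ≤ load (row (I := I)) c (.inl j) then 1 else 0)
    fun j => by
      rw [eval_le]
      refine ite_eq_natCast ?_
      simp only [eval_mul, eval_par, eval_get, eval_var, Function.update_self]
      rw [h.par3, h.cap j, hl j, ← Nat.cast_mul]
      exact Nat.cast_le
  have h2 := eval_sum_eq (u := u) (d := 3) (ρ := ρ) (e := le (par 3) (get 20 (var 3)))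
    h.par1 (F := fun i => if I.rows ≤ c i then 1 else 0) fun i => by
      rw [eval_le]
      refine ite_eq_natCast ?_
      simp only [eval_par, eval_get, eval_var, Function.update_self]
      rw [h.par3, hc i]
      exact Nat.cast_le
  have h3 : (le (par 3 * (var 0 + lit 1)) (get 22 (lit 0))).eval u 3 ρ =
      if I.rows * B ≤ load (row (I := I)) c (.inr (.inr ())) then 1 else 0 := by
    rw [eval_le]
    refine ite_eq_natCast ?_
    simp only [eval_mul, eval_add, eval_par, eval_get, eval_var, eval_lit]
    rw [h.par3, hB, ht]
    exact_mod_cast Iff.rfl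
  rw [goT, eval_no, eval_add, eval_add, h1, h2, h3]
  have e : ∀ i, load (row (I := I)) c (.inr (.inl i)) = c i := fun i => by simp [load, row]
  have e3 : (0 < (if I.rows * B ≤ load (row (I := I)) c (.inr (.inr ())) then (1 : ℤ) else 0)) ↔
      I.rows * B ≤ load (row (I := I)) c (.inr (.inr ())) := by split_ifs <;> simp_all
  have p1 : 0 ≤ ∑ j, (if I.rows * I.cap j ≤ load (row (I := I)) c (.inl j) then (1 : ℤ) else 0) :=
    Finset.sum_nonneg fun _ _ => by split_ifs <;> simp
  have p2 : 0 ≤ ∑ i, (if I.rows ≤ c i then (1 : ℤ) else 0) :=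
    Finset.sum_nonneg fun _ _ => by split_ifs <;> simp
  have p3 : 0 ≤ (if I.rows * B ≤ load (row (I := I)) c (.inr (.inr ())) then (1 : ℤ) else 0) := by
    split_ifs <;> simp
  have q1 := sum_ite_pos_iff (p := fun j => I.rows * I.cap j ≤ load (row (I := I)) c (.inl j))
  have q2 := sum_ite_pos_iff (p := fun i => I.rows ≤ c i)
  congr 1
  simp only [Stopped, Sum.exists, e, rowCap, mul_one, Unique.exists_iff, eq_iff_iff]
  rw [← q1, ← q2]
  refine Iff.trans ?_ (or_congr_right (or_congr_right e3))
  constructor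
  · intro; by_contra hh; push Not at hh; omega
  · rintro (_ | _ | _) <;> omega

end

end PackInstance

/-! ### Choosing a best column deterministically -/

open MultWeights

/-- The chosen index minimizes the pair of ratio and index lexicographically. As cross products are
integers and indices are less than `n`, the single integer comparison of `selectT` encodes this
order, and exactly one index passes the test. -/
theorem exists_unique_best {n : ℕ} (p : Fin n → ℕ) (w : Fin n → ℤ) (hw : ∃ i, 0 < w i) :
    ∃ i₀, 0 < w i₀ ∧ (∀ k, 0 < w k → (p i₀ : ℤ) * w k ≤ p k * w i₀) ∧
      ∀ i, (0 < w i ∧ ¬ ∃ k, 0 < w k ∧ (n : ℤ) * (p k * w i) + k < n * (p i * w k) + i) ↔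
        i = i₀ := by
  let f : Fin n → ℚ ×ₗ Fin n := fun i => toLex ((p i : ℚ) / w i, i)
  have hlt : ∀ i k, 0 < w i → 0 < w k →
      ((n : ℤ) * (p k * w i) + k < n * (p i * w k) + i ↔ f k < f i) := by
    intro i k hi hk
    have hi' : (0 : ℚ) < w i := by exact_mod_cast hi
    have hk' : (0 : ℚ) < w k := by exact_mod_cast hk
    have hin := i.2
    have hkn := k.2
    rw [Prod.Lex.toLex_lt_toLex, div_lt_div_iff₀ hk' hi', div_eq_div_iff hk'.ne' hi'.ne']
    have e1 : (p k : ℚ) * w i < p i * w k ↔ (p k : ℤ) * w i < p i * w k := by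
      exact_mod_cast Iff.rfl
    have e2 : (p k : ℚ) * w i = p i * w k ↔ (p k : ℤ) * w i = p i * w k := by
      exact_mod_cast Iff.rfl
    rw [e1, e2]
    rcases lt_trichotomy ((p k : ℤ) * w i) (p i * w k) with h | h | h
    · simp only [h, true_or, iff_true]
      nlinarith
    · simp only [h, lt_irrefl, true_and, false_or]
      rw [← Fin.val_fin_lt]
      omega
    · simp only [h.ne', not_lt.mpr h.le, false_and, or_self, iff_false, not_lt]
      nlinarith
  obtain ⟨i₀, hi₀, hmin⟩ := Finset.exists_min_image (Finset.univ.filter fun i => 0 < w i) f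
    (by obtain ⟨i, hi⟩ := hw; exact ⟨i, by simpa using hi⟩)
  simp only [Finset.mem_filter, Finset.mem_univ, true_and] at hi₀ hmin
  refine ⟨i₀, hi₀, fun k hk => ?_, fun i => ⟨fun ⟨hi, h⟩ => ?_, ?_⟩⟩
  · have h := hmin k hk
    have hi' : (0 : ℚ) < w i₀ := by exact_mod_cast hi₀
    have hk' : (0 : ℚ) < w k := by exact_mod_cast hk
    have h1 : (p i₀ : ℚ) / w i₀ ≤ p k / w k := by
      rcases Prod.Lex.toLex_le_toLex.mp h with h | h
      · exact h.le
      · exact h.1.le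
    rw [div_le_div_iff₀ hi' hk'] at h1
    exact_mod_cast h1
  · have h1 : ¬ f i₀ < f i := fun hf => h ⟨i₀, hi₀, (hlt i i₀ hi hi₀).mpr hf⟩
    have h2 : f i = f i₀ := le_antisymm (not_lt.mp h1) (hmin i hi)
    exact congrArg Prod.snd (toLex.injective h2)
  · rintro rfl
    refine ⟨hi₀, fun ⟨k, hk, h⟩ => ?_⟩
    exact absurd ((hlt i k hi₀ hk).mp h) (not_lt.mpr (hmin k hk))

/-! ### The multiplicative weights loop in memory -/

namespace PackInstance

variable {I : PackInstance} {u : Store} {ρ : ℕ → ℤ}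

open Classical in
theorem Loaded.eval_selectT (h : I.Loaded u) {w : Fin I.n → ℤ} {p : Fin I.n → ℕ} {g : ℤ}
    (hg : u 24 0 = g) (hw : Holds u 18 w) (hp : Holds u 23 fun i => (p i : ℤ)) {i : Fin I.n}
    (hi : ρ 2 = (i : ℕ)) : selectT.eval u 3 ρ = g * if 0 < w i ∧ ¬ ∃ k : Fin I.n, 0 < w k ∧
      (I.n : ℤ) * (p k * w i) + (k : ℕ) < I.n * (p i * w k) + (i : ℕ) then 1 else 0 := by
  have h1 := eval_sum_eq (u := u) (d := 3) (ρ := ρ)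
    (e := pos (get 18 (var 3)) * lt (par 1 * (get 23 (var 3) * get 18 (var 2)) + var 3)
      (par 1 * (get 23 (var 2) * get 18 (var 3)) + var 2))
    h.par1 (F := fun k => if 0 < w k ∧
      (I.n : ℤ) * (p k * w i) + (k : ℕ) < I.n * (p i * w k) + (i : ℕ) then 1 else 0) fun k => by
      have e : Function.update ρ 3 ((k : ℕ) : ℤ) 2 = (i : ℕ) := by
        rw [Function.update_of_ne (by omega), hi]
      simp only [eval_mul, eval_pos, eval_lt, eval_add, eval_par, eval_get, eval_var,
        Function.update_self, e]
      rw [h.par1, hp k, hp i, hw k, hw i, ite_mul_ite]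
  simp only [selectT, eval_mul, eval_get, eval_lit, hg, eval_pos, eval_no, h1, eval_var, hi]
  rw [hw i]
  congr 1
  by_cases hw1 : 0 < w i
  · by_cases hk : ∃ k : Fin I.n, 0 < w k ∧
      (I.n : ℤ) * (p k * w i) + (k : ℕ) < I.n * (p i * w k) + (i : ℕ)
    · rw [if_pos hw1, if_pos (sum_ite_pos_iff.mpr hk), if_neg (fun hh => hh.2 hk)]; rfl
    · rw [if_pos hw1, if_neg (fun hh => hk (sum_ite_pos_iff.mp hh)), if_pos ⟨hw1, hk⟩]; rfl
  · rw [if_neg hw1, zero_mul, if_neg (fun hh => hw1 hh.1)]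

theorem Holds.congr {n a : ℕ} {u u' : Store} {c : Fin n → ℤ} (h : Holds u a c)
    (hu : u' a = u a) : Holds u' a c := fun i => by rw [hu]; exact h i

/-- The result of filling an array. -/
theorem holds_run_arr {a c d N : ℕ} {e : Term} {F : Fin N → ℤ} (hN : u 40 c = N)
    (h : ∀ i : Fin N, e.eval u (d + 1) (Function.update ρ d ((i : ℕ) : ℤ)) = F i) :
    Holds ((Cmd.arr a c e).run d ρ u) a F := (run_arr hN h).2

theorem run_arr_ne {a b c d : ℕ} {e : Term} (hb : b ≠ a) :
    (Cmd.arr a c e).run d ρ u b = u b := fill_ne _ _ _ hb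

theorem run_arr_one {a d : ℕ} {e : Term} {x : ℤ} (h : I.Loaded u)
    (he : e.eval u (d + 1) (Function.update ρ d 0) = x) :
    (Cmd.arr a 0 e).run d ρ u a 0 = x := by
  have := holds_run_arr (a := a) (e := e) (ρ := ρ) (d := d) (N := 1) (F := fun _ => x) h.par0
    (by rw [Fin.forall_fin_one]; exact he)
  exact this 0

theorem mwStep_ne {d : ℕ} {a : ℕ} (h1 : a < 20 ∨ 26 < a) :
    Cmd.mwStep.run d ρ u a = u a := by
  simp only [Cmd.mwStep, Cmd.run]
  rw [fill_ne _ _ _ (by omega), fill_ne _ _ _ (by omega), fill_ne _ _ _ (by omega),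
    fill_ne _ _ _ (by omega), fill_ne _ _ _ (by omega), fill_ne _ _ _ (by omega),
    fill_ne _ _ _ (by omega)]

theorem emod_natCast (x : ℤ) (y : ℕ) : ∃ z : ℕ, x % (y + 1 : ℤ) = z ∧ z ≤ y := by
  have h1 := Int.emod_nonneg x (b := (y : ℤ) + 1) (by omega)
  have h2 := Int.emod_lt_of_pos x (b := (y : ℤ) + 1) (by omega)
  exact ⟨(x % (y + 1 : ℤ)).toNat, by omega, by omega⟩

/-- Makes no assumption on weights or loads: the final remainder alone keeps the counts at most `H`.
This is all that `card_survivors_le` needs, so the output respects the relaxed capacities even if no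
weight is positive. -/
theorem Loaded.mwStep_bound (h : I.Loaded u) {d : ℕ} : ∃ c : Fin I.n → ℕ,
    Holds (Cmd.mwStep.run d ρ u) 20 (fun i => (c i : ℤ)) ∧ ∀ i, c i ≤ I.rows := by
  simp only [Cmd.mwStep]
  simp only [Cmd.run.eq_2]
  generalize hu' : (Cmd.arr 26 1 _).run d ρ _ = u'
  have h' : I.Loaded u' := h.congr fun a ha => by
    subst hu'
    simp only [Cmd.run]
    rw [fill_ne _ _ _ (by omega), fill_ne _ _ _ (by omega), fill_ne _ _ _ (by omega),
      fill_ne _ _ _ (by omega), fill_ne _ _ _ (by omega), fill_ne _ _ _ (by omega)]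
  have key : ∀ i : Fin I.n, ∃ c : ℕ, (mod (get 26 (var 2)) 3).eval u' (d + 1)
      (Function.update ρ d ((i : ℕ) : ℤ)) = c ∧ c ≤ I.rows := by
    intro i
    obtain ⟨c, h1, h2⟩ := emod_natCast ((get 26 (var 2)).eval u' (d + 1)
      (Function.update ρ d ((i : ℕ) : ℤ))) I.rows
    exact ⟨c, by rw [eval_mod, show u' 40 (3 : ℕ) = I.rows from h'.par3, h1], h2⟩
  choose c hc hcle using key
  exact ⟨c, holds_run_arr h'.par1 hc, hcle⟩

theorem Loaded.mwStep_spec (h : I.Loaded u) {w : Fin I.n → ℤ} {c : Fin I.n → ℕ} {B K : ℕ}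
    (hw : Holds u 18 w) (hpos : ∃ i, 0 < w i) (hc : Holds u 20 fun i => (c i : ℤ))
    (hK : u 19 0 = K) (hB : ρ 0 + 1 = B)
    (hload : ∀ r, load (row (I := I)) c r ≤ I.rows * I.rowCap B r) :
    ∃ c', Holds (Cmd.mwStep.run 2 ρ u) 20 (fun i => (c' i : ℤ)) ∧
      Step (row (I := I)) (I.rowCap B) K I.rows w c c' := by
  classical
  have r0 : ∀ x : ℤ, Function.update ρ 2 x 0 + 1 = B := fun x => by
    rw [Function.update_of_ne (by omega), hB]
  have hl := fun (u' : Store) (hu' : ∀ a, a < 20 ∨ 26 < a → u' a = u a) =>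
    h.congr (u' := u') fun a ha => hu' a (by omega)
  simp only [Cmd.mwStep, Cmd.run.eq_2]
  obtain ⟨u1, hu1⟩ : ∃ u1, u1 = (Cmd.arr 21 2 loadT).run 2 ρ u := ⟨_, rfl⟩
  obtain ⟨u2, hu2⟩ : ∃ u2, u2 = (Cmd.arr 22 0 totalT).run 2 ρ u1 := ⟨_, rfl⟩
  obtain ⟨u3, hu3⟩ : ∃ u3, u3 = (Cmd.arr 23 1 priceT).run 2 ρ u2 := ⟨_, rfl⟩
  obtain ⟨u4, hu4⟩ : ∃ u4, u4 = (Cmd.arr 24 0 goT).run 2 ρ u3 := ⟨_, rfl⟩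
  obtain ⟨u5, hu5⟩ : ∃ u5, u5 = (Cmd.arr 25 1 selectT).run 2 ρ u4 := ⟨_, rfl⟩
  obtain ⟨u6, hu6⟩ : ∃ u6, u6 =
    (Cmd.arr 26 1 (mod (get 20 (var 2) + get 25 (var 2)) 3)).run 2 ρ u5 := ⟨_, rfl⟩
  rw [← hu1, ← hu2, ← hu3, ← hu4, ← hu5, ← hu6]
  have n1 : ∀ a, a ≠ 21 → u1 a = u a := fun a ha => by rw [hu1, run_arr_ne ha]
  have n2 : ∀ a, a ≠ 22 → u2 a = u1 a := fun a ha => by rw [hu2, run_arr_ne ha]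
  have n3 : ∀ a, a ≠ 23 → u3 a = u2 a := fun a ha => by rw [hu3, run_arr_ne ha]
  have n4 : ∀ a, a ≠ 24 → u4 a = u3 a := fun a ha => by rw [hu4, run_arr_ne ha]
  have n5 : ∀ a, a ≠ 25 → u5 a = u4 a := fun a ha => by rw [hu5, run_arr_ne ha]
  have n6 : ∀ a, a ≠ 26 → u6 a = u5 a := fun a ha => by rw [hu6, run_arr_ne ha]
  have l1 : I.Loaded u1 := h.congr fun a ha => n1 a (by omega)
  have l2 : I.Loaded u2 := l1.congr fun a ha => n2 a (by omega)
  have l3 : I.Loaded u3 := l2.congr fun a ha => n3 a (by omega)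
  have l4 : I.Loaded u4 := l3.congr fun a ha => n4 a (by omega)
  have l5 : I.Loaded u5 := l4.congr fun a ha => n5 a (by omega)
  have l6 : I.Loaded u6 := l5.congr fun a ha => n6 a (by omega)
  have c1 := hc.congr (n1 20 (by omega))
  have c2 := c1.congr (n2 20 (by omega))
  have c3 := c2.congr (n3 20 (by omega))
  have c4 := c3.congr (n4 20 (by omega))
  have c5 := c4.congr (n5 20 (by omega))
  have w4 : Holds u4 18 w := (((hw.congr (n1 18 (by omega))).congr (n2 18 (by omega))).congr
    (n3 18 (by omega))).congr (n4 18 (by omega))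
  have L1 : Holds u1 21 fun j => (load (row (I := I)) c (.inl j) : ℤ) := by
    rw [hu1]
    exact holds_run_arr h.par2 fun j => h.eval_loadT hc (by simp)
  have L2 := L1.congr (n2 21 (by omega))
  have L3 := L2.congr (n3 21 (by omega))
  have T2 : u2 22 0 = (load (row (I := I)) c (.inr (.inr ())) : ℕ) := by
    rw [hu2]
    exact run_arr_one l1 (l1.eval_totalT c1)
  have T3 : u3 22 0 = (load (row (I := I)) c (.inr (.inr ())) : ℕ) := by
    rw [n3 22 (by omega), T2]
  have K2 : u2 19 0 = K := by rw [n2 19 (by omega), n1 19 (by omega), hK]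
  have P3 : Holds u3 23 fun i => (price (row (I := I)) (I.rowCap B) K c i : ℤ) := by
    rw [hu3]
    exact holds_run_arr l2.par1 fun i => l2.eval_priceT c2 K2 L2 T2 (r0 _) hload (by simp)
  have P4 := P3.congr (n4 23 (by omega))
  have G4 : u4 24 0 = if Stopped (row (I := I)) (I.rowCap B) I.rows c then 0 else 1 := by
    rw [hu4]
    exact run_arr_one l3 (l3.eval_goT c3 L3 T3 (r0 _))
  obtain ⟨i₀, hi₀, hbest, hsel⟩ := exists_unique_best
    (fun i => price (row (I := I)) (I.rowCap B) K c i) w hpos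
  set g : ℕ := if Stopped (row (I := I)) (I.rowCap B) I.rows c then 0 else 1 with hg
  have S5 : Holds u5 25 fun i => ((g * if i = i₀ then 1 else 0 : ℕ) : ℤ) := by
    rw [hu5]
    refine holds_run_arr l4.par1 fun i => ?_
    have hg4 : u4 24 0 = (g : ℤ) := by rw [G4, hg]; split_ifs <;> rfl
    rw [l4.eval_selectT hg4 w4 P4 (i := i) (by simp), Nat.cast_mul]
    congr 1
    by_cases hii : i = i₀
    · rw [if_pos hii, if_pos ((hsel i).mpr hii)]; rfl
    · rw [if_neg hii, if_neg (fun hh => hii ((hsel i).mp hh))]; rfl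
  -- The remainders are harmless: a count increases only while its own row is not full.
  have hle : ∀ i, c i + (g * if i = i₀ then 1 else 0) ≤ I.rows := by
    intro i
    have h1 : c i ≤ I.rows := by simpa [load, row, rowCap] using hload (.inr (.inl i))
    rw [hg]
    by_cases hs : Stopped (row (I := I)) (I.rowCap B) I.rows c
    · simp [hs, h1]
    · have h2 : c i < I.rows := by
        by_contra hlt
        exact hs ⟨.inr (.inl i), by simpa [load, row, rowCap] using hlt⟩
      split_ifs <;> omega
  have md : ∀ x : ℕ, x ≤ I.rows → (x : ℤ) % ((I.rows : ℤ) + 1) = x := fun x hx => by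
    rw [Int.emod_eq_of_lt (by omega) (by omega)]
  have S6 : Holds u6 26 fun i => ((c i + g * if i = i₀ then 1 else 0 : ℕ) : ℤ) := by
    rw [hu6]
    refine holds_run_arr l5.par1 fun i => ?_
    rw [eval_mod, show u5 40 (3 : ℕ) = I.rows from l5.par3, eval_add, eval_get, eval_get, eval_var,
      Function.update_self, c5 i, S5 i, ← Nat.cast_add]
    exact md _ (hle i)
  refine ⟨fun i => c i + g * if i = i₀ then 1 else 0, holds_run_arr l6.par1 fun i => ?_,
    fun hs => ?_, fun hs => ⟨i₀, ⟨hi₀, hbest⟩, ?_⟩⟩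
  · rw [eval_mod, show u6 40 (3 : ℕ) = I.rows from l6.par3, eval_get, eval_var,
      Function.update_self, S6 i]
    exact md _ (hle i)
  · funext i; simp [hg, hs]
  · funext i
    by_cases hii : i = i₀
    · subst hii; simp [hg, hs]
    · simp [hii]

/-- The result of the multiplicative weights algorithm. -/
theorem Loaded.mwLoop_spec (h : I.Loaded u) {w : Fin I.n → ℤ} {B K : ℕ}
    (hw : Holds u 18 w) (hpos : ∃ i, 0 < w i) (hc : Holds (n := I.n) u 20 fun _ => 0)
    (hK : u 19 0 = K) (hB : ρ 0 + 1 = B) :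
    ∃ c : ℕ → Fin I.n → ℕ, c 0 = 0 ∧ (∀ t < I.n * I.rows,
      Step (row (I := I)) (I.rowCap B) K I.rows w (c t) (c (t + 1))) ∧
      Holds ((Cmd.rep 4 Cmd.mwStep).run 1 ρ u) 20 fun i => (c (I.n * I.rows) i : ℤ) := by
  have := Cmd.run_rep_induction (c := 4) (d := 1) (p := Cmd.mwStep) (ρ := ρ) (u := u)
    (fun k st => (∀ a, a < 20 ∨ 26 < a → st a = u a) ∧ ∃ c : ℕ → Fin I.n → ℕ, c 0 = 0 ∧
      (∀ t < k, Step (row (I := I)) (I.rowCap B) K I.rows w (c t) (c (t + 1))) ∧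
      Holds st 20 fun i => (c k i : ℤ)) h.par4
    ⟨fun _ _ => rfl, fun _ => 0, rfl, fun t ht => absurd ht (by omega), fun i => by
      simpa using hc i⟩ ?_
  · exact this.2
  · rintro k _ st ⟨hst, c, hc0, hstep, hck⟩
    have hL : I.Loaded st := h.congr fun a ha => hst a (by omega)
    obtain ⟨c', h1, h2⟩ := hL.mwStep_spec (ρ := Function.update ρ 1 ((k : ℕ) : ℤ)) (K := K)
      (hw.congr (hst 18 (by omega))) hpos hck (by rw [hst 19 (by omega), hK])
      (by rw [Function.update_of_ne (by omega), hB]) (load_le_of_steps hc0 hstep k le_rfl)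
    refine ⟨fun a ha => by rw [mwStep_ne ha, hst a ha],
      fun t => if t ≤ k then c t else c', ?_, fun t ht => ?_, ?_⟩
    · simp [hc0]
    · rcases Nat.lt_succ_iff_lt_or_eq.mp ht with hlt | rfl
      · simp only [hlt.le, if_true, Nat.succ_le_of_lt hlt]
        exact hstep t hlt
      · simpa using h2
    · simpa using h1

theorem mwLoop_ne (h : I.Loaded u) {a : ℕ} (h1 : a < 20 ∨ 26 < a) :
    (Cmd.rep 4 Cmd.mwStep).run 1 ρ u a = u a :=
  Cmd.run_rep_preserves (fun st => st a = u a)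
    (by rw [show u 40 (4 : ℕ) = _ from h.par4]; omega) rfl fun k st hst => by
    rw [mwStep_ne h1, hst]

theorem Loaded.mwLoop_bound (h : I.Loaded u) (hc : Holds (n := I.n) u 20 fun _ => 0) :
    ∃ c : Fin I.n → ℕ, Holds ((Cmd.rep 4 Cmd.mwStep).run 1 ρ u) 20 (fun i => (c i : ℤ)) ∧
      ∀ i, c i ≤ I.rows := by
  have := Cmd.run_rep_preserves (c := 4) (d := 1) (p := Cmd.mwStep) (ρ := ρ) (u := u)
    (fun st => (∀ a, a < 20 ∨ 26 < a → st a = u a) ∧ ∃ c : Fin I.n → ℕ,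
      Holds st 20 (fun i => (c i : ℤ)) ∧ ∀ i, c i ≤ I.rows)
    (by rw [h.par4]; omega) ⟨fun _ _ => rfl, fun _ => 0, fun i => by simpa using hc i, by simp⟩
    fun k st ⟨hst, _⟩ => ⟨fun a ha => by rw [mwStep_ne ha, hst a ha],
      (h.congr fun a ha => hst a (by omega) : I.Loaded st).mwStep_bound⟩
  exact this.2

end PackInstance

/-- The number `x` is the truth value of `p`. -/
def TruthValue (x : ℤ) (p : Prop) : Prop := (p → x = 1) ∧ (¬ p → x = 0)

namespace TruthValue

variable {x y : ℤ} {p q : Prop}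

theorem of_ite [Decidable p] : TruthValue (if p then 1 else 0) p := ⟨fun h => if_pos h, fun h => if_neg h⟩

theorem eq_ite [Decidable p] (h : TruthValue x p) : x = if p then 1 else 0 := by
  split_ifs with hp
  · exact h.1 hp
  · exact h.2 hp

theorem congr (h : TruthValue x p) (hpq : p ↔ q) : TruthValue x q := by
  rwa [TruthValue, ← hpq]

theorem mul (h : TruthValue x p) (h' : TruthValue y q) : TruthValue (x * y) (p ∧ q) := by
  refine ⟨fun ⟨hp, hq⟩ => by rw [h.1 hp, h'.1 hq]; rfl, fun hn => ?_⟩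
  by_cases hp : p
  · rw [h'.2 fun hq => hn ⟨hp, hq⟩, mul_zero]
  · rw [h.2 hp, zero_mul]

theorem sum_pos_iff {n : ℕ} {F : Fin n → ℤ} {p : Fin n → Prop} (h : ∀ i, TruthValue (F i) (p i)) :
    0 < ∑ i, F i ↔ ∃ i, p i := by
  classical
  rw [Finset.sum_congr rfl fun i _ => (h i).eq_ite, PackInstance.sum_ite_pos_iff]

theorem nonneg (h : TruthValue x p) : 0 ≤ x := by
  by_cases hp : p
  · rw [h.1 hp]; exact zero_le_one
  · rw [h.2 hp]

theorem sum_sum_pos_iff {n : ℕ} {F : Fin n → Fin n → ℤ} {p : Fin n → Fin n → Prop}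
    (h : ∀ i k, TruthValue (F i k) (p i k)) : 0 < ∑ i, ∑ k, F i k ↔ ∃ i k, p i k := by
  have h0 : ∀ i, 0 ≤ ∑ k, F i k := fun i => Finset.sum_nonneg fun k _ => (h i k).nonneg
  rw [Finset.sum_pos_iff_of_nonneg fun i _ => h0 i]
  simp only [Finset.mem_univ, true_and, sum_pos_iff (h _)]

theorem sum_eq_card {n : ℕ} {F : Fin n → ℤ} {p : Fin n → Prop} [DecidablePred p]
    (h : ∀ i, TruthValue (F i) (p i)) : ∑ i, F i = ((Finset.univ.filter p).card : ℤ) := by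
  rw [Finset.sum_congr rfl fun i _ => (h i).eq_ite, Finset.sum_boole]

end TruthValue

/-! ### Blocks, levels, samples and survivors in memory -/

namespace PackInstance

variable {I : PackInstance} {u : Store} {ρ : ℕ → ℤ}

theorem eval_no_sum {e : Term} {c N d : ℕ} {p : Fin N → Prop} (hN : u 40 c = N)
    (h : ∀ i : Fin N, TruthValue (e.eval u (d + 1) (Function.update ρ d ((i : ℕ) : ℤ))) (p i)) :
    TruthValue ((no (sum c e)).eval u d ρ) (¬ ∃ i, p i) := by
  rw [eval_no, eval_sum_eq hN fun i => rfl]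
  have := TruthValue.sum_pos_iff h
  exact ⟨fun hn => if_neg fun h => hn (this.mp h), fun hn => if_pos (this.mpr (not_not.mp hn))⟩

theorem Loaded.truth_insideT (h : I.Loaded u) {d : ℕ} {s t : Term}
    {j : Fin I.m} {i : Fin I.n} (hj : s.eval u d ρ = (j : ℕ)) (hi : t.eval u d ρ = (i : ℕ)) :
    TruthValue ((insideT s t).eval u d ρ) (i ∈ I.inside j) := by
  rw [h.eval_insideT hj hi]
  exact TruthValue.of_ite

/-- The memory contains the blocks and the levels. -/
structure BlocksLoaded (I : PackInstance) (c : Fin I.n → ℕ) (u : Store) : Prop where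
  count : Holds u 20 fun i => (c i : ℤ)
  block : Holds u 27 fun i => (I.blk I.rows c i : ℤ)
  level : Holds u 30 fun j => (2 ^ I.lev I.rows c j : ℕ)

theorem lev_le_add_two {H : ℕ} {c : Fin I.n → ℕ} (j : Fin I.m) : I.lev H c j ≤ I.n + 2 :=
  (Finset.card_filter_le _ _).trans_eq (Finset.card_range _)

theorem blocks_ne {d a : ℕ} (h : a < 27 ∨ 30 < a) : Cmd.blocks.run d ρ u a = u a := by
  simp only [Cmd.blocks, Cmd.run]
  rw [fill_ne _ _ _ (by omega), fill_ne _ _ _ (by omega), fill_ne _ _ _ (by omega),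
    fill_ne _ _ _ (by omega)]

theorem Loaded.blocks_spec (h : I.Loaded u) {c : Fin I.n → ℕ}
    (hc : Holds u 20 fun i => (c i : ℤ)) : I.BlocksLoaded c (Cmd.blocks.run 1 ρ u) := by
  suffices h : Holds (Cmd.blocks.run 1 ρ u) 27 (fun i => (I.blk I.rows c i : ℤ)) ∧
      Holds (Cmd.blocks.run 1 ρ u) 30 (fun j => (2 ^ I.lev I.rows c j : ℕ)) from
    ⟨hc.congr (blocks_ne (by omega)), h.1, h.2⟩
  simp only [Cmd.blocks, Cmd.run.eq_2]
  obtain ⟨u1, hu1⟩ : ∃ u1, u1 = (Cmd.arr 27 1 blockT).run 1 ρ u := ⟨_, rfl⟩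
  obtain ⟨u2, hu2⟩ : ∃ u2, u2 = (Cmd.arr 28 6 (pow2 6 2 (var 1))).run 1 ρ u1 := ⟨_, rfl⟩
  obtain ⟨u3, hu3⟩ : ∃ u3, u3 = (Cmd.arr 29 2 levelT).run 1 ρ u2 := ⟨_, rfl⟩
  obtain ⟨u4, hu4⟩ : ∃ u4, u4 = (Cmd.arr 30 2 (pow2 6 2 (get 29 (var 1)))).run 1 ρ u3 := ⟨_, rfl⟩
  rw [← hu1, ← hu2, ← hu3, ← hu4]
  have n1 : ∀ a, a ≠ 27 → u1 a = u a := fun a ha => by rw [hu1, run_arr_ne ha]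
  have n2 : ∀ a, a ≠ 28 → u2 a = u1 a := fun a ha => by rw [hu2, run_arr_ne ha]
  have n3 : ∀ a, a ≠ 29 → u3 a = u2 a := fun a ha => by rw [hu3, run_arr_ne ha]
  have n4 : ∀ a, a ≠ 30 → u4 a = u3 a := fun a ha => by rw [hu4, run_arr_ne ha]
  have l1 : I.Loaded u1 := h.congr fun a ha => n1 a (by omega)
  have l2 : I.Loaded u2 := l1.congr fun a ha => n2 a (by omega)
  have l3 : I.Loaded u3 := l2.congr fun a ha => n3 a (by omega)
  have B1 : Holds u1 27 fun i => (I.blk I.rows c i : ℤ) := by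
    rw [hu1]
    refine holds_run_arr h.par1 fun i => ?_
    have e := eval_sum_eq (u := u) (d := 2) (ρ := Function.update ρ 1 ((i : ℕ) : ℤ))
      (e := beforeT (var 2) (var 1) * get 20 (var 2)) h.par1
      (F := fun k => ((if I.key k < I.key i then c k else 0 : ℕ) : ℤ)) fun k => by
        rw [eval_mul, h.eval_beforeT (k := k) (i := i) (by simp) (by simp),
          eval_get, eval_var, Function.update_self, hc k]
        split_ifs <;> simp
    simp only [blockT, eval_div, eval_par]
    rw [e, show u 40 (3 : ℕ) = I.rows from h.par3, ← Nat.cast_sum, ← Int.natCast_ediv]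
    rfl
  have B2 := B1.congr (n2 27 (by omega))
  have P2 : ∀ l : Fin (I.n + 2), u2 28 (l : ℕ) = (2 ^ (l : ℕ) : ℕ) := by
    rw [hu2]
    exact holds_run_arr (F := fun l => ((2 ^ (l : ℕ) : ℕ) : ℤ)) l1.par6 fun l =>
      eval_pow2 l1.par6 l.2.le fun k => by simp
  have L3 : Holds u3 29 fun j => (I.lev I.rows c j : ℤ) := by
    rw [hu3]
    refine holds_run_arr l2.par2 fun j => ?_
    rw [levelT, eval_sum_eq l2.par6 fun _ => rfl,
      TruthValue.sum_eq_card (p := fun l : Fin (I.n + 2) => I.Splits I.rows c j l) fun l => ?_]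
    · rw [lev, Finset.card_filter, Finset.card_filter, Finset.sum_range]
    · rw [eval_pos, eval_sum_eq l2.par1 fun i => eval_sum_eq l2.par1 fun k => rfl]
      refine TruthValue.of_ite.congr ((TruthValue.sum_sum_pos_iff (p := fun i k =>
        (i ∈ I.inside j ∧ k ∈ I.inside j) ∧
        I.blk I.rows c i / 2 ^ (l : ℕ) < I.blk I.rows c k / 2 ^ (l : ℕ)) fun i k => ?_).trans ?_)
      · rw [eval_mul, eval_mul]
        refine ((l2.truth_insideT ?_ ?_).mul (l2.truth_insideT ?_ ?_)).mul ?_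
        any_goals simp; done
        rw [eval_lt]
        refine TruthValue.of_ite.congr ?_
        simp only [eval_div, eval_get, eval_var, Function.update_apply]
        norm_num
        rw [B2 i, B2 k, P2 l, ← Int.natCast_ediv, ← Int.natCast_ediv]
        exact Nat.cast_lt
      · simp only [Splits]
        grind
  refine ⟨B2.congr ((n4 27 (by omega)).trans (n3 27 (by omega))), ?_⟩
  rw [hu4]
  refine holds_run_arr l3.par2 fun j => ?_
  exact eval_pow2 l3.par6 (lev_le_add_two j) fun k => by
    simp only [eval_get, eval_var, Function.update_apply]
    norm_num
    exact L3 j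

/-- The sample that belongs to a seed. -/
def sample (c : Fin I.n → ℕ) (P a b e : ℕ) : Finset (Fin I.n) :=
  Finset.univ.filter fun i => ((a * i + b) * i + e) % P < I.n * c i

/-- The memory holds the set `S` in the array `a`. -/
def HoldsSet (u : Store) (a : ℕ) (S : Finset (Fin I.n)) : Prop :=
  ∀ i : Fin I.n, TruthValue (u a (i : ℕ)) (i ∈ S)

theorem HoldsSet.congr {a : ℕ} {u u' : Store} {S : Finset (Fin I.n)} (h : HoldsSet u a S)
    (hu : u' a = u a) : HoldsSet u' a S := fun i => by rw [hu]; exact h i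

theorem holdsSet_run_arr {a c d : ℕ} {e : Term} {S : Finset (Fin I.n)} (hN : u 40 c = I.n)
    (h : ∀ i : Fin I.n,
      TruthValue (e.eval u (d + 1) (Function.update ρ d ((i : ℕ) : ℤ))) (i ∈ S)) :
    HoldsSet ((Cmd.arr a c e).run d ρ u) a S := fun i => by
  rw [holds_run_arr hN (fun i => rfl) i]
  exact h i

theorem Loaded.truth_sampleT (h : I.Loaded u) {c : Fin I.n → ℕ} {P a b e : ℕ}
    (hc : Holds u 20 fun i => (c i : ℤ)) (h1 : ρ 1 = P) (h2 : ρ 2 = a) (h3 : ρ 3 = b)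
    (h4 : ρ 4 = e) {i : Fin I.n} (h5 : ρ 5 = (i : ℕ)) {d : ℕ} :
    TruthValue (sampleT.eval u d ρ) (i ∈ sample c P a b e) := by
  rw [sampleT, eval_lt, eval_rem (a := (a * i + b) * i + e) (b := P)
    (by simp [h2, h3, h4, h5]) (by simp [h1])]
  refine TruthValue.of_ite.congr ?_
  simp only [eval_mul, eval_par, eval_get, eval_var, h5]
  rw [show u 40 (1 : ℕ) = I.n from h.par1, hc i, ← Nat.cast_mul, Nat.cast_lt]
  simp [sample]

theorem BlocksLoaded.eval_halfT {c : Fin I.n → ℕ} (h : I.BlocksLoaded c u) {d : ℕ} {s t : Term}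
    {j : Fin I.m} {i : Fin I.n} (hj : s.eval u d ρ = (j : ℕ)) (hi : t.eval u d ρ = (i : ℕ)) :
    (halfT s t).eval u d ρ = (I.half I.rows c j i : ℕ) := by
  simp only [halfT, eval_div, eval_mul, eval_lit, eval_get, hj, hi, half]
  rw [h.block i, h.level j]
  push_cast
  rfl

theorem BlocksLoaded.truth_closerT {c : Fin I.n → ℕ} (h : I.BlocksLoaded c u) {d : ℕ}
    {s t r : Term} {j : Fin I.m} {i k : Fin I.n} (hj : s.eval u d ρ = (j : ℕ))
    (hi : t.eval u d ρ = (i : ℕ)) (hk : r.eval u d ρ = (k : ℕ)) :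
    TruthValue ((closerT s t r).eval u d ρ) (I.Closer I.rows c j i k) := by
  simp only [closerT, eval_mul, eval_add, eval_sub]
  rw [eval_rem (b := 2) (h.eval_halfT hj hi) rfl, eval_eq, h.eval_halfT hj hi, h.eval_halfT hj hk]
  refine TruthValue.mul (TruthValue.of_ite.congr Nat.cast_inj) ?_
  simp only [eval_lt, eval_get, eval_lit, hi, hk]
  rw [h.block i, h.block k]
  rcases Nat.mod_two_eq_zero_or_one (I.half I.rows c j i) with h2 | h2
  · rw [h2, if_pos rfl]
    simp only [Nat.cast_zero, sub_zero, one_mul, zero_mul, add_zero]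
    exact TruthValue.of_ite.congr Nat.cast_lt
  · rw [h2, if_neg one_ne_zero]
    simp only [Nat.cast_one, sub_self, one_mul, zero_mul, zero_add]
    exact TruthValue.of_ite.congr Nat.cast_lt

theorem BlocksLoaded.truth_surviveT {c : Fin I.n → ℕ} (hL : I.Loaded u) (h : I.BlocksLoaded c u)
    {S : Finset (Fin I.n)} (hS : HoldsSet u 31 S) {i : Fin I.n} (hi : ρ 5 = (i : ℕ)) :
    TruthValue (surviveT.eval u 6 ρ) (i ∈ I.survivors I.rows c S) := by
  rw [surviveT, eval_mul, eval_mul]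
  refine TruthValue.congr (TruthValue.mul (by simpa [hi] using hS i) (TruthValue.mul
    (eval_no_sum (p := fun k => k ∈ S ∧ I.blk I.rows c k = I.blk I.rows c i ∧ k ≠ i)
      hL.par1 fun k => ?_)
    (eval_no_sum (p := fun j => i ∈ I.inside j ∧
      I.halfCap j ≤ ((S ∩ I.inside j).filter (I.Closer I.rows c j i)).card) hL.par2 fun j => ?_))) ?_
  · have e5 : Function.update ρ 6 ((k : ℕ) : ℤ) 5 = (i : ℕ) := by
      rw [Function.update_of_ne (by omega), hi]
    rw [eval_mul, eval_mul]
    refine TruthValue.mul (by simpa using hS k) (TruthValue.mul ?_ ?_)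
    · rw [eval_eq]
      simp only [eval_get, eval_var, Function.update_self, e5]
      rw [h.block i, h.block k]
      exact TruthValue.of_ite.congr Nat.cast_inj
    · rw [eval_sub, eval_eq, eval_var, eval_var, Function.update_self, e5, eval_lit]
      refine ⟨fun hne => ?_, fun heq => ?_⟩
      · rw [if_neg (by rwa [Nat.cast_inj, Fin.val_inj])]; rfl
      · rw [if_pos (by rw [not_not.mp heq])]; rfl
  · have e5 : Function.update ρ 6 ((j : ℕ) : ℤ) 5 = (i : ℕ) := by
      rw [Function.update_of_ne (by omega), hi]
    rw [eval_mul]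
    refine TruthValue.mul (hL.truth_insideT (by simp) (by simpa using e5)) ?_
    rw [eval_le, eval_sum_eq hL.par1 fun k => rfl,
      TruthValue.sum_eq_card (p := fun k => k ∈ S ∧ k ∈ I.inside j ∧ I.Closer I.rows c j i k)
        fun k => ?_]
    · refine TruthValue.of_ite.congr ?_
      have e1 : (get 15 (var 6) / lit 2 + lt (get 15 (var 6)) (lit 2)).eval u 7
          (Function.update ρ 6 ((j : ℕ) : ℤ)) = (I.halfCap j : ℕ) := by
        simp only [eval_add, eval_div, eval_lt, eval_get, eval_var, eval_lit, Function.update_self]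
        rw [hL.cap j, halfCap]
        have := I.one_le_cap j
        split_ifs <;> omega
      rw [e1, Nat.cast_le]
      have e2 : (S ∩ I.inside j).filter (I.Closer I.rows c j i) = Finset.univ.filter fun k =>
          k ∈ S ∧ k ∈ I.inside j ∧ I.Closer I.rows c j i k := by
        ext k; simp [and_assoc]
      rw [e2]
    · rw [eval_mul, eval_mul]
      refine TruthValue.mul (by simpa using hS k) (TruthValue.mul (hL.truth_insideT ?_ ?_)
        (h.truth_closerT ?_ ?_ ?_))
      any_goals simp; done
      simpa using hi
  · simp only [survivors, Finset.mem_filter, not_exists, not_and, not_le, ne_eq, not_not]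

theorem eval_setWeight (h : I.Loaded u) {w : Fin I.n → ℤ} {a : ℕ} {S : Finset (Fin I.n)}
    (hw : Holds u 18 w) (hS : HoldsSet u a S) :
    (sum 1 (get 18 (var 6) * get a (var 6))).eval u 6 ρ = ∑ i ∈ S, w i := by
  classical
  rw [eval_sum_eq (F := fun i => if i ∈ S then w i else 0) h.par1 fun i => ?_,
    Finset.sum_ite_mem, Finset.univ_inter]
  rw [eval_mul, eval_get, eval_get, eval_var, Function.update_self, hw i, (hS i).eq_ite, mul_ite,
    mul_one, mul_zero]

theorem trySeed_ne {d a : ℕ} (h : a ≠ 16 ∧ (a < 31 ∨ 34 < a)) :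
    Cmd.trySeed.run d ρ u a = u a := by
  simp only [Cmd.trySeed, Cmd.run]
  rw [fill_ne _ _ _ (by omega), fill_ne _ _ _ (by omega), fill_ne _ _ _ (by omega),
    fill_ne _ _ _ (by omega), fill_ne _ _ _ (by omega)]

theorem Loaded.trySeed_spec (h : I.Loaded u) {w : Fin I.n → ℤ} {c : Fin I.n → ℕ}
    (hb : I.BlocksLoaded c u) (hw : Holds u 18 w) {O : Finset (Fin I.n)} (hO : HoldsSet u 16 O)
    {P a b e : ℕ} (h1 : ρ 1 = P) (h2 : ρ 2 = a) (h3 : ρ 3 = b) (h4 : ρ 4 = e) :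
    HoldsSet (Cmd.trySeed.run 5 ρ u) 16
      (if ∑ i ∈ O, w i < ∑ i ∈ I.survivors I.rows c (sample c P a b e), w i
        then I.survivors I.rows c (sample c P a b e) else O) := by
  set S := sample c P a b e
  simp only [Cmd.trySeed, Cmd.run.eq_2]
  obtain ⟨u1, hu1⟩ : ∃ u1, u1 = (Cmd.arr 31 1 sampleT).run 5 ρ u := ⟨_, rfl⟩
  obtain ⟨u2, hu2⟩ : ∃ u2, u2 = (Cmd.arr 32 1 surviveT).run 5 ρ u1 := ⟨_, rfl⟩
  obtain ⟨u3, hu3⟩ : ∃ u3, u3 = (Cmd.arr 33 0 improvesT).run 5 ρ u2 := ⟨_, rfl⟩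
  obtain ⟨u4, hu4⟩ : ∃ u4, u4 = (Cmd.arr 34 1 (mod (get 33 (lit 0) * get 32 (var 5) +
    (lit 1 - get 33 (lit 0)) * get 16 (var 5)) 0)).run 5 ρ u3 := ⟨_, rfl⟩
  rw [← hu1, ← hu2, ← hu3, ← hu4]
  have n1 : ∀ a, a ≠ 31 → u1 a = u a := fun a ha => by rw [hu1, run_arr_ne ha]
  have n2 : ∀ a, a ≠ 32 → u2 a = u1 a := fun a ha => by rw [hu2, run_arr_ne ha]
  have n3 : ∀ a, a ≠ 33 → u3 a = u2 a := fun a ha => by rw [hu3, run_arr_ne ha]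
  have n4 : ∀ a, a ≠ 34 → u4 a = u3 a := fun a ha => by rw [hu4, run_arr_ne ha]
  have l1 : I.Loaded u1 := h.congr fun a ha => n1 a (by omega)
  have l2 : I.Loaded u2 := l1.congr fun a ha => n2 a (by omega)
  have l3 : I.Loaded u3 := l2.congr fun a ha => n3 a (by omega)
  have l4 : I.Loaded u4 := l3.congr fun a ha => n4 a (by omega)
  have b1 : I.BlocksLoaded c u1 := ⟨hb.count.congr (n1 _ (by omega)),
    hb.block.congr (n1 _ (by omega)), hb.level.congr (n1 _ (by omega))⟩
  have S1 : HoldsSet u1 31 S := by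
    rw [hu1]
    refine holdsSet_run_arr h.par1 fun i => h.truth_sampleT hb.count ?_ ?_ ?_ ?_ ?_
    exacts [by simpa using h1, by simpa using h2, by simpa using h3, by simpa using h4, by simp]
  have S2 : HoldsSet u2 32 (I.survivors I.rows c S) := by
    rw [hu2]
    exact holdsSet_run_arr l1.par1 fun i => b1.truth_surviveT l1 S1 (by simp)
  have w2 : Holds u2 18 w := (hw.congr (n1 18 (by omega))).congr (n2 18 (by omega))
  have O2 : HoldsSet u2 16 O := (hO.congr (n1 16 (by omega))).congr (n2 16 (by omega))
  set g := ∑ i ∈ O, w i < ∑ i ∈ I.survivors I.rows c S, w i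
  have G3 : u3 33 0 = if g then 1 else 0 := by
    rw [hu3]
    refine run_arr_one l2 ?_
    rw [improvesT, eval_lt, eval_setWeight l2 w2 O2, eval_setWeight l2 w2 S2]
  have S3 := S2.congr (n3 32 (by omega))
  have O3 := O2.congr (n3 16 (by omega))
  have md : ∀ {x : ℤ} {p : Prop}, TruthValue x p → TruthValue (x % (1 + 1)) p := by
    intro x p hx
    refine ⟨fun hp => ?_, fun hp => ?_⟩
    · rw [hx.1 hp]; rfl
    · rw [hx.2 hp]; rfl
  have O4 : HoldsSet u4 34 (if g then I.survivors I.rows c S else O) := by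
    rw [hu4]
    refine holdsSet_run_arr l3.par1 fun i => ?_
    rw [eval_mod, show u3 40 (0 : ℕ) = 1 from l3.par0]
    refine md ?_
    simp only [eval_add, eval_mul, eval_sub, eval_get, eval_lit, eval_var, Function.update_self, G3]
    by_cases hg : g
    · simpa [hg] using S3 i
    · simpa [hg] using O3 i
  refine holdsSet_run_arr l4.par1 fun i => ?_
  rw [eval_mod, show u4 40 (0 : ℕ) = 1 from l4.par0]
  refine md ?_
  simpa using O4 i

end PackInstance

/-! ### The search over seeds and energy bounds -/

namespace PackInstance

variable {I : PackInstance} {u : Store} {ρ : ℕ → ℤ}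

/-- The memory holds an almost feasible set of weight at least `v`. -/
def HoldsBest (I : PackInstance) (w : Fin I.n → ℤ) (v : ℤ) (u : Store) : Prop :=
  ∃ O : Finset (Fin I.n), HoldsSet u 16 O ∧ (∀ j, (O ∩ I.inside j).card ≤ max (I.cap j) 2) ∧
    v ≤ ∑ i ∈ O, w i

/-- The survivors of any sample respect the relaxed capacities, whatever the modulus, and the stored
set is replaced only by a heavier one. So a lower bound for its weight, once attained, persists, and
the weight obtained from each single seed bounds the final weight from below. -/
theorem seeds_spec (h : I.Loaded u) {w : Fin I.n → ℤ} {c : Fin I.n → ℕ}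
    (hb : I.BlocksLoaded c u) (hw : Holds u 18 w) (hc : ∀ i, c i ≤ I.rows) {v₀ : ℤ}
    (hv : I.HoldsBest w v₀ u) {st : Store}
    (hst : st = (Cmd.rep 5 (.rep 5 (.rep 5 (.rep 5 Cmd.trySeed)))).run 1 ρ u) :
    (∀ a, a ≠ 16 ∧ (a < 31 ∨ 34 < a) → st a = u a) ∧ I.HoldsBest w v₀ st ∧
      ∀ P a b e : ℕ, P < 128 * I.n * I.rows * (I.n + 1) + 1 → a < P → b < P → e < P →
        I.HoldsBest w (∑ i ∈ I.survivors I.rows c (sample c P a b e), w i) st := by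
  subst hst
  set Inv : ℤ → Store → Prop := fun v st =>
    (∀ a, a ≠ 16 ∧ (a < 31 ∨ 34 < a) → st a = u a) ∧ I.HoldsBest w v st with hInv
  have par : ∀ {v st}, Inv v st → 0 ≤ st 40 (5 : ℕ) := fun hs => by
    rw [hs.1 40 (by omega), h.par5]; omega
  have base : ∀ (v : ℤ) (P a b e : ℕ) (ρ : ℕ → ℤ), ρ 1 = P → ρ 2 = a → ρ 3 = b → ρ 4 = e →
      ∀ st, Inv v st → Inv v (Cmd.trySeed.run 5 ρ st) ∧
        Inv (∑ i ∈ I.survivors I.rows c (sample c P a b e), w i) (Cmd.trySeed.run 5 ρ st) := by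
    rintro v P a b e ρ h1 h2 h3 h4 st ⟨hs, O, hO, hn, hvO⟩
    have hL : I.Loaded st := h.congr fun a ha => hs a (by omega)
    have hB : I.BlocksLoaded c st := ⟨hb.count.congr (hs _ (by omega)),
      hb.block.congr (hs _ (by omega)), hb.level.congr (hs _ (by omega))⟩
    have key := hL.trySeed_spec hB (hw.congr (hs _ (by omega))) hO h1 h2 h3 h4
    have hne : ∀ a, a ≠ 16 ∧ (a < 31 ∨ 34 < a) → Cmd.trySeed.run 5 ρ st a = u a := fun a ha => by
      rw [trySeed_ne ha, hs a ha]
    set T := I.survivors I.rows c (sample c P a b e)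
    have hT := card_survivors_le hc (sample c P a b e)
    by_cases hlt : ∑ i ∈ O, w i < ∑ i ∈ T, w i
    · rw [if_pos hlt] at key
      exact ⟨⟨hne, T, key, hT, by omega⟩, ⟨hne, T, key, hT, le_rfl⟩⟩
    · rw [if_neg hlt] at key
      exact ⟨⟨hne, O, key, hn, hvO⟩, ⟨hne, O, key, hn, by omega⟩⟩
  have p4 : ∀ (v : ℤ) (P a b : ℕ) (ρ : ℕ → ℤ), ρ 1 = P → ρ 2 = a → ρ 3 = b →
      ∀ st, Inv v st → Inv v ((Cmd.rep 5 Cmd.trySeed).run 4 ρ st) := by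
    intro v P a b ρ h1 h2 h3 st hs
    refine Cmd.run_rep_preserves (Inv v) (par hs) hs fun k st hs => ?_
    refine (base v P a b k _ ?_ ?_ ?_ ?_ st hs).1
    exacts [by simpa using h1, by simpa using h2, by simpa using h3, by simp]
  have p3 : ∀ (v : ℤ) (P a : ℕ) (ρ : ℕ → ℤ), ρ 1 = P → ρ 2 = a →
      ∀ st, Inv v st → Inv v ((Cmd.rep 5 (.rep 5 Cmd.trySeed)).run 3 ρ st) := by
    intro v P a ρ h1 h2 st hs
    refine Cmd.run_rep_preserves (Inv v) (par hs) hs fun k st hs => ?_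
    refine p4 v P a k _ ?_ ?_ ?_ st hs
    exacts [by simpa using h1, by simpa using h2, by simp]
  have p2 : ∀ (v : ℤ) (P : ℕ) (ρ : ℕ → ℤ), ρ 1 = P →
      ∀ st, Inv v st → Inv v ((Cmd.rep 5 (.rep 5 (.rep 5 Cmd.trySeed))).run 2 ρ st) := by
    intro v P ρ h1 st hs
    refine Cmd.run_rep_preserves (Inv v) (par hs) hs fun k st hs => ?_
    refine p3 v P k _ ?_ ?_ st hs
    exacts [by simpa using h1, by simp]
  have p1 : ∀ v st, Inv v st →
      Inv v ((Cmd.rep 5 (.rep 5 (.rep 5 (.rep 5 Cmd.trySeed)))).run 1 ρ st) := by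
    intro v st hs
    refine Cmd.run_rep_preserves (Inv v) (par hs) hs fun k st hs => ?_
    exact p2 v k _ (by simp) st hs
  have h0 : Inv v₀ u := ⟨fun _ _ => rfl, hv⟩
  refine ⟨(p1 v₀ u h0).1, (p1 v₀ u h0).2, fun P a b e hP ha hb' he => ?_⟩
  have lt : ∀ {v st} {k : ℕ}, k ≤ P → Inv v st → (k : ℤ) < st 40 (5 : ℕ) := fun hk hs => by
    rw [hs.1 40 (by omega), h.par5]; exact_mod_cast hk.trans_lt hP
  set v := ∑ i ∈ I.survivors I.rows c (sample c P a b e), w i with hvdef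
  suffices Inv v ((Cmd.rep 5 (.rep 5 (.rep 5 (.rep 5 Cmd.trySeed)))).run 1 ρ u) from this.2
  -- The nested loops are followed to the rounds `P`, `a`, `b`, `e`, in which the seed is tried; the
  -- remaining rounds preserve what was reached.
  refine Cmd.run_rep_reaches (Inv v₀) (Inv v) (lt le_rfl h0) h0
    (fun k st hs => p2 v₀ k _ (by simp) st hs) (fun k st _ hs => p2 v k _ (by simp) st hs)
    fun st hs => ?_
  refine Cmd.run_rep_reaches (Inv v₀) (Inv v) (lt ha.le hs) hs
    (fun k st hs => p3 v₀ P k _ (by simp) (by simp) st hs)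
    (fun k st _ hs => p3 v P k _ (by simp) (by simp) st hs) fun st hs => ?_
  refine Cmd.run_rep_reaches (Inv v₀) (Inv v) (lt hb'.le hs) hs
    (fun k st hs => p4 v₀ P a k _ (by simp) (by simp) (by simp) st hs)
    (fun k st _ hs => p4 v P a k _ (by simp) (by simp) (by simp) st hs) fun st hs => ?_
  exact Cmd.run_rep_reaches (Inv v₀) (Inv v) (lt he.le hs) hs
    (fun k st hs => (base v₀ P a b k _ (by simp) (by simp) (by simp) (by simp) st hs).1)
    (fun k st _ hs => (base v P a b k _ (by simp) (by simp) (by simp) (by simp) st hs).1)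
    fun st hs => (base v₀ P a b e _ (by simp) (by simp) (by simp) (by simp) st hs).2

/-- The numbers that the multiplicative weights algorithm can compute. -/
def IsCount (I : PackInstance) (w : Fin I.n → ℤ) (B : ℕ) (c : ℕ → Fin I.n → ℕ) : Prop :=
  c 0 = 0 ∧ ∀ t < I.n * I.rows,
    Step (row (I := I)) (I.rowCap B) (I.capSum B) I.rows w (c t) (c (t + 1))

/-- Without a positive weight there is no best column and the counts are not identified with a run
of the algorithm; then only the bound from `mwLoop_bound` is used, and the stored set does not get
worse. -/
theorem tryEnergy_spec (h : I.Loaded u) {w : Fin I.n → ℤ} (hw : Holds u 18 w) {v₀ : ℤ}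
    (hv : I.HoldsBest w v₀ u) {k : ℕ} (hρ : ρ 0 = k) {st : Store}
    (hst : st = Cmd.tryEnergy.run 1 ρ u) :
    (∀ a, a < 16 ∨ a = 18 ∨ 34 < a → st a = u a) ∧ I.HoldsBest w v₀ st ∧
      ((∃ i, 0 < w i) → ∃ c, I.IsCount w (k + 1) c ∧ ∀ P a b e : ℕ,
        P < 128 * I.n * I.rows * (I.n + 1) + 1 → a < P → b < P → e < P →
        I.HoldsBest w (∑ i ∈ I.survivors I.rows (c (I.n * I.rows))
          (sample (c (I.n * I.rows)) P a b e), w i) st) := by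
  simp only [Cmd.tryEnergy, Cmd.run.eq_2] at hst
  obtain ⟨u1, hu1⟩ : ∃ u1, u1 = (Cmd.arr 19 0 (var 0 + lit 1 + sum 2 (get 15 (var 2)))).run 1 ρ u :=
    ⟨_, rfl⟩
  obtain ⟨u2, hu2⟩ : ∃ u2, u2 = (Cmd.arr 20 1 (lit 0)).run 1 ρ u1 := ⟨_, rfl⟩
  obtain ⟨u3, hu3⟩ : ∃ u3, u3 = (Cmd.rep 4 Cmd.mwStep).run 1 ρ u2 := ⟨_, rfl⟩
  obtain ⟨u4, hu4⟩ : ∃ u4, u4 = Cmd.blocks.run 1 ρ u3 := ⟨_, rfl⟩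
  rw [← hu1, ← hu2, ← hu3, ← hu4] at hst
  have n1 : ∀ a, a ≠ 19 → u1 a = u a := fun a ha => by rw [hu1, run_arr_ne ha]
  have n2 : ∀ a, a ≠ 20 → u2 a = u1 a := fun a ha => by rw [hu2, run_arr_ne ha]
  have l1 : I.Loaded u1 := h.congr fun a ha => n1 a (by omega)
  have l2 : I.Loaded u2 := l1.congr fun a ha => n2 a (by omega)
  have n3 : ∀ a, a < 20 ∨ 26 < a → u3 a = u2 a := fun a ha => by rw [hu3, mwLoop_ne l2 ha]
  have l3 : I.Loaded u3 := l2.congr fun a ha => n3 a (by omega)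
  have n4 : ∀ a, a < 27 ∨ 30 < a → u4 a = u3 a := fun a ha => by rw [hu4, blocks_ne ha]
  have l4 : I.Loaded u4 := l3.congr fun a ha => n4 a (by omega)
  have n : ∀ a, a < 19 ∨ 30 < a → u4 a = u a := fun a ha => by
    rw [n4 a (by omega), n3 a (by omega), n2 a (by omega), n1 a (by omega)]
  have c2 : Holds (n := I.n) u2 20 fun _ => 0 := by
    rw [hu2]
    exact holds_run_arr l1.par1 fun i => rfl
  have K2 : u2 19 0 = (I.capSum (k + 1) : ℕ) := by
    rw [n2 19 (by omega), hu1]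
    refine run_arr_one h ?_
    rw [eval_add, eval_add, eval_sum_eq (F := fun j => (I.cap j : ℤ)) h.par2 fun j => by
      rw [eval_get, eval_var, Function.update_self, h.cap j]]
    simp [capSum, hρ]
  have w2 : Holds u2 18 w := hw.congr (by rw [n2 18 (by omega), n1 18 (by omega)])
  have w4 : Holds u4 18 w := hw.congr (n 18 (by omega))
  have v4 : I.HoldsBest w v₀ u4 := by
    obtain ⟨O, hO, hh⟩ := hv
    exact ⟨O, hO.congr (n 16 (by omega)), hh⟩
  obtain ⟨c, hc, hcle⟩ := l2.mwLoop_bound (ρ := ρ) c2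
  rw [← hu3] at hc
  have hblk : ∀ c, Holds u3 20 (fun i => (c i : ℤ)) → I.BlocksLoaded c u4 := fun c hc => by
    rw [hu4]; exact l3.blocks_spec hc
  obtain ⟨s1, s2, -⟩ := seeds_spec l4 (hblk c hc) w4 hcle v4 hst
  refine ⟨fun a ha => by rw [s1 a (by omega), n a (by omega)], s2, fun hpos => ?_⟩
  obtain ⟨c', hc0, hstep, hc'⟩ := l2.mwLoop_spec (ρ := ρ) w2 hpos c2 K2
    (B := k + 1) (by rw [hρ]; push_cast; rfl)
  rw [← hu3] at hc'
  have hle : ∀ i, c' (I.n * I.rows) i ≤ I.rows := fun i => by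
    have := load_le_of_steps hc0 hstep _ le_rfl (.inr (.inl i))
    simpa [load, row, rowCap] using this
  exact ⟨c', ⟨hc0, hstep⟩, (seeds_spec l4 (hblk _ hc') w4 hle v4 hst).2.2⟩

theorem weights_ne {a d : ℕ} (h : a ≠ 17 ∧ a ≠ 18) : Cmd.weights.run d ρ u a = u a := by
  simp only [Cmd.weights, Cmd.run]
  rw [fill_ne _ _ _ h.2, fill_ne _ _ _ h.1]

theorem Loaded.weights_spec (h : I.Loaded u) (h5 : Holds u 5 fun i => (I.weight i).num)
    (h6 : Holds u 6 fun i => ((I.weight i).den : ℤ)) :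
    Holds (Cmd.weights.run 0 ρ u) 18 I.intWeight := by
  simp only [Cmd.weights, Cmd.run.eq_2]
  obtain ⟨u1, hu1⟩ : ∃ u1, u1 = (Cmd.arr 17 0 (prod 1 (get 6 (var 1)))).run 0 ρ u := ⟨_, rfl⟩
  rw [← hu1]
  have n1 : ∀ a, a ≠ 17 → u1 a = u a := fun a ha => by rw [hu1, run_arr_ne ha]
  have l1 : I.Loaded u1 := h.congr fun a ha => n1 a (by omega)
  have D1 : u1 17 0 = I.denom := by
    rw [hu1]
    refine run_arr_one h ?_
    rw [eval_prod_eq (F := fun i => ((I.weight i).den : ℤ)) h.par1 fun i => by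
      rw [eval_get, eval_var, Function.update_self, h6 i]]
    rfl
  refine holds_run_arr l1.par1 fun i => ?_
  simp only [eval_mul, eval_div, eval_get, eval_var, eval_lit, Function.update_self, D1, intWeight]
  rw [n1 5 (by omega), n1 6 (by omega), h5 i, h6 i]

/-- Energy bounds up to `n` suffice, since every `x i` is at most one. The search starts from the
empty set, so the stored weight is never negative. -/
theorem main_spec (h : I.Loaded u) (h5 : Holds u 5 fun i => (I.weight i).num)
    (h6 : Holds u 6 fun i => ((I.weight i).den : ℤ)) (h16 : HoldsSet (I := I) u 16 ∅) {st : Store}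
    (hst : st = Cmd.main.run 0 ρ u) :
    I.HoldsBest I.intWeight 0 st ∧ ((∃ i, 0 < I.intWeight i) → ∀ B, 1 ≤ B → B ≤ I.n →
      ∃ c, I.IsCount I.intWeight B c ∧ ∀ P a b e : ℕ,
        P < 128 * I.n * I.rows * (I.n + 1) + 1 → a < P → b < P → e < P →
        I.HoldsBest I.intWeight (∑ i ∈ I.survivors I.rows (c (I.n * I.rows))
          (sample (c (I.n * I.rows)) P a b e), I.intWeight i) st) := by
  rw [Cmd.main, Cmd.run.eq_2] at hst
  obtain ⟨u1, hu1⟩ : ∃ u1, u1 = Cmd.weights.run 0 ρ u := ⟨_, rfl⟩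
  rw [← hu1] at hst
  have n1 : ∀ a, a ≠ 17 ∧ a ≠ 18 → u1 a = u a := fun a ha => by rw [hu1, weights_ne ha]
  have l1 : I.Loaded u1 := h.congr fun a ha => n1 a (by omega)
  have w1 : Holds u1 18 I.intWeight := by
    rw [hu1]
    exact h.weights_spec h5 h6
  set Inv : ℤ → Store → Prop := fun v st =>
    (∀ a, a < 16 ∨ a = 18 ∨ 34 < a → st a = u1 a) ∧ I.HoldsBest I.intWeight v st with hInv
  have h0 : Inv 0 u1 := ⟨fun _ _ => rfl, ∅, h16.congr (n1 16 (by omega)), by simp, by simp⟩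
  have base : ∀ (k : ℕ) (v : ℤ) (st : Store), Inv v st →
      Inv v (Cmd.tryEnergy.run 1 (Function.update ρ 0 (k : ℤ)) st) := by
    rintro k v st ⟨hs, hv⟩
    have hl : I.Loaded st := l1.congr fun a ha => hs a (by omega)
    have := tryEnergy_spec (ρ := Function.update ρ 0 (k : ℤ)) hl (w1.congr (hs 18 (by omega))) hv
      (k := k) (by simp) rfl
    exact ⟨fun a ha => by rw [this.1 a ha, hs a ha], this.2.1⟩
  refine ⟨?_, fun hpos B hB hBn => ?_⟩
  · have := Cmd.run_rep_preserves (c := 1) (d := 0) (ρ := ρ) (u := u1) (Inv 0)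
      (by rw [l1.par1]; omega) h0 fun k st hs => base k 0 st hs
    rw [hst]
    exact this.2
  · obtain ⟨k, rfl⟩ : ∃ k, B = k + 1 := ⟨B - 1, by omega⟩
    set Q : Store → Prop := fun st => ∃ c, I.IsCount I.intWeight (k + 1) c ∧ ∀ P a b e : ℕ,
        P < 128 * I.n * I.rows * (I.n + 1) + 1 → a < P → b < P → e < P →
        Inv (∑ i ∈ I.survivors I.rows (c (I.n * I.rows))
          (sample (c (I.n * I.rows)) P a b e), I.intWeight i) st with hQ
    have := Cmd.run_rep_reaches (c := 1) (d := 0) (ρ := ρ) (u := u1) (p := Cmd.tryEnergy)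
      (k₀ := k) (Inv 0) Q (by rw [l1.par1]; omega) h0 (fun k st hs => base k 0 st hs)
      (fun k st _ ⟨c, hc, hq⟩ => ⟨c, hc, fun P a b e h1 h2 h3 h4 =>
        base k _ st (hq P a b e h1 h2 h3 h4)⟩)
      (fun st ⟨hs, hv⟩ => by
        have hl : I.Loaded st := l1.congr fun a ha => hs a (by omega)
        obtain ⟨t1, -, t3⟩ := tryEnergy_spec (ρ := Function.update ρ 0 (k : ℤ)) hl
          (w1.congr (hs 18 (by omega))) hv (k := k) (by simp) rfl
        obtain ⟨c, hc, hq⟩ := t3 hpos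
        exact ⟨c, hc, fun P a b e h1 h2 h3 h4 => ⟨fun a ha => by rw [t1 a ha, hs a ha],
          hq P a b e h1 h2 h3 h4⟩⟩)
    rw [← hst] at this
    obtain ⟨c, hc, hq⟩ := this
    exact ⟨c, hc, fun P a b e h1 h2 h3 h4 => (hq P a b e h1 h2 h3 h4).2⟩

theorem HoldsSet.output_eq {O : Finset (Fin I.n)} (h : HoldsSet u 16 O) : I.output u = O := by
  ext i
  simp only [output, Finset.mem_filter, Finset.mem_univ, true_and]
  by_cases hi : i ∈ O
  · simp [hi, (h i).1 hi]
  · simp [hi, (h i).2 hi]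

end PackInstance

/-! ### The approximation guarantee -/

namespace PackInstance

variable {I : PackInstance}

/-- Only best columns are increased, and these have positive weight. The averaging over seeds needs
nonnegative weights on the sampled points. -/
theorem IsCount.pos_of_ne_zero {w : Fin I.n → ℤ} {B : ℕ} {c : ℕ → Fin I.n → ℕ}
    (h : I.IsCount w B c) : ∀ t ≤ I.n * I.rows, ∀ i, c t i ≠ 0 → 0 < w i := by
  intro t
  induction t with
  | zero => intro _ i hi; exact absurd (by rw [h.1]; rfl) hi
  | succ t ih =>
    intro ht i hi
    have hs := h.2 t (by omega)
    by_cases hst : Stopped (row (I := I)) (I.rowCap B) I.rows (c t)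
    · rw [hs.1 hst] at hi
      exact ih (by omega) i hi
    · obtain ⟨k, hk, he⟩ := hs.2 hst
      by_cases hik : i = k
      · subst hik; exact hk.1
      · rw [he, Function.update_of_ne hik] at hi
        exact ih (by omega) i hi

/-- Multiplicative weights lose the factor 11 and sampling the factor `256 * Λ`; the scale `H`
cancels, and `11 * 256 = 2816`. Since `Λ = Nat.log 2 B + 1 ≤ n + 1`, the required modulus is in the
range that the program searches. -/
theorem IsCount.exists_seed {w : Fin I.n → ℤ} {B : ℕ} {c : ℕ → Fin I.n → ℕ}
    (h : I.IsCount w B c) (hB1 : 1 ≤ B) (hBn : B ≤ I.n) {x : Fin I.n → ℝ} (hx : I.LPFeasible x)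
    (hxB : ∑ i, x i ≤ B) (hL : 0 < ∑ i, (w i : ℝ) * x i) :
    ∃ P a b e : ℕ, P < 128 * I.n * I.rows * (I.n + 1) + 1 ∧ a < P ∧ b < P ∧ e < P ∧
      ∑ i, (w i : ℝ) * x i ≤ 2816 * (Nat.log 2 B + 1 : ℕ) *
        ((∑ i ∈ I.survivors I.rows (c (I.n * I.rows)) (sample (c (I.n * I.rows)) P a b e), w i : ℤ)
          : ℝ) := by
  have hload := load_le_of_steps h.1 h.2 _ le_rfl
  have hH : 1 ≤ I.rows := by unfold rows; omega
  have hcap : ∀ r, I.rowCap B r ≤ I.capSum B := by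
    rintro (j | i | _)
    · exact (Finset.single_le_sum (fun _ _ => Nat.zero_le _) (Finset.mem_univ j)).trans
        (Nat.le_add_left _ _)
    · simp only [rowCap, capSum]; omega
    · simp [rowCap, capSum]
  have h1 := approx (A := row (I := I)) (b := I.rowCap B) (w := w)
    (by rintro (j | i | _); exacts [I.one_le_cap j, le_rfl, hB1])
    (show 1 ≤ I.capSum B by unfold capSum; omega) hcap
    (by simp only [Fintype.card_sum, Fintype.card_fin, Fintype.card_unit, rows]; omega)
    hH (fun i => ⟨.inr (.inl i), rfl, rfl⟩) h.1 h.2 (fun i => (hx.1 i).1)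
    (by
      rintro (j | i | _)
      · exact hx.2 j
      · simpa [row, rowCap] using (hx.1 i).2
      · simpa [row, rowCap] using hxB) hL
  set Λ := Nat.log 2 B + 1 with hΛ
  obtain ⟨P, hP, a, ha, b, hb, e, he, h2⟩ := exists_good_seed (I := I) (H := I.rows) (Λ := Λ)
    (c := c (I.n * I.rows)) (B := B) (w := fun i => (w i : ℝ)) (by omega) hH (by omega)
    (fun i => by simpa [load, row, rowCap] using hload (.inr (.inl i)))
    (fun j => hload (.inl j)) (hload (.inr (.inr ())))
    (Nat.lt_pow_succ_log_self one_lt_two B)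
    (fun i hi => by exact_mod_cast (h.pos_of_ne_zero _ le_rfl i hi).le)
  have hΛn : Λ ≤ I.n + 1 := by have := Nat.log_le_self 2 B; omega
  refine ⟨P, a, b, e, Nat.lt_succ_of_le (hP.trans (Nat.mul_le_mul_left _ hΛn)), ha, hb, he, ?_⟩
  have hHpos : (0 : ℝ) < I.rows := by exact_mod_cast hH
  refine le_of_mul_le_mul_right ?_ hHpos
  refine h1.trans ((mul_le_mul_of_nonneg_left h2 (by norm_num)).trans_eq ?_)
  push_cast
  rw [sample]
  ring

theorem denom_pos : 0 < I.denom := Finset.prod_pos fun i _ => by exact_mod_cast (I.weight i).den_pos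

theorem intWeight_eq (i : Fin I.n) : (I.intWeight i : ℚ) = I.denom * I.weight i := by
  have hd : ((I.weight i).den : ℤ) ∣ I.denom := Finset.dvd_prod_of_mem _ (Finset.mem_univ i)
  have h0 : ((I.weight i).den : ℚ) ≠ 0 := by exact_mod_cast (I.weight i).den_nz
  rw [intWeight, Int.cast_mul, Int.cast_div hd (by exact_mod_cast (I.weight i).den_nz)]
  conv_rhs => rw [← Rat.num_div_den (I.weight i)]
  push_cast
  field_simp

theorem sum_intWeight (S : Finset (Fin I.n)) :
    ((∑ i ∈ S, I.intWeight i : ℤ) : ℝ) = I.denom * (I.totalWeight S : ℝ) := by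
  have : ((∑ i ∈ S, I.intWeight i : ℤ) : ℚ) = I.denom * I.totalWeight S := by
    rw [totalWeight, Finset.mul_sum, Int.cast_sum]
    exact Finset.sum_congr rfl fun i _ => I.intWeight_eq i
  exact_mod_cast congrArg (fun q : ℚ => (q : ℝ)) this

theorem sum_intWeight_mul (x : Fin I.n → ℝ) :
    ∑ i, (I.intWeight i : ℝ) * x i = I.denom * I.lpValue x := by
  rw [lpValue, Finset.mul_sum]
  refine Finset.sum_congr rfl fun i _ => ?_
  have : (I.intWeight i : ℝ) = I.denom * I.weight i := by
    exact_mod_cast congrArg (fun q : ℚ => (q : ℝ)) (I.intWeight_eq i)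
  rw [this, mul_assoc]

/-- The linear program is a relaxation. -/
theorem opt_le_lpValue {x : Fin I.n → ℝ} (hx : I.LPOptimal x) : (I.opt : ℝ) ≤ I.lpValue x := by
  obtain ⟨S, hS, he⟩ := Finset.exists_mem_eq_sup' I.feasible_nonempty I.totalWeight
  simp only [Finset.mem_filter, Finset.mem_univ, true_and] at hS
  classical
  have hy := hx.2 (fun i => if i ∈ S then 1 else 0) ⟨fun i => by
    dsimp only; split_ifs <;> norm_num, fun j => by
    rw [Finset.sum_ite_mem, Finset.sum_const, nsmul_eq_mul, mul_one, Finset.inter_comm]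
    exact_mod_cast hS j⟩
  refine le_of_eq_of_le ?_ hy
  rw [opt, he, totalWeight, lpValue]
  simp [Finset.sum_ite_mem]

theorem energy_le {x : Fin I.n → ℝ} (hx : I.LPFeasible x) : I.energy x ≤ I.n := by
  refine (Finset.sum_le_sum fun i _ => (hx.1 i).2).trans ?_
  simp

/-- For `E ≤ 2` the left side is at most 2. Otherwise `B ≤ 2 * E`, so the left side is at most `2 +
log E / log 2`, and `1 / log 2 < 2`. -/
theorem log_ceil_le {E : ℝ} {B : ℕ} (hB : B = max 1 ⌈E⌉₊) :
    ((Nat.log 2 B + 1 : ℕ) : ℝ) ≤ 4 * max 1 (Real.log E) := by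
  have h1 : (1 : ℝ) ≤ max 1 (Real.log E) := le_max_left _ _
  by_cases hE : E ≤ 2
  · have hB2 : B ≤ 2 := by
      rw [hB]; exact max_le (by norm_num) (Nat.ceil_le.mpr (by simpa using hE))
    have : Nat.log 2 B ≤ 1 := (Nat.log_mono_right hB2).trans (by norm_num)
    have : ((Nat.log 2 B + 1 : ℕ) : ℝ) ≤ 2 := by exact_mod_cast Nat.succ_le_succ this
    linarith
  · push Not at hE
    have hB1 : B ≠ 0 := by rw [hB]; have := le_max_left 1 ⌈E⌉₊; omega
    have hBE : (B : ℝ) ≤ 2 * E := by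
      have : (⌈E⌉₊ : ℝ) < E + 1 := Nat.ceil_lt_add_one (by linarith)
      rw [hB, Nat.cast_max, Nat.cast_one]
      exact max_le (by linarith) (by linarith)
    have h2 : (2 : ℝ) ^ Nat.log 2 B ≤ B := by exact_mod_cast Nat.pow_log_le_self 2 hB1
    have h3 : (Nat.log 2 B : ℝ) * Real.log 2 ≤ Real.log 2 + Real.log E := by
      rw [← Real.log_pow, ← Real.log_mul (by norm_num) (by linarith)]
      exact Real.log_le_log (by positivity) (h2.trans hBE)
    have h4 := Real.log_two_gt_d9
    have h5 : Real.log E ≤ max 1 (Real.log E) := le_max_right _ _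
    push_cast
    nlinarith

/-- What the algorithm guarantees. -/
theorem isBicriteriaApprox_of_holdsBest {st : Store} {x : Fin I.n → ℝ} (hx : I.LPOptimal x)
    (h0 : I.HoldsBest I.intWeight 0 st)
    (h : (∃ i, 0 < I.intWeight i) → ∀ B, 1 ≤ B → B ≤ I.n →
      ∃ c, I.IsCount I.intWeight B c ∧ ∀ P a b e : ℕ,
        P < 128 * I.n * I.rows * (I.n + 1) + 1 → a < P → b < P → e < P →
        I.HoldsBest I.intWeight (∑ i ∈ I.survivors I.rows (c (I.n * I.rows))
          (sample (c (I.n * I.rows)) P a b e), I.intWeight i) st) :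
    I.IsBicriteriaApprox (11264 * max 1 (Real.log (I.energy x))) 2 (I.output st) := by
  have hM : (1 : ℝ) ≤ max 1 (Real.log (I.energy x)) := le_max_left _ _
  have hD : (0 : ℝ) < I.denom := by exact_mod_cast I.denom_pos
  have hout : ∀ v, I.HoldsBest I.intWeight v st → (v : ℝ) ≤ I.denom * I.totalWeight (I.output st) :=
    fun v ⟨O, hO, _, hv⟩ => by
      rw [hO.output_eq, ← sum_intWeight]
      exact_mod_cast hv
  refine ⟨?_, ?_⟩
  · rw [div_le_iff₀ (by positivity)]
    refine I.opt_le_lpValue hx |>.trans ?_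
    have hW := hout 0 h0
    rw [Int.cast_zero] at hW
    have hW0 : (0 : ℝ) ≤ I.totalWeight (I.output st) := nonneg_of_mul_nonneg_right hW hD
    -- If the linear program has no positive value, nonnegative output weight suffices; otherwise
    -- some weight is positive.
    by_cases hL : I.lpValue x ≤ 0
    · exact hL.trans (by positivity)
    · push Not at hL
      have hL' : 0 < ∑ i, (I.intWeight i : ℝ) * x i := by
        rw [sum_intWeight_mul]; positivity
      obtain ⟨i, -, hi⟩ := Finset.exists_lt_of_sum_lt (s := Finset.univ)
        (f := fun _ => (0 : ℝ)) (g := fun i => (I.intWeight i : ℝ) * x i) (by simpa using hL')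
      have hwi : 0 < I.intWeight i := by
        have := pos_of_mul_pos_left hi (hx.1.1 i).1
        exact_mod_cast this
      -- The program does not know `x`, but it tries this bound among others, and `x` satisfies the
      -- corresponding extra row.
      set B := max 1 ⌈I.energy x⌉₊ with hB
      have hBn : B ≤ I.n := max_le (by have := i.2; omega) (Nat.ceil_le.mpr (energy_le hx.1))
      obtain ⟨c, hc, hq⟩ := h ⟨i, hwi⟩ B (le_max_left _ _) hBn
      obtain ⟨P, a, b, e, hP, ha, hb, he, hle⟩ := hc.exists_seed (le_max_left _ _) hBn hx.1
        ((Nat.le_ceil _).trans (by exact_mod_cast le_max_right 1 ⌈I.energy x⌉₊)) hL'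
      have h2 := hout _ (hq P a b e hP ha hb he)
      rw [sum_intWeight_mul] at hle
      have h3 := log_ceil_le hB
      -- The final constant is `2816 * 4 = 11264`.
      have h4 : I.denom * I.lpValue x ≤
          2816 * (4 * max 1 (Real.log (I.energy x))) * (I.denom * I.totalWeight (I.output st)) :=
        hle.trans ((mul_le_mul_of_nonneg_left h2 (by positivity)).trans
          (mul_le_mul_of_nonneg_right (mul_le_mul_of_nonneg_left h3 (by norm_num)) hW))
      refine le_of_mul_le_mul_left (h4.trans_eq ?_) hD
      ring
  · obtain ⟨O, hO, hn, -⟩ := h0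
    rw [hO.output_eq]
    exact hn

end PackInstance

/-! ### Input size and initial memory -/

namespace Ram

theorem bits_getD_le (l : List ℤ) (k : ℕ) : bits (l.getD k 0) ≤ (l.map bits).sum + 1 := by
  by_cases hk : k < l.length
  · rw [List.getD_eq_getElem _ _ hk]
    exact (List.single_le_sum (fun _ _ => Nat.zero_le _) _
      (List.mem_map_of_mem (List.getElem_mem hk))).trans (Nat.le_succ _)
  · rw [List.getD_eq_default _ _ (by omega)]
    simp [bits]

theorem sum_bits_getD_le (input : List (List ℤ)) (a : ℕ) :
    ((input.getD a []).map bits).sum ≤ inputSize input := by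
  by_cases ha : a < input.length
  · rw [List.getD_eq_getElem _ _ ha]
    exact List.single_le_sum (fun _ _ => Nat.zero_le _) _
      (List.mem_map_of_mem (f := fun l : List ℤ => (l.map bits).sum) (List.getElem_mem ha))
  · rw [List.getD_eq_default _ _ (by omega)]
    simp

theorem bits_initial_le (input : List (List ℤ)) (a : ℕ) (i : ℤ) :
    bits (initial input a i) ≤ inputSize input + 1 := by
  rw [initial]
  split_ifs
  · exact (bits_getD_le _ _).trans (Nat.succ_le_succ (sum_bits_getD_le input a))
  · simp [bits]

theorem length_le_sum_bits (l : List ℤ) : l.length ≤ (l.map bits).sum := by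
  have := List.length_le_sum_of_one_le (l.map bits) (fun x hx => by
    obtain ⟨z, -, rfl⟩ := List.mem_map.mp hx
    exact one_le_bits z)
  simpa using this

theorem runPars_ne {a : ℕ} (ha : a ≠ 40) (ρ : ℕ → ℤ) (l : List Term) :
    ∀ (c : ℕ) (u : Store), runPars ρ l c u a = u a := by
  induction l with
  | nil => intro c u; rfl
  | cons e l ih => intro c u; rw [runPars, ih, setCell_ne _ _ _ ha]

end Ram

namespace PackInstance

variable {I : PackInstance}

/-- Every entry of a list costs at least one bit. -/
theorem add_le_inputSize : I.n + I.m ≤ inputSize I.encode := by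
  have h1 := length_le_sum_bits (List.ofFn fun i => (I.point i).1.num)
  have h2 := length_le_sum_bits (List.ofFn fun j => (I.cap j : ℤ))
  rw [List.length_ofFn] at h1 h2
  simp only [inputSize, encode, List.map_cons, List.sum_cons, List.map_nil, List.sum_nil]
  omega

theorem initial_ofFn {input : List (List ℤ)} {a n : ℕ} {f : Fin n → ℤ}
    (h : input.getD a [] = List.ofFn f) (i : Fin n) : initial input a (i : ℕ) = f i := by
  rw [initial, if_pos (by omega), h, Int.toNat_natCast, List.getD_eq_getElem _ _ (by simp),
    List.getElem_ofFn]

theorem holds_runPars {ρ : ℕ → ℤ} {l : List Term} {c : ℕ} {input : List (List ℤ)} {a n : ℕ}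
    {f : Fin n → ℤ} (ha : a ≠ 40) (h : input.getD a [] = List.ofFn f) :
    Holds (runPars ρ l c (initial input)) a f := fun i => by
  rw [runPars_ne ha]
  exact initial_ofFn h i

theorem loaded_runPars (ρ : ℕ → ℤ) : I.Loaded (runPars ρ params 0 (initial I.encode)) := by
  have hn : initial I.encode 0 0 = I.n := by simp [initial, encode]
  have hm : initial I.encode 0 1 = I.m := by simp [initial, encode]
  constructor
  case xnum => exact holds_runPars (a := 1) (by omega) rfl
  case xden => exact holds_runPars (a := 2) (by omega) rfl
  case ynum => exact holds_runPars (a := 3) (by omega) rfl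
  case yden => exact holds_runPars (a := 4) (by omega) rfl
  case lnum => exact holds_runPars (a := 7) (by omega) rfl
  case lden => exact holds_runPars (a := 8) (by omega) rfl
  case rnum => exact holds_runPars (a := 9) (by omega) rfl
  case rden => exact holds_runPars (a := 10) (by omega) rfl
  case bnum => exact holds_runPars (a := 11) (by omega) rfl
  case bden => exact holds_runPars (a := 12) (by omega) rfl
  case tnum => exact holds_runPars (a := 13) (by omega) rfl
  case tden => exact holds_runPars (a := 14) (by omega) rfl
  case cap => exact holds_runPars (a := 15) (by omega) rfl
  all_goals simp [params, runPars, setCell, hn, hm, rows]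

/-- The bound for the moduli, `128 * n * H * (n + 1) + 1`, is cubic in `n + m + 2`, hence the
exponent 3. -/
theorem parsLt_params (ρ : ℕ → ℤ) {Z : ℕ} (hZ : 200 * (I.n + I.m + 2) ^ 3 ≤ Z) :
    ParsLt Z ρ params 0 (initial I.encode) := by
  have hn : initial I.encode 0 0 = I.n := by simp [initial, encode]
  have hm : initial I.encode 0 1 = I.m := by simp [initial, encode]
  simp only [params, ParsLt, eval_lit, eval_get, eval_add, eval_mul, setCell,
    Function.update_apply]
  norm_num [hn, hm]
  have h : (200 * (I.n + I.m + 2) ^ 3 : ℤ) ≤ Z := by exact_mod_cast hZ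
  have hN : (0 : ℤ) ≤ I.n := by omega
  have hM : (0 : ℤ) ≤ I.m := by omega
  set N : ℤ := (I.n : ℤ) with hN_def
  set M : ℤ := (I.m : ℤ) with hM_def
  have h1 : (N + M + 2) * 1 ≤ (N + M + 2) * (N + M + 2) ^ 2 :=
    mul_le_mul_of_nonneg_left (one_le_pow₀ (by omega)) (by omega)
  have h2 : N * (N + M + 1) * (N + 1) ≤ (N + M + 2) * (N + M + 2) * (N + M + 2) := by
    gcongr <;> omega
  have h3 : N * (N + M + 1) * 1 ≤ N * (N + M + 1) * (N + 1) :=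
    mul_le_mul_of_nonneg_left (by omega) (by positivity)
  have h4 : 0 ≤ N * (N + M + 1) := by positivity
  have h5 : 128 * N * (N + M + 1) * (N + 1) = 128 * (N * (N + M + 1) * (N + 1)) := by ring
  have h6 : (N + M + 2) * (N + M + 2) * (N + M + 2) = (N + M + 2) ^ 3 := by ring
  have h7 : (N + M + 2) * (N + M + 2) ^ 2 = (N + M + 2) ^ 3 := by ring
  rw [h5]
  generalize N * (N + M + 1) * (N + 1) = q at *
  generalize N * (N + M + 1) = r at *
  generalize (N + M + 2) ^ 3 = y at *
  omega

end PackInstance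

theorem mainTheorem5 :
    ∃ (prog : Ram.Prog) (T : Polynomial ℕ) (C : ℝ), 0 < C ∧
      ∀ I : PackInstance, ∃ (s : Ram.Store) (t : ℕ),
        Ram.Exec prog (Ram.initial I.encode) s t ∧
        t ≤ T.eval (Ram.inputSize I.encode) ∧
        ∀ x : Fin I.n → ℝ, I.LPOptimal x →
          I.IsBicriteriaApprox (C * max 1 (Real.log (I.energy x))) 2 (I.output s) := by
  obtain ⟨T₁, h₁⟩ := exec_setPars (κ := fun a => 60 * a + 1) (fun _ => 0) params params_ok 0
  obtain ⟨T₂, h₂⟩ := Cmd.exec_comp (κ := fun a => 60 * a + 1) Cmd.main 0 Cmd.main_ok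
  -- Exceeds the bit lengths of all input numbers as well as the values of all parameters; the two
  -- parts of the program run in time `Z ^ T₁` and `Z ^ T₂`.
  let Zp : Polynomial ℕ := 200 * (Polynomial.X + 2) ^ 3
  refine ⟨program, Zp ^ T₁ + Zp ^ T₂ + 1, 11264, by norm_num, fun I => ?_⟩
  set u := initial I.encode with hu
  have hnm := I.add_le_inputSize
  obtain ⟨Z, hZ⟩ : ∃ Z, Z = 200 * (inputSize I.encode + 2) ^ 3 := ⟨_, rfl⟩
  have hZ3 : 200 * (I.n + I.m + 2) ^ 3 ≤ Z := by
    rw [hZ]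
    exact Nat.mul_le_mul_left _ (Nat.pow_le_pow_left (by omega) 3)
  have hZs : inputSize I.encode + 2 ≤ Z := by
    have := Nat.le_self_pow (n := 3) (by norm_num) (inputSize I.encode + 2)
    omega
  have hB : Bounded (fun a => 60 * a + 1) Z u := by
    refine ⟨fun a _ i => ?_, fun c => ?_⟩
    · exact ((bits_initial_le _ a i).trans (by omega)).trans (Nat.le_self_pow (by omega) Z)
    · have : u 40 c = 0 := by simp [hu, initial, PackInstance.encode]
      omega
  obtain ⟨s₁, τ₁, e₁, t₁, m₁, b₁⟩ := h₁ Z u (by omega) hB (PackInstance.parsLt_params _ hZ3) u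
    ⟨fun _ _ => rfl, fun v hv => absurd hv (by omega)⟩
  obtain ⟨s₂, τ₂, e₂, t₂, m₂, -⟩ := h₂ Z _ (fun _ => 0) (by omega) b₁
    (fun v hv => absurd hv (by omega)) s₁ m₁
  refine ⟨s₂, τ₁ + τ₂ + 1, .seq e₁ e₂, ?_, fun x hx => ?_⟩
  · have hZe : Zp.eval (inputSize I.encode) = Z := by simp [Zp, hZ]
    simp only [Polynomial.eval_add, Polynomial.eval_pow, Polynomial.eval_one, hZe]
    omega
  · obtain ⟨g₁, g₂⟩ := PackInstance.main_spec (I := I) (ρ := fun _ => 0)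
      (PackInstance.loaded_runPars (fun _ => 0))
      (PackInstance.holds_runPars (by omega) rfl)
      (PackInstance.holds_runPars (by omega) rfl)
      -- Array 16 is not part of the input, so its cells are 0 and represent the empty set.
      (fun i => ⟨fun h => absurd h (Finset.notMem_empty i), fun _ => by
        rw [runPars_ne (by omega)]; simp [initial, PackInstance.encode]⟩) rfl
    have := PackInstance.isBicriteriaApprox_of_holdsBest hx g₁ g₂
    have he : I.output s₂ = I.output (Cmd.main.run 0 (fun _ => 0)
        (runPars (fun _ => 0) params 0 (initial I.encode))) := by
      simp only [PackInstance.output, m₂.user 16 (by omega), hu]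
    rwa [he]
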